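/- **Algebras.** Let $A$ be a finite-dimensional Hopf algebra over a field $k$ with invertible antipode $\gamma$; write $\bar\gamma=\gamma^{-1}$, and $\Delta(x)=\sum x'\otimes x''$, $(\Delta\otimes 1)\Delta(x)=\sum x'\otimes x''\otimes x'''$. The dual $A^*$ has the product $(fg)(x)=\sum f(x')g(x'')$, and $\sum f'\otimes f''$ is determined by $\sum f'(x)f''(y)=f(xy)$. Let $(e_a)$ be a basis of $A$ with dual basis $(e^a)$. The Drinfeld double $D(A)$ and the Heisenberg double $H(A)$ are the space $A^*\otimes A$ with the unit $1\otimes1$ and, respectively, the products $$(f\otimes a)(g\otimes b)=\sum f\,g(\bar\gamma(a''')\,?\,a')\otimes a''b,\qquad (f\otimes a)(g\otimes b)=\sum f\,g(?\,a')\otimes a''b .$$ Let $R=\sum_a(1\otimes e_a)\otimes(e^a\otimes1)=\sum\alpha\otimes\beta\in D(A)^{\otimes2}$, let $\gamma(f\otimes a)=(1\otimes\gamma(a))(\bar\gamma^*(f)\otimes1)$ be the antipode of $D(A)$, and let $u=\sum\gamma(\beta)\alpha$. Put $D(A)^\theta=D(A)[\theta]/(\theta^2-u\gamma(u))$ with $\theta$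 central. Let $\phi\colon D(A)\to H(A)\otimes H(A)^{\mathrm{op}}$ be the algebra homomorphism with $\phi(1\otimes a)=\sum(1\otimes a')\otimes(1\otimes\gamma(a''))$ and $\phi(f\otimes1)=\sum(f''\otimes1)\otimes(\bar\gamma^*(f')\otimes1)$. Let $C$ be any subset of $H(A)\otimes H(A)^{\mathrm{op}}$ that contains the image of $\phi$ (for instance the image itself, or everything), and let $\mathcal H=(H(A)\otimes H(A)^{\mathrm{op}})^{\bar\theta}$ be the algebra obtained from $H(A)\otimes H(A)^{\mathrm{op}}$ by adjoining an element $\bar\theta$ with $\bar\theta^2=\phi(u\gamma(u))$ that commutes with the elements of $C$. Extend $\phi$ to $D(A)^\theta\to\mathcal H$ by $\phi(\theta)=\bar\theta$. For an algebra $B$ and a component of a tangle let $B_i$ be $B$ if the component has boundary, and $B$ modulo the span of the commutators $ab-ba$ if it is closed. **Diagrams.** Let $D$ be an oriented tangle diagram, with components ordered as $D_1,\dots,D_n$, that is pasted horizontally and vertically from copies of vertical strands, crossings of two strands, local maxima and local minima, and let $T$ be the framed ordered tangle that it represents by the blackboard framing. In a crossing one strand runs between the lower left and the upper right (the *slash*),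 the other one between the lower right and the upper left. Labels are read off along a component against the orientation and their product is written from left to right; on a closed component one reads from a base point. **$J$.** A crossing gets the label $(\gamma'\otimes\gamma')(R)$ if the slash is the over strand and $(\gamma'\otimes\gamma')(R^{-1})$ otherwise, where the first tensorand is put on the under strand and the second on the over strand, and each $\gamma'$ is $\gamma$ if that strand goes up and the identity if it goes down. A local maximum that runs from left to right gets $u^{-1}\theta$, a local minimum that runs from left to right gets $u\theta^{-1}$; nothing else is labelled. The products along the components (summed over the terms of the labels) give the universal quantum invariant $J(T)=J(D)\in\bigotimes_i D(A)^\theta_i$ of the framed ordered tangle $T$, computed from its diagram $D$. **$J'$.** Let $\zeta(D)$ be obtained from $D$ by doubling every strand; the copy on the left (with respect to the orientation) is thick, the other one thin. In $A\otimes A^*$ put $$S=\sum e_a\otimes e^a,\quad S'=\sum\gamma(e_a)\otimes e^a,\quad S''=\sum e_a\otimes\bar\gamma^*(e^a),\quad \tilde S=\sum\gamma(e_a)\otimes\bar\gamma^*(e^a),$$ and, for each of them, $X^{-1}=(\gamma\otimes1)(X)$ (these are the inverses in $A\otimes A^*$, $A^{\mathrm{op}}\otimes A^*$, $A\otimes(A^*)^{\mathrm{op}}$,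 $A^{\mathrm{op}}\otimes(A^*)^{\mathrm{op}}$). A crossing of $\zeta(D)$ with under strand and over strand (thin, thin), (thick, thin), (thin, thick), (thick, thick) gets the label $(\gamma'\otimes(\bar\gamma^*)')(X)$ with $X=S,S',S'',\tilde S$ respectively if the slash is the over strand, and $(\gamma'\otimes(\bar\gamma^*)')(X^{-1})$ otherwise; the first tensorand, viewed as $1\otimes a$, is put on the under strand, the second one, viewed as $f\otimes1$, on the over strand, and $\gamma'$, $(\bar\gamma^*)'$ stand for $\gamma$, $\bar\gamma^*$ if the strand goes up and for the identity if it goes down. The thin copy of $D_i$ is read in $H(A)$ and the thick copy in $H(A)^{\mathrm{op}}$, and the two products form the $i$th tensorand of $J'(D)\in\mathcal H^{\otimes n}$, where for a closed component both are read from the two copies of a base point. **$J''$.** Let $D_{(\leftarrow)}$ be obtained from $D$ by replacing each local maximum that runs from left to right with a right-to-left maximum above a crossing whose under strand is passed first and goes up, and each local minimum that runs from left to right with a right-to-left minimum below a crossing whose under strand is passed first and goes down. Let $d(D_i)$ be the number of left-to-right maxima minus the number of left-to-right minima of $D_i$. Let $J''(D)\in\bigotimes_i\mathcal H_i$ be the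 class of $\bigl(\prod_i\bar\theta_i^{\,d(D_i)}\bigr)J'(D_{(\leftarrow)})$, where $\bar\theta_i$ is $\bar\theta$ in the $i$th tensorand, multiplying from the left. **Theorem.** For every such $D$, and for all choices of the base points for $J(D)$ and of the base points on $D$ for $J''(D)$, $$\phi^{\otimes n}(J(T))=J''(D)\qquad\text{in }\ \bigotimes_i(H(A)\otimes H(A)^{\mathrm{op}})^{\bar\theta}_i .$$ -/

import Mathlib

open scoped TensorProduct
open Coalgebra HopfAlgebra WithConv

set_option linter.unusedSectionVars false
set_option linter.unusedVariables false

noncomputable section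

section Twisted
variable {k B A : Type*} [CommRing k] [Ring B] [Algebra k B] [Ring A] [Algebra k A]

/-- The natural map `End B ⊗ End A → End (B ⊗ A)`. -/
def endTensor : Module.End k B ⊗[k] Module.End k A →ₐ[k] Module.End k (B ⊗[k] A) :=
  Module.endTensorEndAlgHom (R := k) (S := k) (A := k) (M := B) (N := A)

@[simp] lemma endTensor_tmul (T : Module.End k B) (U : Module.End k A) (g : B) (b : A) :
    endTensor (k := k) (T ⊗ₜ[k] U) (g ⊗ₜ b) = T g ⊗ₜ U b := rfl

/-- The exchange operators: if `δ a = ∑ Tᵢ ⊗ aᵢ`, then `exch δ a (g ⊗ b) = ∑ Tᵢ g ⊗ aᵢ b`. -/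
def exch (δ : A →ₐ[k] Module.End k B ⊗[k] A) : A →ₐ[k] Module.End k (B ⊗[k] A) :=
  endTensor.comp
    ((Algebra.TensorProduct.map (AlgHom.id k (Module.End k B)) (Algebra.lmul k A)).comp δ)

/-- Left multiplication by an element of the first factor of `B ⊗ A`. -/
def lmulFst : B →ₐ[k] Module.End k (B ⊗[k] A) :=
  endTensor.comp
    (Algebra.TensorProduct.includeLeft.comp (Algebra.lmul k B))

/-- The twisted multiplication: `(f ⊗ a) (g ⊗ b) = ∑ f (Tᵢ g) ⊗ aᵢ b` if `δ a = ∑ Tᵢ ⊗ aᵢ`. -/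
def twistedMul (δ : A →ₐ[k] Module.End k B ⊗[k] A) :
    B ⊗[k] A →ₗ[k] Module.End k (B ⊗[k] A) :=
  TensorProduct.lift ((LinearMap.mul k (Module.End k (B ⊗[k] A))).compl₁₂
    (lmulFst (A := A)).toLinearMap (exch δ).toLinearMap)

/-- The conditions on `δ` under which the twisted multiplication is unital and associative. -/
class IsTwist (δ : A →ₐ[k] Module.End k B ⊗[k] A) : Prop where
  exch_one : ∀ a, exch δ a (1 ⊗ₜ 1) = 1 ⊗ₜ a
  exch_mul : ∀ a g h, exch δ a ((g * h) ⊗ₜ 1) = twistedMul δ (exch δ a (g ⊗ₜ 1)) (h ⊗ₜ 1)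

lemma twistedMul_tmul (δ : A →ₐ[k] Module.End k B ⊗[k] A) (f : B) (a : A) :
    twistedMul δ (f ⊗ₜ a) = lmulFst f * exch δ a := rfl

lemma lmulFst_tmul (f g : B) (a : A) : lmulFst (k := k) f (g ⊗ₜ[k] a) = (f * g) ⊗ₜ a := by
  simp [lmulFst]

/-- Right multiplication by an element of the second factor of `B ⊗ A`. -/
def rmulSnd (b : A) : Module.End k (B ⊗[k] A) := LinearMap.lTensor B (LinearMap.mulRight k b)

lemma exch_rmul (δ : A →ₐ[k] Module.End k B ⊗[k] A) (a b : A) (x : B ⊗[k] A) :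
    exch δ a (rmulSnd b x) = rmulSnd b (exch δ a x) := by
  simp only [exch, AlgHom.comp_apply]
  induction δ a with
  | zero => simp
  | add => simp_all
  | tmul T c =>
    induction x with
    | zero => simp
    | add => simp_all
    | tmul f d => simp [rmulSnd, mul_assoc]

lemma lmul_rmul (f : B) (b : A) (x : B ⊗[k] A) :
    lmulFst f (rmulSnd b x) = rmulSnd b (lmulFst f x) := by
  induction x with
  | zero => simp
  | add => simp_all
  | tmul g d => simp [rmulSnd, lmulFst]

lemma twistedMul_rmul (δ : A →ₐ[k] Module.End k B ⊗[k] A) (b : A) (x y : B ⊗[k] A) :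
    twistedMul δ x (rmulSnd b y) = rmulSnd b (twistedMul δ x y) := by
  induction x with
  | zero => simp
  | add => simp_all
  | tmul g d => simp [twistedMul_tmul, exch_rmul, lmul_rmul]

lemma twistedMul_lmulFst (δ : A →ₐ[k] Module.End k B ⊗[k] A) (f : B) (x : B ⊗[k] A) :
    twistedMul δ (lmulFst f x) = lmulFst f * twistedMul δ x := by
  induction x with
  | zero => simp
  | add => simp_all [mul_add]
  | tmul g d => simp [twistedMul_tmul, lmulFst_tmul, map_mul, mul_assoc]

lemma twistedMul_rmulSnd (δ : A →ₐ[k] Module.End k B ⊗[k] A) (b : A) (x : B ⊗[k] A) :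
    twistedMul δ (rmulSnd b x) = twistedMul δ x * exch δ b := by
  induction x with
  | zero => simp
  | add => simp_all [add_mul]
  | tmul g d => simp [twistedMul_tmul, rmulSnd, map_mul, mul_assoc]

lemma exch_mul_lmulFst (δ : A →ₐ[k] Module.End k B ⊗[k] A) [IsTwist δ] (a : A) (g : B) :
    exch δ a * lmulFst g = twistedMul δ (exch δ a (g ⊗ₜ 1)) := by
  ext h c
  have e : ∀ h : B, h ⊗ₜ[k] c = rmulSnd c (h ⊗ₜ[k] (1 : A)) := fun h => by simp [rmulSnd]
  simp only [TensorProduct.AlgebraTensorModule.curry_apply, LinearMap.restrictScalars_self,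
    TensorProduct.curry_apply, Module.End.mul_apply, lmulFst_tmul]
  rw [e, e, exch_rmul, twistedMul_rmul, IsTwist.exch_mul]

lemma twistedMul_twistedMul (δ : A →ₐ[k] Module.End k B ⊗[k] A) [IsTwist δ] (x y : B ⊗[k] A) :
    twistedMul δ (twistedMul δ x y) = twistedMul δ x * twistedMul δ y := by
  induction x with
  | zero => simp
  | add => simp_all [add_mul]
  | tmul f a =>
    induction y with
    | zero => simp
    | add => simp_all [mul_add]
    | tmul g b =>
      have e : g ⊗ₜ[k] b = rmulSnd b (g ⊗ₜ[k] (1 : A)) := by simp [rmulSnd]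
      rw [e, twistedMul_rmul, twistedMul_rmulSnd, twistedMul_tmul, Module.End.mul_apply,
        twistedMul_lmulFst, ← exch_mul_lmulFst, twistedMul_rmulSnd, twistedMul_tmul]
      simp [mul_assoc]

/-- The space `B ⊗ A` with the twisted multiplication. -/
def Twisted (_δ : A →ₐ[k] Module.End k B ⊗[k] A) : Type _ := B ⊗[k] A

namespace Twisted
variable (δ : A →ₐ[k] Module.End k B ⊗[k] A)

instance : AddCommGroup (Twisted δ) := inferInstanceAs (AddCommGroup (B ⊗[k] A))
instance : Module k (Twisted δ) := inferInstanceAs (Module k (B ⊗[k] A))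
instance [Module.Finite k B] [Module.Finite k A] : Module.Finite k (Twisted δ) :=
  inferInstanceAs (Module.Finite k (B ⊗[k] A))

/-- The pure tensor `f ⊗ a` as an element of the twisted tensor product. -/
def mk (f : B) (a : A) : Twisted δ := f ⊗ₜ[k] a

/-- The identity map from `B ⊗ A`. -/
def ofTensor : B ⊗[k] A ≃ₗ[k] Twisted δ := LinearEquiv.refl k _

instance : Mul (Twisted δ) := ⟨fun x y => ofTensor δ (twistedMul δ ((ofTensor δ).symm x) ((ofTensor δ).symm y))⟩
instance : One (Twisted δ) := ⟨mk δ 1 1⟩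

lemma mul_def (x y : Twisted δ) :
    x * y = ofTensor δ (twistedMul δ ((ofTensor δ).symm x) ((ofTensor δ).symm y)) := rfl

lemma one_def : (1 : Twisted δ) = mk δ 1 1 := rfl

lemma mk_eq (f : B) (a : A) : mk δ f a = ofTensor δ (f ⊗ₜ a) := rfl

variable [IsTwist δ]

instance : Ring (Twisted δ) :=
  { (inferInstance : AddCommGroup (Twisted δ)) with
    mul := (· * ·)
    one := 1
    mul_assoc := fun x y z => by simp [mul_def, twistedMul_twistedMul]
    one_mul := fun x => by
      simp [mul_def, one_def, mk_eq, twistedMul_tmul]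
    mul_one := fun x => by
      simp only [mul_def, one_def, mk_eq, LinearEquiv.symm_apply_apply]
      obtain ⟨x, rfl⟩ := (ofTensor δ).surjective x
      congr 1
      simp only [LinearEquiv.symm_apply_apply]
      induction x with
      | zero => simp
      | add => simp_all
      | tmul f a => simp [twistedMul_tmul, IsTwist.exch_one, lmulFst_tmul]
    left_distrib := fun x y z => by simp [mul_def]
    right_distrib := fun x y z => by simp [mul_def]
    zero_mul := fun x => by simp [mul_def]
    mul_zero := fun x => by simp [mul_def] }

instance : Algebra k (Twisted δ) :=
  Algebra.ofModule (fun r x y => by simp [mul_def]) (fun r x y => by simp [mul_def])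

/-- The first factor as a subalgebra. -/
def inl : B →ₐ[k] Twisted δ :=
  AlgHom.ofLinearMap ((ofTensor δ).toLinearMap ∘ₗ (TensorProduct.mk k B A).flip 1) rfl
    (fun f g => by simp [mul_def, twistedMul_tmul, lmulFst_tmul])

/-- The second factor as a subalgebra. -/
def inr : A →ₐ[k] Twisted δ :=
  AlgHom.ofLinearMap ((ofTensor δ).toLinearMap ∘ₗ TensorProduct.mk k B A 1) rfl
    (fun a b => by
      have e : (1 : B) ⊗ₜ[k] b = rmulSnd b ((1 : B) ⊗ₜ[k] (1 : A)) := by simp [rmulSnd]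
      simp only [mul_def, LinearMap.comp_apply, TensorProduct.mk_apply, LinearEquiv.coe_coe,
        LinearEquiv.symm_apply_apply, twistedMul_tmul, map_one, one_mul]
      rw [e, exch_rmul, IsTwist.exch_one]
      simp [rmulSnd])

lemma inl_apply (f : B) : inl δ f = mk δ f 1 := rfl
lemma inr_apply (a : A) : inr δ a = mk δ 1 a := rfl

lemma inl_mul_inr (f : B) (a : A) : inl δ f * inr δ a = mk δ f a := by
  simp [inl_apply, inr_apply, mk_eq, mul_def, twistedMul_tmul, lmulFst_tmul]

lemma inr_mul_inl (a : A) (g : B) : inr δ a * inl δ g = ofTensor δ (exch δ a (g ⊗ₜ 1)) := by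
  simp [inl_apply, inr_apply, mk_eq, mul_def, twistedMul_tmul]

/-- The linear map induced by maps out of the two factors. -/
def liftLin {C : Type*} [Ring C] [Algebra k C] (p : B →ₐ[k] C) (q : A →ₐ[k] C) : Twisted δ →ₗ[k] C :=
  TensorProduct.lift ((LinearMap.mul k C).compl₁₂ p.toLinearMap q.toLinearMap) ∘ₗ
    (ofTensor δ).symm.toLinearMap

/-- Algebra maps out of a twisted tensor product. -/
def lift {C : Type*} [Ring C] [Algebra k C] (p : B →ₐ[k] C) (q : A →ₐ[k] C)
    (h : ∀ a g, q a * p g = liftLin δ p q (inr δ a * inl δ g)) : Twisted δ →ₐ[k] C :=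
  AlgHom.ofLinearMap (liftLin δ p q)
    (by simp [one_def, mk_eq, liftLin]) (by
      have key : ∀ f (x : Twisted δ) b,
          liftLin δ p q (inl δ f * x * inr δ b) = p f * liftLin δ p q x * q b := by
        intro f x b
        obtain ⟨x, rfl⟩ := (ofTensor δ).surjective x
        induction x with
        | zero => simp
        | add => simp_all [mul_add, add_mul]
        | tmul g c =>
          rw [← mk_eq, ← inl_mul_inr]
          simp only [← mul_assoc, ← map_mul]
          rw [mul_assoc _ (inr δ c), ← map_mul, inl_mul_inr, inl_mul_inr]
          simp [liftLin, mk_eq, mul_assoc]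
      intro x y
      obtain ⟨x, rfl⟩ := (ofTensor δ).surjective x
      obtain ⟨y, rfl⟩ := (ofTensor δ).surjective y
      induction x with
      | zero => simp
      | add => simp_all [add_mul]
      | tmul f a =>
        induction y with
        | zero => simp
        | add => simp_all [mul_add]
        | tmul g b =>
          have e : ofTensor δ (f ⊗ₜ a) * ofTensor δ (g ⊗ₜ b)
              = inl δ f * (inr δ a * inl δ g) * inr δ b := by
            simp only [← mk_eq, ← inl_mul_inr, mul_assoc]
          rw [e, key, ← h]
          simp [liftLin, mul_assoc])

end Twisted
end Twisted

section Doubles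
variable (k A : Type*) [Field k] [Ring A] [HopfAlgebra k A]

/-- The dual `A^*` with the convolution product `(f g)(x) = ∑ f (x') g (x'')`. -/
abbrev DualAlg := WithConv (A →ₗ[k] k)

instance [Module.Finite k A] : Module.Finite k (DualAlg k A) :=
  Module.Finite.equiv (WithConv.linearEquiv k (A →ₗ[k] k)).symm

variable {A}
/-- `transp T f = f ∘ T`. -/
def transp : Module.End k A →ₗ[k] Module.End k (DualAlg k A) :=
  LinearMap.mk₂ k (fun T f => toConv (f.ofConv ∘ₗ T)) (fun _ _ _ => by ext; simp)
    (fun _ _ _ => by ext; simp) (fun _ _ _ => by ext; simp) (fun _ _ _ => by ext; simp)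

@[simp] lemma transp_apply (T : Module.End k A) (f : DualAlg k A) (x : A) :
    (transp k T f) x = f (T x) := rfl

variable (A)
/-- The left action `a ▷ g = g (? a)` on the dual. -/
def dualActR : A →ₐ[k] Module.End k (DualAlg k A) :=
  AlgHom.ofLinearMap (transp k ∘ₗ (LinearMap.mul k A).flip)
    (by ext; simp) (fun a b => by ext; simp [mul_assoc])

@[simp] lemma dualActR_apply (a : A) (f : DualAlg k A) (x : A) :
    (dualActR k A a f) x = f (x * a) := rfl

/-- The coaction defining the Heisenberg double: `a ↦ ∑ (g ↦ g (? a')) ⊗ a''`. -/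
def heisCoaction : A →ₐ[k] Module.End k (DualAlg k A) ⊗[k] A :=
  (Algebra.TensorProduct.map (dualActR k A) (AlgHom.id k A)).comp (Bialgebra.comulAlgHom k A)

lemma dual_mul_apply {ι : Type*} (f g : DualAlg k A) (x : A) (r : Repr k x ι) :
    (f * g) x = ∑ i ∈ r.index, f (r.left i) * g (r.right i) := r.convMul_apply f g

variable {k A}
lemma exch_heis {ι : Type*} {a : A} (r : Repr k a ι) (g : DualAlg k A) (b : A) :
    exch (heisCoaction k A) a (g ⊗ₜ b) =
      ∑ i ∈ r.index, dualActR k A (r.left i) g ⊗ₜ (r.right i * b) := by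
  simp [exch, heisCoaction, ← r.eq]

lemma dualActR_one (a : A) : dualActR k A a 1 = counit (R := k) a • 1 := by
  ext x; simp [mul_comm]

lemma dualActR_mul {ι : Type*} {a : A} (r : Repr k a ι) (g h : DualAlg k A) :
    dualActR k A a (g * h) =
      ∑ i ∈ r.index, dualActR k A (r.left i) g * dualActR k A (r.right i) h := by
  ext x
  have := dual_mul_apply k A g h (x * a) ((ℛ k x).mul r)
  simp only [dualActR_apply, LinearMap.coe_sum, ofConv_sum, Finset.sum_apply] at *
  rw [this]
  simp_rw [dual_mul_apply k A _ _ x (ℛ k x)]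
  simp [Finset.sum_product]
  rw [Finset.sum_comm]

instance : IsTwist (heisCoaction k A) where
  exch_one a := by
    rw [exch_heis (ℛ k a)]
    simp_rw [dualActR_one, TensorProduct.smul_tmul, mul_one, ← TensorProduct.tmul_sum]
    rw [sum_counit_smul]
  exch_mul a g h := by
    rw [exch_heis (ℛ k a), exch_heis (ℛ k a)]
    simp only [map_sum, LinearMap.sum_apply, twistedMul_tmul, Module.End.mul_apply, mul_one]
    simp_rw [exch_heis (ℛ k _), dualActR_mul (ℛ k _), map_sum, lmulFst_tmul, mul_one,
      TensorProduct.sum_tmul]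
    have := congr((TensorProduct.map (LinearMap.mul' k (DualAlg k A) ∘ₗ TensorProduct.map
      ((dualActR k A).toLinearMap.flip g) ((dualActR k A).toLinearMap.flip h)) LinearMap.id)
        ((TensorProduct.assoc k A A A).symm $(sum_tmul_tmul_eq (ℛ k a)
          (fun i => ℛ k ((ℛ k a).left i)) (fun i => ℛ k ((ℛ k a).right i)))))
    simpa using this

end Doubles

section D
variable (k A : Type*) [Field k] [Ring A] [HopfAlgebra k A]

/-- The antipode is invertible. -/
class BijectiveAntipode : Prop where
  bijective : Function.Bijective (antipode k (A := A))

variable {k A}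

lemma comul_antipode (a : A) : comul (R := k) (antipode k a) =
    TensorProduct.map (antipode k) (antipode k) (TensorProduct.comm k A A (comul a)) := by
  have h : toConv (TensorProduct.map (antipode k) (antipode k) ∘ₗ
      (TensorProduct.comm k A A).toLinearMap ∘ₗ comul) = toConv (comul ∘ₗ antipode k (A := A)) := by
    refine left_inv_eq_right_inv (a := toConv (comul (R := k) (A := A))) ?_ LinearMap.comul_right_inv
    let c : A ⊗[k] A →ₗ[k] A := LinearMap.mul' k A ∘ₗ (antipode k).rTensor A
    have hc : ∀ x : A, c (comul x) = algebraMap k A (counit x) := mul_antipode_rTensor_comul_apply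
    have hc' : ∀ x y : A, c (x ⊗ₜ y) = antipode k x * y := fun _ _ => rfl
    have t : (TensorProduct.assoc k A A A).symm.toLinearMap.lTensor A ∘ₗ
        (TensorProduct.assoc k A A (A ⊗[k] A)).toLinearMap ∘ₗ
        TensorProduct.map comul comul ∘ₗ comul (R := k) (A := A) =
        TensorProduct.map LinearMap.id (TensorProduct.map comul LinearMap.id ∘ₗ comul) ∘ₗ comul := by
      simp only [coassoc_simps]
    ext a
    trans TensorProduct.map c c (TensorProduct.leftComm k A (A ⊗[k] A) A
      (((TensorProduct.assoc k A A A).symm.toLinearMap.lTensor A ∘ₗ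
        (TensorProduct.assoc k A A (A ⊗[k] A)).toLinearMap ∘ₗ
        TensorProduct.map comul comul ∘ₗ comul (R := k) (A := A)) a))
    · simp only [LinearMap.convMul_apply, LinearMap.comp_apply]
      induction comul (R := k) a with
      | zero => simp
      | add => simp_all
      | tmul x y =>
        simp only [TensorProduct.map_tmul, LinearMap.comp_apply]
        induction comul (R := k) x with
        | zero => simp
        | add => simp_all [TensorProduct.add_tmul]
        | tmul x y' =>
          induction comul (R := k) y with
          | zero => simp
          | add => simp_all [TensorProduct.tmul_add]
          | tmul x y => simp [hc']
    · rw [t]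
      have : ∀ y : A, ∀ p : A, TensorProduct.map c c (TensorProduct.leftComm k A (A ⊗[k] A) A
          (p ⊗ₜ (TensorProduct.map comul LinearMap.id (comul y)))) = 1 ⊗ₜ c (p ⊗ₜ y) := by
        intro y p
        conv_rhs => rw [← sum_counit_smul (ℛ k y)]
        rw [← (ℛ k y).eq]
        simp [hc, hc', Algebra.algebraMap_eq_smul_one, TensorProduct.smul_tmul, TensorProduct.tmul_sum]
      trans (TensorProduct.mk k A A 1 ∘ₗ c) (comul a)
      · simp only [LinearMap.comp_apply]
        induction comul (R := k) a with
        | zero => simp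
        | add => simp_all [TensorProduct.tmul_add]
        | tmul p y => simpa using this y p
      · simp [hc, Algebra.algebraMap_eq_smul_one,
          Algebra.TensorProduct.one_def]
  exact congr($h a).symm

variable (k A)
variable [BijectiveAntipode k A]
/-- The inverse `γ⁻¹` of the antipode. -/
def antipodeInv : A →ₗ[k] A :=
  (LinearEquiv.ofBijective (antipode k (A := A)) BijectiveAntipode.bijective).symm.toLinearMap

variable {k A}
@[simp] lemma antipode_antipodeInv (a : A) : antipode k (antipodeInv k A a) = a :=
  (LinearEquiv.ofBijective (antipode k (A := A)) BijectiveAntipode.bijective).apply_symm_apply a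
@[simp] lemma antipodeInv_antipode (a : A) : antipodeInv k A (antipode k a) = a :=
  (LinearEquiv.ofBijective (antipode k (A := A)) BijectiveAntipode.bijective).symm_apply_apply a

lemma antipode_inj {a b : A} (h : antipode k a = antipode k b) : a = b :=
  BijectiveAntipode.bijective.1 h

lemma antipodeInv_mul (a b : A) : antipodeInv k A (a * b) = antipodeInv k A b * antipodeInv k A a :=
  antipode_inj (k := k) (by simp [antipode_mul_antidistrib])

@[simp] lemma antipodeInv_one : antipodeInv k A 1 = 1 := antipode_inj (k := k) (by simp)

@[simp] lemma counit_antipodeInv (a : A) : counit (R := k) (antipodeInv k A a) = counit a := by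
  rw [← counit_antipode, antipode_antipodeInv]

lemma comul_antipodeInv (a : A) : comul (R := k) (antipodeInv k A a) =
    TensorProduct.map (antipodeInv k A) (antipodeInv k A) (TensorProduct.comm k A A (comul a)) := by
  obtain ⟨a, rfl⟩ := BijectiveAntipode.bijective (k := k) |>.2 a
  rw [comul_antipode, antipodeInv_antipode, ← (ℛ k a).eq]
  simp

lemma coassoc_five : (TensorProduct.assoc k A A (A ⊗[k] (A ⊗[k] A))).toLinearMap ∘ₗ
    TensorProduct.map comul (TensorProduct.map LinearMap.id comul) ∘ₗ
    TensorProduct.map LinearMap.id comul ∘ₗ comul =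
    TensorProduct.map LinearMap.id ((TensorProduct.map LinearMap.id
      (TensorProduct.assoc k A A A).toLinearMap ∘ₗ
        (TensorProduct.assoc k A (A ⊗[k] A) A).toLinearMap) ∘ₗ
      TensorProduct.map (TensorProduct.map LinearMap.id comul ∘ₗ comul) LinearMap.id) ∘ₗ
      TensorProduct.map LinearMap.id comul ∘ₗ (comul (R := k) (A := A)) := by
  simp only [coassoc_simps]

variable (k A)
/-- The left action `a ▷ g = g (γ⁻¹(a) ?)` on the dual. -/
def dualActL : A →ₐ[k] Module.End k (DualAlg k A) :=
  AlgHom.ofLinearMap (transp k ∘ₗ LinearMap.mul k A ∘ₗ antipodeInv k A)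
    (by ext; simp) (fun a b => by ext; simp [mul_assoc, antipodeInv_mul])

@[simp] lemma dualActL_apply (a : A) (f : DualAlg k A) (x : A) :
    (dualActL k A a f) x = f (antipodeInv k A a * x) := rfl

lemma dualActR_L_commute (a b : A) : Commute (dualActR k A a) (dualActL k A b) := by
  ext f x; simp [mul_assoc]

/-- The coaction defining the Drinfeld double. -/
def drinCoaction : A →ₐ[k] Module.End k (DualAlg k A) ⊗[k] A :=
  (Algebra.TensorProduct.lift
    (Algebra.TensorProduct.includeLeft.comp (dualActR k A))
    ((Algebra.TensorProduct.map (dualActL k A) (AlgHom.id k A)).comp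
      (Algebra.TensorProduct.comm k A A).toAlgHom)
    (fun a x => by
      induction x with
      | zero => simp
      | add x y hx hy => simpa using hx.add_right hy
      | tmul x y =>
        simp [Commute, SemiconjBy, (dualActR_L_commute k A _ _).eq])).comp
  ((Algebra.TensorProduct.map (AlgHom.id k A) (Bialgebra.comulAlgHom k A)).comp
    (Bialgebra.comulAlgHom k A))

variable {k A}
lemma exch_drin {ι : Type*} {κ : ι → Type*} {a : A} (r : Repr k a ι)
    (s : ∀ i, Repr k (r.right i) (κ i)) (g : DualAlg k A) (b : A) :
    exch (drinCoaction k A) a (g ⊗ₜ b) =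
      ∑ i ∈ r.index, ∑ j ∈ (s i).index,
        dualActR k A (r.left i) (dualActL k A ((s i).right j) g) ⊗ₜ ((s i).left j * b) := by
  simp [exch, drinCoaction, ← r.eq, ← (s _).eq, TensorProduct.tmul_sum]

lemma dualActL_mul {ι : Type*} {a : A} (r : Repr k a ι) (g h : DualAlg k A) :
    dualActL k A a (g * h) =
      ∑ i ∈ r.index, dualActL k A (r.right i) g * dualActL k A (r.left i) h := by
  let r' : Repr k (antipodeInv k A a) ι :=
    { index := r.index, left := fun i => antipodeInv k A (r.right i),
      right := fun i => antipodeInv k A (r.left i),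
      eq := by rw [comul_antipodeInv, ← r.eq]; simp }
  ext x
  have := dual_mul_apply k A g h (antipodeInv k A a * x) (r'.mul (ℛ k x))
  simp only [dualActL_apply, LinearMap.coe_sum, ofConv_sum, Finset.sum_apply] at *
  rw [this]
  simp_rw [dual_mul_apply k A _ _ x (ℛ k x)]
  simp [Finset.sum_product, r']

lemma dualActL_one (a : A) : dualActL k A a 1 = counit (R := k) a • 1 := by
  ext x
  simp

lemma sum_smul_counit' {ι : Type*} {a : A} (r : Repr k a ι) :
    ∑ i ∈ r.index, counit (R := k) (r.right i) • r.left i = a := by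
  have h := congr(TensorProduct.rid k A $(sum_tmul_counit_eq r))
  simpa only [map_sum, TensorProduct.rid_tmul, one_smul] using h

/-- Auxiliary rearrangement `p ⊗ q ⊗ r ⊗ s ⊗ t ↦ r ⊗ ((p ⊗ t) ⊗ (q ⊗ s))`. -/
def rearrFive : A ⊗[k] (A ⊗[k] (A ⊗[k] (A ⊗[k] A))) →ₗ[k]
    A ⊗[k] ((A ⊗[k] A) ⊗[k] (A ⊗[k] A)) :=
  (TensorProduct.assoc k A A (A ⊗[k] A)).symm.toLinearMap.lTensor A ∘ₗ
  ((TensorProduct.comm k (A ⊗[k] A) A).toLinearMap.lTensor A).lTensor A ∘ₗ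
  (TensorProduct.leftComm k A A ((A ⊗[k] A) ⊗[k] A)).toLinearMap ∘ₗ
  ((TensorProduct.assoc k A A A).symm.toLinearMap.lTensor A ∘ₗ
    (TensorProduct.leftComm k A A (A ⊗[k] A)).toLinearMap).lTensor A

lemma rearrFive_tmul (p q r s t : A) : rearrFive (k := k) (p ⊗ₜ (q ⊗ₜ (r ⊗ₜ (s ⊗ₜ t)))) =
    r ⊗ₜ ((p ⊗ₜ t) ⊗ₜ (q ⊗ₜ s)) := rfl

/-- Auxiliary: `a ⊗ c ↦ (x ↦ g (γ⁻¹(c) x a))`. -/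
def biAct (g : DualAlg k A) : A ⊗[k] A →ₗ[k] DualAlg k A :=
  TensorProduct.lift ((((LinearMap.mul k (Module.End k (DualAlg k A))).compl₁₂
    (dualActR k A).toLinearMap (dualActL k A).toLinearMap)).compr₂ (LinearMap.applyₗ g))

lemma biAct_tmul (g : DualAlg k A) (a c : A) :
    biAct g (a ⊗ₜ c) = dualActR k A a (dualActL k A c g) := rfl

/-- Auxiliary contraction. -/
def contrFive (g h : DualAlg k A) : A ⊗[k] (A ⊗[k] (A ⊗[k] (A ⊗[k] A))) →ₗ[k] DualAlg k A ⊗[k] A :=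
  (TensorProduct.comm k A (DualAlg k A)).toLinearMap ∘ₗ
    (LinearMap.mul' k (DualAlg k A) ∘ₗ TensorProduct.map (biAct g) (biAct h)).lTensor A ∘ₗ rearrFive

lemma contrFive_tmul (g h : DualAlg k A) (p q r s t : A) :
    contrFive g h (p ⊗ₜ (q ⊗ₜ (r ⊗ₜ (s ⊗ₜ t)))) =
      (dualActR k A p (dualActL k A t g) * dualActR k A q (dualActL k A s h)) ⊗ₜ r := rfl

instance : IsTwist (drinCoaction k A) where
  exch_one a := by
    rw [exch_drin (ℛ k a) (fun i => ℛ k _)]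
    have inner : ∀ i, ∑ j ∈ (ℛ k ((ℛ k a).right i)).index,
        dualActR k A ((ℛ k a).left i) (dualActL k A ((ℛ k ((ℛ k a).right i)).right j) 1) ⊗ₜ[k]
          ((ℛ k ((ℛ k a).right i)).left j * 1) =
        1 ⊗ₜ[k] (counit (R := k) ((ℛ k a).left i) • (ℛ k a).right i) := by
      intro i
      conv_rhs => rw [← sum_smul_counit' (ℛ k ((ℛ k a).right i)), Finset.smul_sum]
      simp only [dualActL_one, map_smul, dualActR_one, mul_one, TensorProduct.smul_tmul,
        TensorProduct.tmul_sum]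
    simp_rw [inner, ← TensorProduct.tmul_sum, sum_counit_smul]
  exch_mul a g h := by
    have key := congr(contrFive g h ($(coassoc_five (k := k) (A := A)) a))
    trans (contrFive g h) (((TensorProduct.assoc k A A (A ⊗[k] (A ⊗[k] A))).toLinearMap ∘ₗ
      TensorProduct.map comul (TensorProduct.map LinearMap.id comul) ∘ₗ
      TensorProduct.map LinearMap.id comul ∘ₗ comul) a)
    · rw [exch_drin (ℛ k a) (fun i => ℛ k _)]
      simp only [LinearMap.comp_apply]
      rw [← (ℛ k a).eq]
      simp only [map_sum, TensorProduct.map_tmul, LinearMap.id_apply, mul_one]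
      refine Finset.sum_congr rfl fun i _ => ?_
      rw [← (ℛ k ((ℛ k a).right i)).eq]
      simp only [map_sum, TensorProduct.map_tmul, LinearMap.id_apply, TensorProduct.tmul_sum]
      refine Finset.sum_congr rfl fun j _ => ?_
      rw [dualActL_mul (ℛ k _)]
      simp only [map_sum]
      simp_rw [dualActR_mul (ℛ k ((ℛ k a).left i))]
      rw [← (ℛ k ((ℛ k a).left i)).eq, ← (ℛ k ((ℛ k ((ℛ k a).right i)).right j)).eq]
      simp only [map_sum, TensorProduct.tmul_sum, TensorProduct.sum_tmul]
      refine Finset.sum_congr rfl fun _ _ => Finset.sum_congr rfl fun _ _ => rfl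
    · rw [key]
      rw [exch_drin (ℛ k a) (fun i => ℛ k _)]
      simp only [LinearMap.comp_apply]
      rw [← (ℛ k a).eq]
      simp only [map_sum, TensorProduct.map_tmul, LinearMap.id_apply, mul_one, LinearMap.sum_apply]
      refine Finset.sum_congr rfl fun i _ => ?_
      rw [← (ℛ k ((ℛ k a).right i)).eq]
      simp only [map_sum, TensorProduct.map_tmul, LinearMap.id_apply, TensorProduct.tmul_sum]
      refine Finset.sum_congr rfl fun j _ => ?_
      rw [twistedMul_tmul, Module.End.mul_apply, exch_drin (ℛ k _) (fun i => ℛ k _)]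
      simp only [LinearMap.comp_apply, TensorProduct.map_tmul]
      rw [← (ℛ k ((ℛ k ((ℛ k a).right i)).left j)).eq]
      simp only [map_sum, TensorProduct.map_tmul, LinearMap.id_apply, TensorProduct.tmul_sum,
        TensorProduct.sum_tmul]
      refine Finset.sum_congr rfl fun l _ => ?_
      rw [← (ℛ k ((ℛ k ((ℛ k ((ℛ k a).right i)).left j)).right l)).eq]
      simp only [map_sum, TensorProduct.tmul_sum, TensorProduct.sum_tmul, lmulFst_tmul, mul_one]
      refine Finset.sum_congr rfl fun _ _ => rfl
end D

section Phi
variable (k A : Type*) [Field k] [Ring A] [HopfAlgebra k A]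

/-- The Heisenberg double. -/
abbrev Heis := Twisted (heisCoaction k A)

/-- `H(A) ⊗ H(A)^op`. -/
abbrev HHop := Heis k A ⊗[k] (Heis k A)ᵐᵒᵖ

/-- The Drinfeld double. -/
abbrev Drin [BijectiveAntipode k A] := Twisted (drinCoaction k A)

/-- The pairing of `A^* ⊗ A^*` with `A ⊗ A`. -/
def dualPair : DualAlg k A ⊗[k] DualAlg k A →ₗ[k] Module.Dual k (A ⊗[k] A) :=
  TensorProduct.dualDistrib k A A ∘ₗ
    TensorProduct.map (WithConv.linearEquiv k (A →ₗ[k] k)).toLinearMap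
      (WithConv.linearEquiv k (A →ₗ[k] k)).toLinearMap

variable {k A}
lemma dualPair_tmul (f g : DualAlg k A) (x y : A) :
    dualPair k A (f ⊗ₜ g) (x ⊗ₜ y) = f x * g y := by
  simp [dualPair]

lemma dualPair_transp (S T : Module.End k A) (u : DualAlg k A ⊗[k] DualAlg k A) (x y : A) :
    dualPair k A (TensorProduct.map (transp k S) (transp k T) u) (x ⊗ₜ y) =
      dualPair k A u (S x ⊗ₜ T y) := by
  induction u with
  | zero => simp
  | add => simp_all
  | tmul f g => simp [dualPair_tmul]

variable [Module.Finite k A]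
lemma dualPair_ext {u v : DualAlg k A ⊗[k] DualAlg k A}
    (h : ∀ x y, dualPair k A u (x ⊗ₜ y) = dualPair k A v (x ⊗ₜ y)) : u = v := by
  have : dualPair k A u = dualPair k A v := TensorProduct.ext' h
  have inj : Function.Injective (dualPair k A) :=
    (TensorProduct.dualDistribEquiv k A A).injective.comp
      (TensorProduct.congr (WithConv.linearEquiv k (A →ₗ[k] k))
        (WithConv.linearEquiv k (A →ₗ[k] k))).injective
  exact inj this

variable (k A)
/-- The comultiplication of `A^*`, transpose of the multiplication:
`∑ f' ⊗ f''` with `∑ f'(x) f''(y) = f (x y)`. -/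
def dualComul : DualAlg k A →ₗ[k] DualAlg k A ⊗[k] DualAlg k A :=
  (TensorProduct.congr (WithConv.linearEquiv k (A →ₗ[k] k))
      (WithConv.linearEquiv k (A →ₗ[k] k))).symm.toLinearMap ∘ₗ
    (TensorProduct.dualDistribEquiv k A A).symm.toLinearMap ∘ₗ
    (LinearMap.mul' k A).dualMap ∘ₗ (WithConv.linearEquiv k (A →ₗ[k] k)).toLinearMap

variable {k A}
lemma dualPair_dualComul (f : DualAlg k A) (x y : A) :
    dualPair k A (dualComul k A f) (x ⊗ₜ y) = f (x * y) := by
  have h : dualPair k A (dualComul k A f) = (LinearMap.mul' k A).dualMap f.ofConv :=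
    ((TensorProduct.congr (WithConv.linearEquiv k (A →ₗ[k] k)) (WithConv.linearEquiv k (A →ₗ[k] k))).trans
      (TensorProduct.dualDistribEquiv k A A)).apply_symm_apply _
  rw [h]; simp

/-- Auxiliary: the product of `A^* ⊗ (A^*)^op` carried to `A^* ⊗ A^*`. -/
def mulMulOp : DualAlg k A ⊗[k] DualAlg k A →ₗ[k] DualAlg k A ⊗[k] DualAlg k A →ₗ[k]
    DualAlg k A ⊗[k] DualAlg k A :=
  TensorProduct.map₂ (LinearMap.mul k (DualAlg k A)) (LinearMap.mul k (DualAlg k A)).flip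

lemma op_mulMulOp (u v : DualAlg k A ⊗[k] DualAlg k A) :
    (MulOpposite.opLinearEquiv k).toLinearMap.lTensor (DualAlg k A) (mulMulOp u v) =
      (MulOpposite.opLinearEquiv k).toLinearMap.lTensor (DualAlg k A) u *
      (MulOpposite.opLinearEquiv k).toLinearMap.lTensor (DualAlg k A) v := by
  change _ = Algebra.TensorProduct.mul (R := k) (A := DualAlg k A) (B := (DualAlg k A)ᵐᵒᵖ) _ _
  induction u with
  | zero => simp only [map_zero, LinearMap.zero_apply]
  | add x y hx hy => simp only [map_add, LinearMap.add_apply, hx, hy]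
  | tmul f g =>
    induction v with
    | zero => simp only [map_zero]
    | add x y hx hy => simp only [map_add, hx, hy]
    | tmul f' g' => simp [mulMulOp]

lemma dualPair_mulMulOp (u v : DualAlg k A ⊗[k] DualAlg k A) {ι κ : Type*} {x y : A}
    (r : Repr k x ι) (s : Repr k y κ) :
    dualPair k A (mulMulOp u v) (x ⊗ₜ y) = ∑ i ∈ r.index, ∑ j ∈ s.index,
      dualPair k A u (r.left i ⊗ₜ s.right j) * dualPair k A v (r.right i ⊗ₜ s.left j) := by
  induction u with
  | zero => simp
  | add => simp_all [add_mul, Finset.sum_add_distrib]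
  | tmul f g =>
    induction v with
    | zero => simp
    | add => simp_all [mul_add, Finset.sum_add_distrib]
    | tmul f' g' =>
      have e : mulMulOp (f ⊗ₜ[k] g) (f' ⊗ₜ g') = (f * f') ⊗ₜ (g' * g) := rfl
      rw [e, dualPair_tmul, dual_mul_apply k A _ _ _ r, dual_mul_apply k A _ _ _ s,
        Finset.sum_mul_sum]
      simp only [dualPair_tmul]
      refine Finset.sum_congr rfl fun _ _ => Finset.sum_congr rfl fun _ _ => by ring

variable [BijectiveAntipode k A]
variable (k A)

/-- `f ↦ ∑ f'' ⊗ γ⁻¹*(f')`. -/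
def dualSplit : DualAlg k A →ₗ[k] DualAlg k A ⊗[k] DualAlg k A :=
  (transp k (antipodeInv k A)).lTensor (DualAlg k A) ∘ₗ
    (TensorProduct.comm k _ _).toLinearMap ∘ₗ dualComul k A

variable {k A} in
lemma dualPair_comm (u : DualAlg k A ⊗[k] DualAlg k A) (x y : A) :
    dualPair k A (TensorProduct.comm k _ _ u) (x ⊗ₜ y) = dualPair k A u (y ⊗ₜ x) := by
  induction u with
  | zero => simp
  | add => simp_all
  | tmul f g => simp [dualPair_tmul, mul_comm]

variable {k A} in
lemma dualPair_dualSplit (f : DualAlg k A) (x y : A) :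
    dualPair k A (dualSplit k A f) (x ⊗ₜ y) = f (antipodeInv k A y * x) := by
  have : ∀ u, (transp k (antipodeInv k A)).lTensor (DualAlg k A) u =
      TensorProduct.map (transp k LinearMap.id) (transp k (antipodeInv k A)) u := fun u => by
    congr 1
  simp only [dualSplit, LinearMap.comp_apply, this, dualPair_transp]
  simp only [LinearMap.id_apply, LinearEquiv.coe_coe]
  rw [dualPair_comm, dualPair_dualComul]

/-- `φ` on `A^*` : `f ↦ ∑ (f'' ⊗ 1) ⊗ (γ⁻¹*(f') ⊗ 1)`. -/
def phiDual : DualAlg k A →ₐ[k] HHop k A :=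
  (Algebra.TensorProduct.map (Twisted.inl (heisCoaction k A))
    (AlgHom.op (Twisted.inl (heisCoaction k A)))).comp
  (AlgHom.ofLinearMap ((MulOpposite.opLinearEquiv k).toLinearMap.lTensor (DualAlg k A) ∘ₗ dualSplit k A)
    (by
      have : dualSplit k A 1 = 1 ⊗ₜ 1 := dualPair_ext fun x y => by
        rw [dualPair_dualSplit]; simp [dualPair_tmul, mul_comm]
      simp [this, Algebra.TensorProduct.one_def])
    (fun f g => by
      rw [LinearMap.comp_apply, LinearMap.comp_apply, LinearMap.comp_apply, ← op_mulMulOp]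
      congr 1
      refine dualPair_ext fun x y => ?_
      let r' : Repr k (antipodeInv k A y) (A × A) :=
        { index := (ℛ k y).index, left := fun i => antipodeInv k A ((ℛ k y).right i),
          right := fun i => antipodeInv k A ((ℛ k y).left i),
          eq := by rw [comul_antipodeInv, ← (ℛ k y).eq]; simp }
      rw [dualPair_dualSplit, dualPair_mulMulOp _ _ (ℛ k x) (ℛ k y),
        dual_mul_apply k A f g _ (r'.mul (ℛ k x))]
      simp only [dualPair_dualSplit]
      simp only [r', Repr.mul_index, Repr.mul_left, Repr.mul_right, Finset.sum_product]
      rw [Finset.sum_comm]))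

/-- `φ` on `A` : `a ↦ ∑ (1 ⊗ a') ⊗ (1 ⊗ γ(a''))`. -/
def phiAlg : A →ₐ[k] HHop k A :=
  (Algebra.TensorProduct.map (Twisted.inr (heisCoaction k A))
    ((AlgHom.op (Twisted.inr (heisCoaction k A))).comp (antipodeAlgHomOp k A))).comp
  (Bialgebra.comulAlgHom k A)

/-- Auxiliary: `(f ⊗ g) ⊗ (b ⊗ c) ↦ (f ⊗ b) ⊗ (g ⊗ c)`. -/
def shuffleHH : (DualAlg k A ⊗[k] DualAlg k A) ⊗[k] (A ⊗[k] A) →ₗ[k] HHop k A :=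
  TensorProduct.map (Twisted.ofTensor (heisCoaction k A)).toLinearMap
    ((MulOpposite.opLinearEquiv k).toLinearMap ∘ₗ
      (Twisted.ofTensor (heisCoaction k A)).toLinearMap) ∘ₗ
  (TensorProduct.tensorTensorTensorComm k (DualAlg k A) (DualAlg k A) A A).toLinearMap

variable {k A}

lemma shuffleHH_tmul (f g : DualAlg k A) (b c : A) :
    shuffleHH k A ((f ⊗ₜ g) ⊗ₜ (b ⊗ₜ c)) = Twisted.mk (heisCoaction k A) f b ⊗ₜ
      MulOpposite.op (Twisted.mk (heisCoaction k A) g c) := rfl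

/-- Auxiliary: the element of `A^* ⊗ A^*` that is `g (e γ⁻¹(y) x a)` at `(x, y)`. -/
def splitAct (g : DualAlg k A) : A ⊗[k] A →ₗ[k] DualAlg k A ⊗[k] DualAlg k A :=
  TensorProduct.lift (LinearMap.mk₂ k
    (fun a e => (dualActR k A a).rTensor (DualAlg k A)
      (dualSplit k A (transp k (LinearMap.mulLeft k e) g)))
    (fun _ _ _ => by simp [LinearMap.rTensor_add])
    (fun _ _ _ => by simp [LinearMap.rTensor_smul])
    (fun m x y => by
      rw [← map_add, ← map_add, ← LinearMap.add_apply, ← map_add]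
      congr; ext; simp [add_mul])
    (fun c m x => by
      rw [← map_smul, ← map_smul, ← LinearMap.smul_apply, ← map_smul]
      congr; ext; simp))

lemma rTensor_dualActR (a x y : A) (u : DualAlg k A ⊗[k] DualAlg k A) :
    dualPair k A ((dualActR k A a).rTensor (DualAlg k A) u) (x ⊗ₜ y) =
      dualPair k A u ((x * a) ⊗ₜ y) := by
  induction u with
  | zero => simp
  | add => simp_all
  | tmul f g => simp [dualPair_tmul]

lemma lTensor_dualActR (a x y : A) (u : DualAlg k A ⊗[k] DualAlg k A) :
    dualPair k A ((dualActR k A a).lTensor (DualAlg k A) u) (x ⊗ₜ y) =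
      dualPair k A u (x ⊗ₜ (y * a)) := by
  induction u with
  | zero => simp
  | add => simp_all
  | tmul f g => simp [dualPair_tmul]

lemma dualPair_splitAct (g : DualAlg k A) (a e x y : A) :
    dualPair k A (splitAct g (a ⊗ₜ e)) (x ⊗ₜ y) = g (e * (antipodeInv k A y * (x * a))) := by
  simp [splitAct, rTensor_dualActR, dualPair_dualSplit]

/-- Auxiliary contraction. -/
def contrPhi (g : DualAlg k A) : A ⊗[k] (A ⊗[k] (A ⊗[k] A)) →ₗ[k] HHop k A :=
  shuffleHH k A ∘ₗ TensorProduct.map (splitAct g) ((antipode k).lTensor A) ∘ₗ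
    (TensorProduct.assoc k A A (A ⊗[k] A)).symm.toLinearMap ∘ₗ
    ((TensorProduct.comm k (A ⊗[k] A) A).toLinearMap ∘ₗ
      (TensorProduct.assoc k A A A).symm.toLinearMap).lTensor A

lemma contrPhi_tmul (g : DualAlg k A) (p q r e : A) :
    contrPhi g (p ⊗ₜ (q ⊗ₜ (r ⊗ₜ e))) =
      shuffleHH k A (splitAct g (p ⊗ₜ e) ⊗ₜ (q ⊗ₜ antipode k r)) := rfl

/-- Auxiliary: `s ⊗ t ↦ γ⁻¹(t) s`. -/
def invMulSwap : A ⊗[k] A →ₗ[k] A :=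
  LinearMap.mul' k A ∘ₗ (antipodeInv k A).rTensor A ∘ₗ (TensorProduct.comm k A A).toLinearMap

lemma invMulSwap_comul (a : A) : invMulSwap (comul (R := k) a) = algebraMap k A (counit a) := by
  refine antipode_inj (k := k) ?_
  have : antipode k (invMulSwap (comul (R := k) a)) =
      LinearMap.mul' k A ((antipode k).rTensor A (comul (R := k) a)) := by
    rw [← (ℛ k a).eq]
    simp [invMulSwap, antipode_mul_antidistrib]
  rw [this, mul_antipode_rTensor_comul_apply]
  simp [Algebra.algebraMap_eq_smul_one]

lemma coassoc_phi : TensorProduct.map LinearMap.id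
      ((TensorProduct.map LinearMap.id (TensorProduct.assoc k A A A).toLinearMap ∘ₗ
        (TensorProduct.assoc k A (A ⊗[k] A) A).toLinearMap) ∘ₗ
      TensorProduct.map (TensorProduct.map LinearMap.id comul ∘ₗ comul) LinearMap.id) ∘ₗ
      TensorProduct.map LinearMap.id comul ∘ₗ (comul (R := k) (A := A)) =
    TensorProduct.map LinearMap.id (TensorProduct.map LinearMap.id
      (TensorProduct.map LinearMap.id comul ∘ₗ comul)) ∘ₗ
      TensorProduct.map LinearMap.id comul ∘ₗ (comul (R := k) (A := A)) := by
  simp only [coassoc_simps]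

variable (k A) in
/-- Auxiliary: `p ⊗ q ⊗ r ⊗ s ⊗ t ↦ p ⊗ q ⊗ r ⊗ γ⁻¹(t) s`. -/
def squash : A ⊗[k] (A ⊗[k] (A ⊗[k] (A ⊗[k] A))) →ₗ[k] A ⊗[k] (A ⊗[k] (A ⊗[k] A)) :=
  ((invMulSwap (k := k) (A := A)).lTensor A |>.lTensor A).lTensor A

lemma squash_tmul (p q r s t : A) : squash k A (p ⊗ₜ (q ⊗ₜ (r ⊗ₜ (s ⊗ₜ t)))) =
    p ⊗ₜ (q ⊗ₜ (r ⊗ₜ (antipodeInv k A t * s))) := rfl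

/-- Auxiliary: the map `f ⊗ g ↦ (f ⊗ 1) ⊗ (g ⊗ 1)` from `A^* ⊗ A^*`. -/
def embDual : DualAlg k A ⊗[k] DualAlg k A →ₗ[k] HHop k A :=
  (Algebra.TensorProduct.map (Twisted.inl (heisCoaction k A))
    (AlgHom.op (Twisted.inl (heisCoaction k A)))).toLinearMap ∘ₗ
    (MulOpposite.opLinearEquiv k).toLinearMap.lTensor (DualAlg k A)

lemma embDual_tmul (f g : DualAlg k A) : embDual (k := k) (A := A) (f ⊗ₜ g) =
    Twisted.inl (heisCoaction k A) f ⊗ₜ MulOpposite.op (Twisted.inl (heisCoaction k A) g) := rfl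

lemma phiDual_eq (g : DualAlg k A) : phiDual k A g = embDual (dualSplit k A g) := rfl

lemma phiAlg_eq {ι : Type*} {a : A} (r : Repr k a ι) : phiAlg k A a = ∑ i ∈ r.index,
    Twisted.inr (heisCoaction k A) (r.left i) ⊗ₜ[k]
      MulOpposite.op (Twisted.inr (heisCoaction k A) (antipode k (r.right i))) := by
  simp only [phiAlg, AlgHom.comp_apply, Bialgebra.comulAlgHom_apply]
  rw [← r.eq, map_sum]
  rfl

lemma embDual_mul {ι : Type*} (u : DualAlg k A ⊗[k] DualAlg k A) (b : A) {c : A} (r : Repr k c ι) :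
    embDual u * (Twisted.inr (heisCoaction k A) b ⊗ₜ[k]
      MulOpposite.op (Twisted.inr (heisCoaction k A) c)) =
    ∑ i ∈ r.index, shuffleHH k A
      ((dualActR k A (r.left i)).lTensor (DualAlg k A) u ⊗ₜ (b ⊗ₜ r.right i)) := by
  induction u with
  | zero => simp
  | add x y hx hy => simp only [map_add, add_mul, hx, hy, TensorProduct.add_tmul,
      Finset.sum_add_distrib]
  | tmul f g =>
    rw [embDual_tmul, Algebra.TensorProduct.tmul_mul_tmul, ← MulOpposite.op_mul,
      Twisted.inr_mul_inl, exch_heis r, Twisted.inl_mul_inr]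
    simp only [map_sum, Finset.op_sum, TensorProduct.tmul_sum, mul_one]
    rfl

lemma mul_embDual {ι : Type*} (u : DualAlg k A ⊗[k] DualAlg k A) {b : A} (c : A) (r : Repr k b ι) :
    (Twisted.inr (heisCoaction k A) b ⊗ₜ[k]
      MulOpposite.op (Twisted.inr (heisCoaction k A) c)) * embDual u =
    ∑ i ∈ r.index, shuffleHH k A
      ((dualActR k A (r.left i)).rTensor (DualAlg k A) u ⊗ₜ (r.right i ⊗ₜ c)) := by
  induction u with
  | zero => simp
  | add x y hx hy => simp only [map_add, mul_add, hx, hy, TensorProduct.add_tmul,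
      Finset.sum_add_distrib]
  | tmul f g =>
    rw [embDual_tmul, Algebra.TensorProduct.tmul_mul_tmul, ← MulOpposite.op_mul,
      Twisted.inr_mul_inl, exch_heis r, Twisted.inl_mul_inr]
    simp only [map_sum, TensorProduct.sum_tmul, mul_one]
    rfl

lemma coassoc_phi' : TensorProduct.map LinearMap.id (TensorProduct.map LinearMap.id
      (TensorProduct.map LinearMap.id comul ∘ₗ comul)) ∘ₗ
      TensorProduct.map LinearMap.id comul ∘ₗ (comul (R := k) (A := A)) =
    (TensorProduct.map LinearMap.id (TensorProduct.map LinearMap.id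
      (TensorProduct.map LinearMap.id comul)) ∘ₗ
    (TensorProduct.assoc k A A (A ⊗[k] A)).toLinearMap) ∘ₗ
      TensorProduct.map comul comul ∘ₗ (comul (R := k) (A := A)) := by
  simp only [coassoc_simps]

lemma squash_counit (p q b : A) : squash k A (TensorProduct.map LinearMap.id
    (TensorProduct.map LinearMap.id (TensorProduct.map LinearMap.id comul))
      (p ⊗ₜ (q ⊗ₜ comul b))) = p ⊗ₜ (q ⊗ₜ (b ⊗ₜ 1)) := by
  have : ∀ z : A ⊗[k] A, squash k A (TensorProduct.map LinearMap.id
    (TensorProduct.map LinearMap.id (TensorProduct.map LinearMap.id comul))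
      (p ⊗ₜ (q ⊗ₜ z))) = p ⊗ₜ (q ⊗ₜ ((invMulSwap (k := k) (A := A) ∘ₗ comul).lTensor A z)) := by
    intro z
    induction z with
    | zero => simp
    | add x y hx hy => simp only [map_add, TensorProduct.tmul_add, hx, hy]
    | tmul x y => simp [squash]
  rw [this, ← (ℛ k b).eq]
  simp only [map_sum, LinearMap.lTensor_tmul, LinearMap.comp_apply, invMulSwap_comul,
    Algebra.algebraMap_eq_smul_one, TensorProduct.tmul_smul]
  simp only [TensorProduct.smul_tmul', ← TensorProduct.sum_tmul, sum_smul_counit']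

lemma splitAct_one (g : DualAlg k A) (a : A) :
    splitAct g (a ⊗ₜ 1) = (dualActR k A a).rTensor (DualAlg k A) (dualSplit k A g) :=
  dualPair_ext fun x y => by
    simp [dualPair_splitAct, rTensor_dualActR, dualPair_dualSplit]

lemma splitAct_antipode (g : DualAlg k A) (a c d : A) :
    splitAct g (a ⊗ₜ (antipodeInv k A d * c)) =
      (dualActR k A (antipode k c)).lTensor (DualAlg k A)
        (dualSplit k A (dualActR k A a (dualActL k A d g))) :=
  dualPair_ext fun x y => by
    simp [dualPair_splitAct, lTensor_dualActR, dualPair_dualSplit, antipodeInv_mul, mul_assoc]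

lemma phi_left (a : A) (g : DualAlg k A) : phiAlg k A a * phiDual k A g =
    contrPhi g (squash k A ((TensorProduct.map LinearMap.id (TensorProduct.map LinearMap.id
      (TensorProduct.map LinearMap.id comul ∘ₗ comul)) ∘ₗ
      TensorProduct.map LinearMap.id comul ∘ₗ (comul (R := k) (A := A))) a)) := by
  rw [coassoc_phi']
  simp only [LinearMap.comp_apply]
  rw [phiAlg_eq (ℛ k a), phiDual_eq, Finset.sum_mul]
  conv_rhs => rw [← (ℛ k a).eq]
  simp only [map_sum]
  refine Finset.sum_congr rfl fun i _ => ?_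
  rw [mul_embDual _ _ (ℛ k ((ℛ k a).left i)), TensorProduct.map_tmul]
  conv_rhs => enter [2, 2, 2, 2, 2]; rw [← (ℛ k ((ℛ k a).left i)).eq]
  simp only [map_sum, TensorProduct.sum_tmul]
  refine Finset.sum_congr rfl fun j _ => ?_
  have : (TensorProduct.assoc k A A (A ⊗[k] A)).toLinearMap
      (((ℛ k ((ℛ k a).left i)).left j ⊗ₜ[k] (ℛ k ((ℛ k a).left i)).right j) ⊗ₜ
        comul ((ℛ k a).right i)) = (ℛ k ((ℛ k a).left i)).left j ⊗ₜ[k]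
        ((ℛ k ((ℛ k a).left i)).right j ⊗ₜ comul ((ℛ k a).right i)) := rfl
  rw [this, squash_counit, contrPhi_tmul, splitAct_one]

lemma phi_right (a : A) (g : DualAlg k A) :
    Twisted.liftLin (drinCoaction k A) (phiDual k A) (phiAlg k A)
      (Twisted.inr _ a * Twisted.inl _ g) =
    contrPhi g (squash k A ((TensorProduct.map LinearMap.id
      ((TensorProduct.map LinearMap.id (TensorProduct.assoc k A A A).toLinearMap ∘ₗ
        (TensorProduct.assoc k A (A ⊗[k] A) A).toLinearMap) ∘ₗ
      TensorProduct.map (TensorProduct.map LinearMap.id comul ∘ₗ comul) LinearMap.id) ∘ₗ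
      TensorProduct.map LinearMap.id comul ∘ₗ (comul (R := k) (A := A))) a)) := by
  rw [Twisted.inr_mul_inl, exch_drin (ℛ k a) (fun i => ℛ k _)]
  simp only [LinearMap.comp_apply]
  rw [← (ℛ k a).eq]
  simp only [map_sum, TensorProduct.map_tmul, LinearMap.id_apply, mul_one]
  refine Finset.sum_congr rfl fun i _ => ?_
  rw [← (ℛ k ((ℛ k a).right i)).eq]
  simp only [map_sum, TensorProduct.tmul_sum]
  refine Finset.sum_congr rfl fun j _ => ?_
  simp only [LinearMap.comp_apply, TensorProduct.map_tmul, LinearMap.id_apply]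
  have : ∀ (f : DualAlg k A) (b : A), Twisted.liftLin (drinCoaction k A) (phiDual k A) (phiAlg k A)
      (Twisted.ofTensor _ (f ⊗ₜ b)) = phiDual k A f * phiAlg k A b := fun f b => by
    simp [Twisted.liftLin]
  rw [this, phiDual_eq, phiAlg_eq (ℛ k _), Finset.mul_sum]
  conv_rhs => rw [← (ℛ k ((ℛ k ((ℛ k a).right i)).left j)).eq]
  simp only [map_sum, TensorProduct.map_tmul, TensorProduct.tmul_sum, TensorProduct.sum_tmul]
  refine Finset.sum_congr rfl fun l _ => ?_
  let r := ℛ k ((ℛ k ((ℛ k ((ℛ k a).right i)).left j)).right l)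
  let r' : Repr k (antipode k ((ℛ k ((ℛ k ((ℛ k a).right i)).left j)).right l)) (A × A) :=
    { index := r.index, left := fun i => antipode k (r.right i),
      right := fun i => antipode k (r.left i),
      eq := by rw [comul_antipode, ← r.eq]; simp }
  rw [embDual_mul _ _ r', LinearMap.id_apply, ← r.eq]
  simp only [map_sum, TensorProduct.tmul_sum, TensorProduct.sum_tmul]
  refine Finset.sum_congr rfl fun m _ => ?_
  simp only [r']
  rw [← splitAct_antipode]
  rfl

variable (k A)
/-- The homomorphism `φ : D(A) → H(A) ⊗ H(A)^op`. -/
def phi : Drin k A →ₐ[k] HHop k A :=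
  Twisted.lift (drinCoaction k A) (phiDual k A) (phiAlg k A) (fun a g => by
    rw [phi_left, phi_right, coassoc_phi])
end Phi

section Adjoin
variable {k B : Type*} [Field k] [Ring B] [Algebra k B]

/-- The relations of `B[θ]/(θ² - v)`, where `θ` is made to commute with the elements of `C`. The
generators are `some b` for `b ∈ B`, and `none` for `θ`. -/
inductive AdjoinSqrt.Rel (k : Type*) {B : Type*} [Field k] [Ring B] [Algebra k B] (C : Set B)
    (v : B) : FreeAlgebra k (Option B) → FreeAlgebra k (Option B) → Prop
  | add (a b : B) : Rel k C v (FreeAlgebra.ι k (some (a + b)))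
      (FreeAlgebra.ι k (some a) + FreeAlgebra.ι k (some b))
  | mul (a b : B) : Rel k C v (FreeAlgebra.ι k (some (a * b)))
      (FreeAlgebra.ι k (some a) * FreeAlgebra.ι k (some b))
  | scalar (r : k) : Rel k C v (FreeAlgebra.ι k (some (algebraMap k B r))) (algebraMap k _ r)
  | sq : Rel k C v (FreeAlgebra.ι k none * FreeAlgebra.ι k none) (FreeAlgebra.ι k (some v))
  | comm (c : B) (hc : c ∈ C) : Rel k C v (FreeAlgebra.ι k none * FreeAlgebra.ι k (some c))
      (FreeAlgebra.ι k (some c) * FreeAlgebra.ι k none)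

/-- The algebra obtained from `B` by adjoining an element `θ` with `θ² = v` that commutes with the
elements of `C`. For `C = univ` this is `B[θ]/(θ² - v)` with `θ` central. -/
def AdjoinSqrt (k : Type*) {B : Type*} [Field k] [Ring B] [Algebra k B] (C : Set B) (v : B) :
    Type _ := RingQuot (AdjoinSqrt.Rel k C v)

instance (k : Type*) {B : Type*} [Field k] [Ring B] [Algebra k B] (C : Set B) (v : B) :
    Ring (AdjoinSqrt k C v) := inferInstanceAs (Ring (RingQuot (AdjoinSqrt.Rel k C v)))

instance (k : Type*) {B : Type*} [Field k] [Ring B] [Algebra k B] (C : Set B) (v : B) :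
    Algebra k (AdjoinSqrt k C v) := inferInstanceAs (Algebra k (RingQuot (AdjoinSqrt.Rel k C v)))

namespace AdjoinSqrt
variable (k) (C : Set B) (v : B)

/-- The projection from the free algebra. -/
def proj : FreeAlgebra k (Option B) →ₐ[k] AdjoinSqrt k C v := RingQuot.mkAlgHom k (Rel k C v)

variable {k C v} in
lemma proj_rel {x y : FreeAlgebra k (Option B)} (h : Rel k C v x y) :
    proj k C v x = proj k C v y := RingQuot.mkAlgHom_rel k h

/-- The adjoined square root `θ`. -/
def root : AdjoinSqrt k C v := proj k C v (FreeAlgebra.ι k none)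

/-- The structure map `B → B[θ]`. -/
def of : B →ₐ[k] AdjoinSqrt k C v where
  toFun b := proj k C v (FreeAlgebra.ι k (some b))
  map_one' := by simpa using proj_rel (Rel.scalar (k := k) (C := C) (v := v) 1)
  map_zero' := by simpa using proj_rel (Rel.scalar (k := k) (C := C) (v := v) 0)
  map_mul' a b := by simpa using proj_rel (Rel.mul (k := k) (C := C) (v := v) a b)
  map_add' a b := by simpa using proj_rel (Rel.add (k := k) (C := C) (v := v) a b)
  commutes' r := by simpa using proj_rel (Rel.scalar (k := k) (C := C) (v := v) r)

lemma root_mul_root : root k C v * root k C v = of k C v v := by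
  simpa [root, of] using proj_rel (Rel.sq (k := k) (C := C) (v := v))

lemma root_comm {c : B} (hc : c ∈ C) : root k C v * of k C v c = of k C v c * root k C v := by
  simpa [root, of] using proj_rel (Rel.comm (k := k) (C := C) (v := v) c hc)

variable {k} {C} {v}
/-- The universal property. -/
def lift {E : Type*} [Ring E] [Algebra k E] (p : B →ₐ[k] E) (t : E) (ht : t * t = p v)
    (hc : ∀ c ∈ C, t * p c = p c * t) : AdjoinSqrt k C v →ₐ[k] E :=
  RingQuot.liftAlgHom k ⟨FreeAlgebra.lift k (fun o => o.elim t p), by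
    intro x y h
    induction h with
    | add a b => simp
    | mul a b => simp
    | scalar r => simp
    | sq => simpa using ht
    | comm c h => simpa using hc c h⟩

@[simp] lemma lift_root {E : Type*} [Ring E] [Algebra k E] (p : B →ₐ[k] E) (t : E)
    (ht : t * t = p v) (hc : ∀ c ∈ C, t * p c = p c * t) :
    lift (C := C) p t ht hc (root k C v) = t :=
  (RingQuot.liftAlgHom_mkAlgHom_apply k _ _ _).trans (by simp)

@[simp] lemma lift_of {E : Type*} [Ring E] [Algebra k E] (p : B →ₐ[k] E) (t : E)
    (ht : t * t = p v) (hc : ∀ c ∈ C, t * p c = p c * t) (b : B) :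
    lift (C := C) p t ht hc (of k C v b) = p b :=
  (RingQuot.liftAlgHom_mkAlgHom_apply k _ _ _).trans (by simp)

end AdjoinSqrt

variable (k B) in
/-- The span of the commutators for a closed component, and `0` for an open one. -/
def commutators (closed : Prop) : Submodule k B :=
  Submodule.span k {x | closed ∧ ∃ a b : B, x = a * b - b * a}

variable (k B) in
/-- `B` for an open component, `B` modulo the span of the commutators for a closed one. -/
abbrev TraceSpace (closed : Prop) : Type _ := B ⧸ commutators k B closed

/-- The map of trace spaces induced by an algebra homomorphism. -/
def TraceSpace.map {E : Type*} [Ring E] [Algebra k E] (p : B →ₐ[k] E) (closed : Prop) :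
    TraceSpace k B closed →ₗ[k] TraceSpace k E closed :=
  Submodule.mapQ _ _ p.toLinearMap (by
    rw [commutators, Submodule.span_le]
    rintro x ⟨h, a, b, rfl⟩
    exact Submodule.subset_span ⟨h, p a, p b, by simp⟩)

/-- Integral powers of an invertible element of a ring. -/
def intPow {E : Type*} [Ring E] (x : E) (d : ℤ) : E :=
  x ^ d.toNat * (Ring.inverse x) ^ (-d).toNat
end Adjoin

section Elements
variable (k A : Type*) [Field k] [Ring A] [HopfAlgebra k A] [Module.Finite k A]

/-- The canonical element `∑ e_a ⊗ e^a` of `A ⊗ A^*`. -/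
def canonicalElement : A ⊗[k] DualAlg k A :=
  ∑ i, Module.finBasis k A i ⊗ₜ[k] toConv ((Module.finBasis k A).coord i)

variable {k A}
/-- The map `a ⊗ f ↦ f(x) a`. -/
def evalSnd (x : A) : A ⊗[k] DualAlg k A →ₗ[k] A :=
  TensorProduct.lift ((LinearMap.lsmul k A).flip.compl₂
    (LinearMap.applyₗ x ∘ₗ (WithConv.linearEquiv k (A →ₗ[k] k)).toLinearMap))

lemma evalSnd_tmul (x a : A) (f : DualAlg k A) : evalSnd x (a ⊗ₜ[k] f) = f x • a := rfl

lemma evalSnd_ext {s t : A ⊗[k] DualAlg k A} (h : ∀ x, evalSnd x s = evalSnd x t) : s = t := by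
  have key : ∀ z : A ⊗[k] DualAlg k A, z = ∑ i, evalSnd (Module.finBasis k A i) z ⊗ₜ[k]
      toConv ((Module.finBasis k A).coord i) := by
    intro z
    induction z with
    | zero => simp
    | add x y hx hy =>
      simp only [map_add, TensorProduct.add_tmul, Finset.sum_add_distrib]
      rw [← hx, ← hy]
    | tmul a f =>
      simp only [evalSnd_tmul, TensorProduct.smul_tmul, ← TensorProduct.tmul_sum]
      congr 1
      ext x
      conv_lhs => rw [← (Module.finBasis k A).sum_repr x]
      simp
  rw [key s, key t]
  simp_rw [h]

lemma evalSnd_canonicalElement (x : A) : evalSnd x (canonicalElement k A) = x := by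
  simp [canonicalElement, evalSnd_tmul]

lemma evalSnd_mul (s t : A ⊗[k] DualAlg k A) {ι : Type*} {x : A} (r : Repr k x ι) :
    evalSnd x (s * t) = ∑ i ∈ r.index, evalSnd (r.left i) s * evalSnd (r.right i) t := by
  change evalSnd x (Algebra.TensorProduct.mul (R := k) (A := A) (B := DualAlg k A) s t) = _
  induction s with
  | zero => simp
  | add x y hx hy =>
    simp only [map_add, LinearMap.add_apply, hx, hy, add_mul, Finset.sum_add_distrib]
  | tmul a f =>
    induction t with
    | zero => simp
    | add x y hx hy => simp only [map_add, hx, hy, mul_add, Finset.sum_add_distrib]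
    | tmul b g =>
      have : (Algebra.TensorProduct.mul (R := k) (A := A) (B := DualAlg k A) (a ⊗ₜ f) (b ⊗ₜ g)) =
        (a * b) ⊗ₜ (f * g) := by simp
      rw [this, evalSnd_tmul, dual_mul_apply k A _ _ _ r, Finset.sum_smul]
      refine Finset.sum_congr rfl fun i _ => ?_
      simp [evalSnd_tmul, smul_smul]
      simp [mul_comm]

lemma evalSnd_rTensor (y : A) (z : A ⊗[k] DualAlg k A) :
    evalSnd y ((antipode k).rTensor (DualAlg k A) z) = antipode k (evalSnd y z) := by
  induction z with
  | zero => simp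
  | add => simp_all
  | tmul => simp [evalSnd_tmul]

/-- The inverse of `S = ∑ e_a ⊗ e^a` is `∑ γ(e_a) ⊗ e^a`. -/
lemma canonicalElement_mul :
    canonicalElement k A * (antipode k).rTensor (DualAlg k A) (canonicalElement k A) = 1 := by
  refine evalSnd_ext fun x => ?_
  rw [evalSnd_mul _ _ (ℛ k x)]
  simp only [evalSnd_rTensor, evalSnd_canonicalElement, sum_mul_antipode_eq_smul]
  rw [Algebra.TensorProduct.one_def, evalSnd_tmul]
  simp

lemma mul_canonicalElement :
    (antipode k).rTensor (DualAlg k A) (canonicalElement k A) * canonicalElement k A = 1 := by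
  refine evalSnd_ext fun x => ?_
  rw [evalSnd_mul _ _ (ℛ k x)]
  simp only [evalSnd_rTensor, evalSnd_canonicalElement, sum_antipode_mul_eq_smul]
  rw [Algebra.TensorProduct.one_def, evalSnd_tmul]
  simp

variable (k A)
variable [BijectiveAntipode k A]

/-- The universal `R`-matrix `R = ∑ (1 ⊗ e_a) ⊗ (e^a ⊗ 1)` of `D(A)`. -/
def rMatrix : Drin k A ⊗[k] Drin k A :=
  TensorProduct.map (Twisted.inr (drinCoaction k A)).toLinearMap
    (Twisted.inl (drinCoaction k A)).toLinearMap (canonicalElement k A)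

/-- The antipode of `D(A)`: `f ⊗ a ↦ (1 ⊗ γ(a)) (γ⁻¹*(f) ⊗ 1)`. -/
def drinAntipode : Drin k A →ₗ[k] Drin k A :=
  TensorProduct.lift ((LinearMap.mul k (Drin k A)).flip.compl₁₂
    ((Twisted.inl (drinCoaction k A)).toLinearMap ∘ₗ transp k (antipodeInv k A))
    ((Twisted.inr (drinCoaction k A)).toLinearMap ∘ₗ antipode k)) ∘ₗ
  (Twisted.ofTensor (drinCoaction k A)).symm.toLinearMap

lemma drinAntipode_mk (f : DualAlg k A) (a : A) :
    drinAntipode k A (Twisted.mk (drinCoaction k A) f a) =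
      Twisted.inr (drinCoaction k A) (antipode k a) *
        Twisted.inl (drinCoaction k A) (transp k (antipodeInv k A) f) := rfl

/-- `u = ∑ γ(β) α` for `R = ∑ α ⊗ β`. -/
def drinU : Drin k A :=
  LinearMap.mul' k (Drin k A) ((drinAntipode k A).rTensor (Drin k A)
    (TensorProduct.comm k _ _ (rMatrix k A)))

/-- `D(A)^θ = D(A)[θ]/(θ² - u γ(u))`. -/
abbrev DrinTheta : Type _ :=
  AdjoinSqrt k (B := Drin k A) Set.univ (drinU k A * drinAntipode k A (drinU k A))

/-- `(H(A) ⊗ H(A)^op)^θ̄`: an element `θ̄` with `θ̄² = φ(u γ(u))` is adjoined, and made to commute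
with the elements of `C`. -/
abbrev HHTheta (C : Set (HHop k A)) : Type _ :=
  AdjoinSqrt k C (phi k A (drinU k A * drinAntipode k A (drinU k A)))

variable {k A} in
/-- The extension of `φ` with `φ(θ) = θ̄`. -/
def phiTheta {C : Set (HHop k A)} (hC : Set.range (phi k A) ⊆ C) :
    DrinTheta k A →ₐ[k] HHTheta k A C :=
  AdjoinSqrt.lift ((AdjoinSqrt.of k C _).comp (phi k A)) (AdjoinSqrt.root k C _)
    (by rw [AlgHom.comp_apply]; exact AdjoinSqrt.root_mul_root k C _)
    (fun x _ => by rw [AlgHom.comp_apply]; exact AdjoinSqrt.root_comm k C _ (hC ⟨x, rfl⟩))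

lemma phiTheta_root {C : Set (HHop k A)} (hC : Set.range (phi k A) ⊆ C) :
    phiTheta hC (AdjoinSqrt.root k _ _) = AdjoinSqrt.root k C _ := by
  simp [phiTheta]

lemma phiTheta_of {C : Set (HHop k A)} (hC : Set.range (phi k A) ⊆ C) (x : Drin k A) :
    phiTheta hC (AdjoinSqrt.of k _ _ x) = AdjoinSqrt.of k C _ (phi k A x) := by
  simp [phiTheta]

end Elements

section Diagrams

/-- The direction of a strand. -/
inductive Dir
  | up | down
  deriving DecidableEq

/-- A crossing of two strands: `slash` and `back` are the directions of the strand running from the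
bottom left to the top right, and of the strand running from the bottom right to the top left;
`slashOver` says that the first one is the over strand. -/
structure Crossing where
  slashOver : Bool
  slash : Dir
  back : Dir

namespace Crossing

/-- The direction of the under strand. -/
def underDir (x : Crossing) : Dir := if x.slashOver then x.back else x.slash

/-- The direction of the over strand. -/
def overDir (x : Crossing) : Dir := if x.slashOver then x.slash else x.back

/-- The crossing is positive. -/
def positive (x : Crossing) : Bool := x.slashOver == decide (x.slash = x.back)

end Crossing

/-- The fundamental tangles with their orientations. In `max b` and `min b` the strand runs from
left to right if `b = true`, and from right to left otherwise. -/
inductive Fragment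
  | strand (d : Dir)
  | crossing (x : Crossing)
  | max (leftToRight : Bool)
  | min (leftToRight : Bool)

/-- What a strand of a fundamental tangle does: it runs below or above another one, or through a
left-to-right extremum, or (`plain`) it is straight or a right-to-left extremum. -/
inductive PassKind
  | plain | under | over | extremum

/-- A boundary point of a fundamental tangle: the `j`th one from the left on the upper
(`isTop = true`) or on the lower side. -/
structure LocalEnd where
  isTop : Bool
  pos : ℕ

/-- An oriented strand of a fundamental tangle. -/
structure Pass where
  kind : PassKind
  source : LocalEnd
  target : LocalEnd

/-- A strand joining the lower boundary point `b` to the upper boundary point `t`. -/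
def Pass.vertical (κ : PassKind) (d : Dir) (b t : ℕ) : Pass :=
  match d with
  | .up => ⟨κ, ⟨false, b⟩, ⟨true, t⟩⟩
  | .down => ⟨κ, ⟨true, t⟩, ⟨false, b⟩⟩

/-- A strand joining the boundary points `0` and `1` of the same side. -/
def Pass.turn (isTop leftToRight : Bool) : Pass :=
  match leftToRight with
  | true => ⟨.extremum, ⟨isTop, 0⟩, ⟨isTop, 1⟩⟩
  | false => ⟨.plain, ⟨isTop, 1⟩, ⟨isTop, 0⟩⟩

namespace Fragment

/-- The directions of the strands at the upper boundary, from left to right. -/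
def top : Fragment → List Dir
  | strand d => [d]
  | crossing x => [x.back, x.slash]
  | max _ => []
  | min true => [.down, .up]
  | min false => [.up, .down]

/-- The directions of the strands at the lower boundary, from left to right. -/
def bottom : Fragment → List Dir
  | strand d => [d]
  | crossing x => [x.slash, x.back]
  | max true => [.up, .down]
  | max false => [.down, .up]
  | min _ => []

/-- The strands. -/
def passes : Fragment → List Pass
  | strand d => [.vertical .plain d 0 0]
  | crossing x =>
    [.vertical (if x.slashOver then .over else .under) x.slash 0 1,
     .vertical (if x.slashOver then .under else .over) x.back 1 0]
  | max b => [.turn false b]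
  | min b => [.turn true b]

/-- The data of a crossing. -/
def crossing? : Fragment → Option Crossing
  | crossing x => some x
  | _ => none

/-- For a left-to-right extremum: whether it is a maximum. -/
def extremum? : Fragment → Option Bool
  | max true => some true
  | min true => some false
  | _ => none

lemma kind_under {F : Fragment} {s : Pass} (h : s ∈ F.passes)
    (hs : s.kind = .under ∨ s.kind = .over) : F.crossing?.isSome := by
  rcases F with d | x | b | b
  · cases d <;> simp_all [passes, Pass.vertical]
  · simp [crossing?]
  · cases b <;> simp_all [passes, Pass.turn]
  · cases b <;> simp_all [passes, Pass.turn]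

lemma kind_extremum {F : Fragment} {s : Pass} (h : s ∈ F.passes) (hs : s.kind = .extremum) :
    F.extremum?.isSome := by
  rcases F with d | x | b | b
  · cases d <;> simp_all [passes, Pass.vertical]
  · rcases x with ⟨_ | _, _ | _, _ | _⟩ <;> simp [passes, Pass.vertical] at h <;>
      rcases h with rfl | rfl <;> simp at hs
  · cases b <;> simp_all [passes, Pass.turn, extremum?]
  · cases b <;> simp_all [passes, Pass.turn, extremum?]

end Fragment

/-- An oriented tangle diagram: rows of fundamental tangles pasted horizontally, the rows being
pasted vertically, from the top to the bottom. -/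
structure TangleDiagram where
  rows : List (List Fragment)
  glue : rows.IsChain (fun r s => r.flatMap Fragment.bottom = s.flatMap Fragment.top)

namespace TangleDiagram
variable (D : TangleDiagram)

/-- The copies of the fundamental tangles in the diagram. -/
abbrev Pos : Type := (i : Fin D.rows.length) × Fin (D.rows.get i).length

/-- The fundamental tangle at a given place. -/
def frag (p : D.Pos) : Fragment := (D.rows.get p.1).get p.2

/-- The strands of the copies of the fundamental tangles. -/
abbrev Piece : Type := (p : D.Pos) × Fin (D.frag p).passes.length

variable {D}

/-- A piece as an oriented strand. -/
def Piece.pass (q : D.Piece) : Pass := (D.frag q.1).passes.get q.2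

/-- The position in the diagram of a boundary point of the copy `p` of a fundamental tangle: the
number of the horizontal line on which it lies, and its place on that line. -/
def Pos.globalEnd (p : D.Pos) (e : LocalEnd) : ℕ × ℕ :=
  if e.isTop then
    (p.1, (((D.rows.get p.1).take p.2).flatMap Fragment.top).length + e.pos)
  else
    (p.1 + 1, (((D.rows.get p.1).take p.2).flatMap Fragment.bottom).length + e.pos)

/-- The point at which a piece starts. -/
def Piece.source (q : D.Piece) : ℕ × ℕ := Pos.globalEnd q.1 q.pass.source

/-- The point at which a piece ends. -/
def Piece.target (q : D.Piece) : ℕ × ℕ := Pos.globalEnd q.1 q.pass.target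

end TangleDiagram

/-- An ordering `T_1, …, T_n` of the components of a diagram, with a base point on each closed
component: the `i`th component is given by the list of its pieces, in the order in which they are met
along the orientation, beginning at the boundary or at the base point. -/
structure ComponentOrdering (D : TangleDiagram) (n : ℕ) where
  comp : Fin n → List D.Piece
  nonempty : ∀ i, comp i ≠ []
  chain : ∀ i, (comp i).IsChain (fun p q => p.target = q.source)
  complete : ∀ i,
    ((comp i).getLast (nonempty i)).target = ((comp i).head (nonempty i)).source ∨
    ((∀ q : D.Piece, q.target ≠ ((comp i).head (nonempty i)).source) ∧
      ∀ q : D.Piece, ((comp i).getLast (nonempty i)).target ≠ q.source)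
  bijective : Function.Bijective
    (fun x : (i : Fin n) × Fin (comp i).length => (comp x.1).get x.2)

/-- The `i`th component has no boundary. -/
def ComponentOrdering.IsClosed {D : TangleDiagram} {n : ℕ} (o : ComponentOrdering D n)
    (i : Fin n) : Prop :=
  ((o.comp i).getLast (o.nonempty i)).target = ((o.comp i).head (o.nonempty i)).source

/-- What is met along a component: a crossing, on the under or on the over strand, or a
left-to-right extremum. -/
inductive Event (Cr Ex : Type)
  | under (c : Cr)
  | over (c : Cr)
  | extremum (e : Ex)

/-- The part of a diagram with ordered components on which the labels depend: the crossings, the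
left-to-right extrema, and for each component the list of those that are met along it. -/
structure GaussCode (n : ℕ) where
  Cr : Type
  Ex : Type
  [fintypeCr : Fintype Cr]
  [fintypeEx : Fintype Ex]
  info : Cr → Crossing
  isMax : Ex → Bool
  comp : Fin n → List (Event Cr Ex)

attribute [instance] GaussCode.fintypeCr GaussCode.fintypeEx

namespace TangleDiagram
variable (D : TangleDiagram)

/-- The crossings of a diagram. -/
abbrev Crossings : Type := {p : D.Pos // (D.frag p).crossing?.isSome}

/-- The left-to-right extrema of a diagram. -/
abbrev Extrema : Type := {p : D.Pos // (D.frag p).extremum?.isSome}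

variable {D}

/-- What is met along a piece. -/
def Piece.events (q : D.Piece) : List (Event D.Crossings D.Extrema) :=
  match h : q.pass.kind with
  | .plain => []
  | .under => [.under ⟨q.1, Fragment.kind_under (List.get_mem _ q.2) (.inl h)⟩]
  | .over => [.over ⟨q.1, Fragment.kind_under (List.get_mem _ q.2) (.inr h)⟩]
  | .extremum => [.extremum ⟨q.1, Fragment.kind_extremum (List.get_mem _ q.2) h⟩]

end TangleDiagram

/-- The code of a diagram with ordered components. -/
def ComponentOrdering.code {D : TangleDiagram} {n : ℕ} (o : ComponentOrdering D n) :
    GaussCode n where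
  Cr := D.Crossings
  Ex := D.Extrema
  info c := (D.frag c.1).crossing?.get c.2
  isMax e := (D.frag e.1).extremum?.get e.2
  comp i := (o.comp i).flatMap TangleDiagram.Piece.events

namespace GaussCode
variable {n : ℕ}

/-- The number `d` of left-to-right maxima minus the number of left-to-right minima on the `i`th
component. -/
def extremumCount (G : GaussCode n) (i : Fin n) : ℤ :=
  ((G.comp i).map (fun
    | .extremum e => if G.isMax e then (1 : ℤ) else -1
    | _ => 0)).sum

/-- The operation `(←)`: a left-to-right maximum is replaced with a right-to-left one above a crossing
whose under strand comes first and goes up, and a left-to-right minimum with a right-to-left one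
below a crossing whose under strand comes first and goes down. -/
def leftward (G : GaussCode n) : GaussCode n where
  Cr := G.Cr ⊕ G.Ex
  Ex := Empty
  info
    | .inl c => G.info c
    | .inr e => { slashOver := !G.isMax e, slash := .up, back := .down }
  isMax := Empty.elim
  comp i := (G.comp i).flatMap fun
    | .under c => [.under (.inl c)]
    | .over c => [.over (.inl c)]
    | .extremum e => [.under (.inr e), .over (.inr e)]

/-- The crossings of the doubled diagram: `(c, s, t)` is the crossing, at the place of the crossing
`c`, of the thick (`s = true`) or thin (`s = false`) copy of the under strand with the thick
(`t = true`) or thin (`t = false`) copy of the over strand. -/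
abbrev DoubledCr (G : GaussCode n) : Type := G.Cr × Bool × Bool

/-- The order in which two parallel copies are met. -/
def copyOrder (thinFirst : Bool) : List Bool := if thinFirst then [false, true] else [true, false]

/-- The crossings of the doubled diagram met by the thick or thin copy of the `i`th component. Each
strand is doubled, and the copy on its left is thick. At a positive crossing the under strand goes
from the right of the over strand to its left, and the over strand from the left of the under strand
to its right; at a negative crossing it is the other way round. -/
def doubledComp (G : GaussCode n) (thick : Bool) (i : Fin n) :
    List (Event G.DoubledCr Empty) :=
  (G.comp i).flatMap fun
    | .under c => (copyOrder (G.info c).positive).map fun t => .under (c, thick, t)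
    | .over c => (copyOrder (!(G.info c).positive)).map fun s => .over (c, s, thick)
    | .extremum _ => []

end GaussCode
end Diagrams

section Contraction
variable {k V W M ι : Type*} [Field k] [AddCommGroup V] [Module k V] [Module.Finite k V]
  [AddCommGroup W] [Module k W] [Module.Finite k W] [AddCommMonoid M] [Module k M] [Fintype ι]

open Classical in
/-- If `t c = ∑ v ⊗ w` for every `c`, this is the sum of the values of `F` at the families of the
pairs `(v, w)`, for a function `F` that is linear in each `v` and in each `w`. -/
def contract (t : ι → V ⊗[k] W) (F : (ι → V × W) → M) : M :=
  ∑ σ : ι → Fin (Module.finrank k V) × Fin (Module.finrank k W),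
    (∏ c, ((Module.finBasis k V).tensorProduct (Module.finBasis k W)).repr (t c) (σ c)) •
      F (fun c => (Module.finBasis k V (σ c).1, Module.finBasis k W (σ c).2))

end Contraction

/-- The product of the labels that are met, read against the orientation and written from the left to
the right. -/
def readLabels {E R : Type*} [Ring R] (label : E → R) (l : List E) : R :=
  (l.reverse.map label).prod

section Invariants
variable (k A : Type*) [Field k] [Ring A] [HopfAlgebra k A] [Module.Finite k A]
  [BijectiveAntipode k A]

/-- `T` for a strand that goes up, the identity for a strand that goes down. -/
def Dir.apply {k V : Type*} [Field k] [AddCommGroup V] [Module k V] (d : Dir)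
    (T : Module.End k V) : Module.End k V :=
  match d with
  | .up => T
  | .down => LinearMap.id

/-- The label `(γ' ⊗ γ')(R)` or `(γ' ⊗ γ')(R⁻¹)` of a crossing; the first tensorand belongs to the
under strand, the second one to the over strand. -/
def universalLabel (x : Crossing) : Drin k A ⊗[k] Drin k A :=
  TensorProduct.map (x.underDir.apply (drinAntipode k A)) (x.overDir.apply (drinAntipode k A))
    (if x.slashOver then rMatrix k A else Ring.inverse (rMatrix k A))

/-- The label `u⁻¹ θ` of a left-to-right maximum and the label `u θ⁻¹` of a left-to-right minimum. -/
def extremumLabel (isMax : Bool) : DrinTheta k A :=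
  if isMax then
    AdjoinSqrt.of k _ _ (Ring.inverse (drinU k A)) * AdjoinSqrt.root k _ _
  else
    AdjoinSqrt.of k _ _ (drinU k A) * Ring.inverse (AdjoinSqrt.root k _ _)

/-- The universal invariant `J` of a diagram with values in `⨂ D(A)^θ_i`. -/
def universalInvariant {n : ℕ} (G : GaussCode n) (closed : Fin n → Prop) :
    ⨂[k] i, TraceSpace k (DrinTheta k A) (closed i) :=
  contract (fun c => universalLabel k A (G.info c)) fun σ =>
    PiTensorProduct.tprod k fun i => Submodule.Quotient.mk <|
      readLabels (fun
        | .under c => AdjoinSqrt.of k _ _ (σ c).1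
        | .over c => AdjoinSqrt.of k _ _ (σ c).2
        | .extremum e => extremumLabel k A (G.isMax e)) (G.comp i)

/-- The tensors in `A ⊗ A^*`: `S = ∑ e_a ⊗ e^a`, `S' = ∑ γ(e_a) ⊗ e^a`, `S'' = ∑ e_a ⊗ γ⁻¹*(e^a)` and
`S̃ = ∑ γ(e_a) ⊗ γ⁻¹*(e^a)`, where the first (second) tensorand belongs to a thin strand if
`s = false` (`t = false`) and to a thick one otherwise. -/
def sTensor (s t : Bool) : A ⊗[k] DualAlg k A :=
  TensorProduct.map (if s then antipode k else LinearMap.id)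
    (if t then transp k (antipodeInv k A) else LinearMap.id) (canonicalElement k A)

/-- The inverses `S⁻¹ = ∑ γ(e_a) ⊗ e^a`, `S'⁻¹ = ∑ γ(γ(e_a)) ⊗ e^a`, `S''⁻¹ = ∑ γ(e_a) ⊗ γ⁻¹*(e^a)`
and `S̃⁻¹ = ∑ γ(γ(e_a)) ⊗ γ⁻¹*(e^a)`. -/
def sTensorInv (s t : Bool) : A ⊗[k] DualAlg k A :=
  (antipode k).rTensor (DualAlg k A) (sTensor k A s t)

/-- The label `(γ' ⊗ (γ⁻¹*)')(S^{±1})` of a crossing of the doubled diagram, where `S` is one of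
`S, S', S'', S̃` according to the thickness of the under and of the over strand. -/
def doubledLabel (x : Crossing) (s t : Bool) : A ⊗[k] DualAlg k A :=
  TensorProduct.map (x.underDir.apply (antipode k))
    (x.overDir.apply (transp k (antipodeInv k A)))
    (if x.slashOver then sTensor k A s t else sTensorInv k A s t)

/-- The product of the labels met by the thin copy of a component, in `H(A)`. -/
def thinWord {Cr : Type} (σ : Cr → A × DualAlg k A) (l : List (Event Cr Empty)) : Heis k A :=
  readLabels (fun
    | .under c => Twisted.inr (heisCoaction k A) (σ c).1
    | .over c => Twisted.inl (heisCoaction k A) (σ c).2) l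

/-- The product of the labels met by the thick copy of a component, in `H(A)^op`. -/
def thickWord {Cr : Type} (σ : Cr → A × DualAlg k A) (l : List (Event Cr Empty)) :
    (Heis k A)ᵐᵒᵖ :=
  readLabels (fun
    | .under c => MulOpposite.op (Twisted.inr (heisCoaction k A) (σ c).1)
    | .over c => MulOpposite.op (Twisted.inl (heisCoaction k A) (σ c).2)) l

/-- The element `J'` of a diagram, before passing to the quotients for the closed components: the
sum over the labels of the doubled diagram. -/
def heisenbergSum (C : Set (HHop k A)) {n : ℕ} (G : GaussCode n) : ⨂[k] _ : Fin n, HHTheta k A C :=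
  contract (fun c : G.DoubledCr => doubledLabel k A (G.info c.1) c.2.1 c.2.2) fun σ =>
    PiTensorProduct.tprod k fun i => AdjoinSqrt.of k C _
      (thinWord k A σ (G.doubledComp false i) ⊗ₜ thickWord k A σ (G.doubledComp true i))

/-- `J'' = (∏ θ̄_i^{d(D_i)}) J'(D_(←))`. -/
def heisenbergInvariant (C : Set (HHop k A)) {n : ℕ} (G : GaussCode n) (closed : Fin n → Prop) :
    ⨂[k] i, TraceSpace k (HHTheta k A C) (closed i) :=
  PiTensorProduct.map (fun i => (commutators k (HHTheta k A C) (closed i)).mkQ ∘ₗ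
      LinearMap.mulLeft k (intPow (AdjoinSqrt.root k C _) (G.extremumCount i)))
    (heisenbergSum k A C G.leftward)

variable {k A} in
/-- The map `φ^{⊗ n}`, taken modulo the commutators for the closed components. -/
def phiPower {C : Set (HHop k A)} (hC : Set.range (phi k A) ⊆ C) {n : ℕ} (closed : Fin n → Prop) :
    (⨂[k] i, TraceSpace k (DrinTheta k A) (closed i)) →ₗ[k]
      ⨂[k] i, TraceSpace k (HHTheta k A C) (closed i) :=
  PiTensorProduct.map fun i =>
    TraceSpace.map (B := DrinTheta k A) (E := HHTheta k A C) (phiTheta hC) (closed i)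

end Invariants

end

/-! Both sides turn out to be values of one multilinear map at the same tensors. Replace each
left-to-right extremum by its crossing. Every crossing then carries a tensor in `HHop k A ⊗ HHop k
A`, whose tensorands sit at the under and at the over passage. Each passage is met exactly once, so
the product along the components, multiplied by the powers of θ̄ and taken modulo commutators, is
multilinear in these tensors; call it Λ. For J'', the four crossings of the doubled diagram that lie
over one crossing are contracted first (`contract_prod`); for J, φ is applied to the universal
labels. What remains is a comparison at a single crossing.

This comparison is `contract_doubledLabel`. The universal label has the normal form ∑ T(e_a) ⊗ e^a,
where T = `Crossing.twist` is a power of the antipode, and the doubled labels have the same form up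
to the antipodes for thick strands. Since φ is built from the comultiplications of A and of A^*, it
meets both of them on the canonical element S. The identities (Δ ⊗ 1)S = S₁₃S₂₃ and (1 ⊗ Δ)S =
S₁₂S₁₃ combine into `sum_comul_tmul_dualComul`: four copies of S appear, one for each crossing of
the doubled diagram. The factors come in the order in which the parallel copies meet because the
parity of T is the sign of the crossing: an even power of γ preserves product and coproduct, an odd
power reverses both.

At an extremum, the two labels of the replacing crossing multiply to u⁻¹ or u
(`mul_comm_universalLabel`); the inverse of u is exhibited in `drinU_mul`. As u γ(u) is a unit, so
is θ; as θ̄ commutes with the image of φ, all its powers can be collected on the left, where the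
exponent is d(D_i) (`phiTheta_readLabels`).

A change of the base points for J rotates the words of closed components only
(`ComponentOrdering.word_eq_or_isRotated`), which is invisible modulo commutators. After this change
both invariants are read from the same base points. -/

noncomputable section

/-! ### Contractions of families of tensors with multilinear functions. -/

section Contraction
variable {k V W M ι : Type*} [Field k] [AddCommGroup V] [Module k V] [Module.Finite k V]
  [AddCommGroup W] [Module k W] [Module.Finite k W] [AddCommMonoid M] [Module k M] [Fintype ι]

/-- Expanding each `t c` in the product basis and using multilinearity gives the defining sum. This
frees contractions from the chosen bases. -/
lemma contract_eq_multilinear (Λ : MultilinearMap k (fun _ : ι => V ⊗[k] W) M)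
    {F : (ι → V × W) → M} (h : ∀ σ, Λ (fun c => (σ c).1 ⊗ₜ (σ c).2) = F σ) (t : ι → V ⊗[k] W) :
    contract t F = Λ t := by
  classical
  have e : t = fun c => ∑ j, ((Module.finBasis k V).tensorProduct (Module.finBasis k W)).repr
      (t c) j • (Module.finBasis k V).tensorProduct (Module.finBasis k W) j :=
    funext fun c => (Module.Basis.sum_repr _ _).symm
  conv_rhs => rw [e, Λ.map_sum]
  unfold contract
  refine Fintype.sum_equiv (Equiv.refl _) _ _ fun σ => ?_
  rw [Λ.map_smul_univ, ← h]
  simp [Module.Basis.tensorProduct_apply']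

lemma map_contract {N : Type*} [AddCommMonoid N] [Module k N] (L : M →ₗ[k] N)
    (t : ι → V ⊗[k] W) (F : (ι → V × W) → M) :
    L (contract t F) = contract t fun σ => L (F σ) := by
  simp [contract, map_sum]

/-- `F` is linear in each of the two entries of each pair. -/
structure IsBimultilinear (k : Type*) {V W M ι : Type*} [Field k] [AddCommGroup V] [Module k V]
    [AddCommGroup W] [Module k W] [AddCommMonoid M] [Module k M] (F : (ι → V × W) → M) : Prop where
  exists_bilinear : ∀ [DecidableEq ι] (σ : ι → V × W) (c : ι), ∃ B : V →ₗ[k] W →ₗ[k] M,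
    ∀ v w, F (Function.update σ c (v, w)) = B v w

/-- With all second entries fixed the function is multilinear in the first ones, and conversely; so
arbitrary families are reduced to basis vectors in two stages. -/
lemma IsBimultilinear.ext {F G : (ι → V × W) → M} (hF : IsBimultilinear k F)
    (hG : IsBimultilinear k G) {κ κ' : Type*} (b : Module.Basis κ k V) (b' : Module.Basis κ' k W)
    (h : ∀ σ : ι → κ × κ', F (fun c => (b (σ c).1, b' (σ c).2)) =
      G (fun c => (b (σ c).1, b' (σ c).2))) : F = G := by
  classical
  have left : ∀ {F : (ι → V × W) → M}, IsBimultilinear k F → ∀ w : ι → W,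
      ∃ Λ : MultilinearMap k (fun _ : ι => V) M, ∀ v, Λ v = F fun c => (v c, w c) := by
    intro F hF w
    have e : ∀ (v : ι → V) i (x : V), (fun c => (Function.update v i x c, w c)) =
        Function.update (fun c => (v c, w c)) i (x, w i) := by
      intro v i x
      ext c <;> by_cases hc : c = i <;> [subst hc; skip; subst hc; skip] <;> simp [*]
    refine ⟨MultilinearMap.mk' (fun v => F fun c => (v c, w c)) ?_ ?_, fun v => rfl⟩
    · intro v i x y
      obtain ⟨B, hB⟩ := hF.exists_bilinear (fun c => (v c, w c)) i
      simp only [e, hB, map_add, LinearMap.add_apply]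
    · intro v i r x
      obtain ⟨B, hB⟩ := hF.exists_bilinear (fun c => (v c, w c)) i
      simp only [e, hB, map_smul, LinearMap.smul_apply]
  have right : ∀ {F : (ι → V × W) → M}, IsBimultilinear k F → ∀ v : ι → V,
      ∃ Λ : MultilinearMap k (fun _ : ι => W) M, ∀ w, Λ w = F fun c => (v c, w c) := by
    intro F hF v
    have e : ∀ (w : ι → W) i (x : W), (fun c => (v c, Function.update w i x c)) =
        Function.update (fun c => (v c, w c)) i (v i, x) := by
      intro w i x
      ext c <;> by_cases hc : c = i <;> [subst hc; skip; subst hc; skip] <;> simp [*]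
    refine ⟨MultilinearMap.mk' (fun w => F fun c => (v c, w c)) ?_ ?_, fun v => rfl⟩
    · intro w i x y
      obtain ⟨B, hB⟩ := hF.exists_bilinear (fun c => (v c, w c)) i
      simp only [e, hB, map_add]
    · intro w i r x
      obtain ⟨B, hB⟩ := hF.exists_bilinear (fun c => (v c, w c)) i
      simp only [e, hB, map_smul]
  have key : ∀ (v : ι → V) (w : ι → W),
      F (fun c => (v c, w c)) = G (fun c => (v c, w c)) := by
    intro v w
    obtain ⟨Λ, hΛ⟩ := left hF w
    obtain ⟨Λ', hΛ'⟩ := left hG w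
    rw [← hΛ, ← hΛ']
    congr 1
    refine Module.Basis.ext_multilinear (fun _ => b) fun j => ?_
    rw [hΛ, hΛ']
    obtain ⟨Θ, hΘ⟩ := right hF fun c => b (j c)
    obtain ⟨Θ', hΘ'⟩ := right hG fun c => b (j c)
    rw [← hΘ, ← hΘ']
    congr 1
    refine Module.Basis.ext_multilinear (fun _ => b') fun j' => ?_
    rw [hΘ, hΘ']
    exact h fun c => (j c, j' c)
  exact funext fun σ => key (fun c => (σ c).1) fun c => (σ c).2

lemma MultilinearMap.isBimultilinear_tmul (Λ : MultilinearMap k (fun _ : ι => V ⊗[k] W) M) :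
    IsBimultilinear k fun σ : ι → V × W => Λ fun c => (σ c).1 ⊗ₜ (σ c).2 := by
  constructor
  intro _ σ c
  refine ⟨TensorProduct.curry (Λ.toLinearMap (fun c => (σ c).1 ⊗ₜ (σ c).2) c), fun v w => ?_⟩
  simp only [TensorProduct.curry_apply, MultilinearMap.toLinearMap_apply]
  congr 1
  ext d
  by_cases hd : d = c
  · subst hd; simp
  · simp [hd]

/-- The universal property of the tensor product, for one factor per index. The map is defined by
coordinates, and is compared with `F` on families of basis pairs only. -/
lemma IsBimultilinear.exists_multilinear {F : (ι → V × W) → M} (hF : IsBimultilinear k F) :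
    ∃ Λ : MultilinearMap k (fun _ : ι => V ⊗[k] W) M,
      ∀ σ : ι → V × W, Λ (fun c => (σ c).1 ⊗ₜ (σ c).2) = F σ := by
  classical
  let b := (Module.finBasis k V).tensorProduct (Module.finBasis k W)
  let Λ : MultilinearMap k (fun _ : ι => V ⊗[k] W) M :=
    ∑ σ : ι → Fin (Module.finrank k V) × Fin (Module.finrank k W),
      ((MultilinearMap.mkPiAlgebra k ι k).compLinearMap fun c => b.coord (σ c)).smulRight
        (F fun c => (Module.finBasis k V (σ c).1, Module.finBasis k W (σ c).2))
  refine ⟨Λ, fun σ => ?_⟩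
  refine congrFun (IsBimultilinear.ext Λ.isBimultilinear_tmul hF (Module.finBasis k V)
    (Module.finBasis k W) fun τ => ?_) σ
  have e : ∀ c, Module.finBasis k V (τ c).1 ⊗ₜ[k] Module.finBasis k W (τ c).2 = b (τ c) :=
    fun c => by simp [b, Module.Basis.tensorProduct_apply']
  simp only [e, Λ, sum_apply, MultilinearMap.smulRight_apply,
    MultilinearMap.compLinearMap_apply, MultilinearMap.mkPiAlgebra_apply, Module.Basis.coord_apply,
    Module.Basis.repr_self]
  -- At the basis family `τ` the product of the coordinates vanishes for every other index family.
  rw [Fintype.sum_eq_single τ]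
  · simp
  · intro ρ hρ
    obtain ⟨c, hc⟩ := Function.ne_iff.1 hρ
    rw [Finset.prod_eq_zero (Finset.mem_univ c), zero_smul]
    simp [Ne.symm hc]

/-- Any presentation of the labels by pure tensors may be used, in particular the one by dual bases.
-/
lemma contract_sum_tmul {κ : Type*} [Fintype κ] {F : (ι → V × W) → M} (hF : IsBimultilinear k F)
    [DecidableEq ι] (v : ι → κ → V) (w : ι → κ → W) :
    contract (fun c => ∑ j, v c j ⊗ₜ[k] w c j) F =
      ∑ ρ : ι → κ, F fun c => (v c (ρ c), w c (ρ c)) := by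
  obtain ⟨Λ, hΛ⟩ := hF.exists_multilinear
  rw [contract_eq_multilinear Λ hΛ, Λ.map_sum]
  exact Finset.sum_congr rfl fun ρ _ => hΛ fun c => (v c (ρ c), w c (ρ c))

lemma MultilinearMap.ext_tmul {Λ Λ' : MultilinearMap k (fun _ : ι => V ⊗[k] W) M}
    (h : ∀ σ : ι → V × W, Λ (fun c => (σ c).1 ⊗ₜ (σ c).2) = Λ' (fun c => (σ c).1 ⊗ₜ (σ c).2)) :
    Λ = Λ' :=
  MultilinearMap.ext fun t => by
    rw [← contract_eq_multilinear Λ h, contract_eq_multilinear Λ' (fun _ => rfl)]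

/-- A Fubini rule: the inner contraction over `κ` gathers the crossings that lie over one index. No
linearity of `G` is needed, since both sides are sums over the same bases; only `Λ` has to
distribute over sums. -/
lemma contract_prod {κ Q : Type*} [Fintype κ] [AddCommMonoid Q] [Module k Q]
    (Λ : MultilinearMap k (fun _ : ι => Q) M) (G : ι → (κ → V × W) → Q)
    (t : ι × κ → V ⊗[k] W) :
    contract t (fun σ => Λ fun c => G c fun s => σ (c, s)) =
      Λ fun c => contract (fun s => t (c, s)) (G c) := by
  classical
  simp only [contract]
  rw [Λ.map_sum]
  rw [← (Equiv.curry ι κ (Fin (Module.finrank k V) × Fin (Module.finrank k W))).sum_comp]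
  convert! Finset.sum_congr rfl fun σ _ => ?_
  rw [Λ.map_smul_univ, Fintype.prod_prod_type]
  rfl

end Contraction

/-! ### Products along words, and their multilinearity in the labels. -/

section Words
variable {k E R I : Type*} [Field k] [Ring R] [Algebra k R]

@[simp] lemma readLabels_nil (L : E → R) : readLabels L [] = 1 := rfl

lemma readLabels_cons (L : E → R) (e : E) (l : List E) :
    readLabels L (e :: l) = readLabels L l * L e := by
  simp [readLabels]

lemma readLabels_append (L : E → R) (l m : List E) :
    readLabels L (l ++ m) = readLabels L m * readLabels L l := by
  simp [readLabels]

lemma readLabels_congr {L L' : E → R} {l : List E} (h : ∀ e ∈ l, L e = L' e) :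
    readLabels L l = readLabels L' l := by
  simp only [readLabels]
  exact congrArg _ (List.map_congr_left fun e he => h e (by simpa using he))

lemma readLabels_flatMap {E' : Type*} (L : E' → R) (f : E → List E') (l : List E) :
    readLabels L (l.flatMap f) = readLabels (fun e => readLabels L (f e)) l := by
  induction l with
  | nil => rfl
  | cons e l ih => rw [List.flatMap_cons, readLabels_append, ih, readLabels_cons]

lemma readLabels_map {E' : Type*} (L : E' → R) (f : E → E') (l : List E) :
    readLabels L (l.map f) = readLabels (fun e => L (f e)) l := by
  simp [readLabels, Function.comp_def]

lemma map_readLabels {R' : Type*} [Ring R'] [Algebra k R'] (p : R →ₐ[k] R') (L : E → R)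
    (l : List E) : p (readLabels L l) = readLabels (fun e => p (L e)) l := by
  simp [readLabels, map_list_prod, Function.comp_def]

/-- The two tensor factors commute with each other, so two words on the same letters can be
multiplied letter by letter. -/
lemma readLabels_tmul {R' : Type*} [Ring R'] [Algebra k R'] (L : E → R) (L' : E → R')
    (l : List E) :
    readLabels L l ⊗ₜ[k] readLabels L' l = readLabels (fun e => L e ⊗ₜ[k] L' e) l := by
  induction l with
  | nil => rfl
  | cons e l ih => simp only [readLabels_cons, ← ih, Algebra.TensorProduct.tmul_mul_tmul]

/-- Each letter occurs exactly once in the words `w i`. -/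
def OccursOnce (w : I → List E) : Prop :=
  ∀ e, ∃ i l m, w i = l ++ e :: m ∧ e ∉ l ∧ e ∉ m ∧ ∀ j ≠ i, e ∉ w j

variable [Fintype I] {N : I → Type*} [∀ i, AddCommMonoid (N i)] [∀ i, Module k (N i)]

lemma readLabels_update_of_notMem [DecidableEq E] (L : E → R) (e : E) (x : R) {l : List E}
    (h : e ∉ l) : readLabels (Function.update L e x) l = readLabels L l :=
  readLabels_congr fun _ hf => Function.update_of_ne (by rintro rfl; exact h hf) _ _

/-- Only one word contains the letter, and only once, so its product is (rest) · x · (rest), linear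
in the label x. -/
lemma OccursOnce.exists_update {w : I → List E} (hw : OccursOnce w) [DecidableEq E]
    [DecidableEq I] (g : ∀ i, R →ₗ[k] N i) (L : E → R) (e : E) :
    ∃ i, ∃ B : R →ₗ[k] N i, ∀ x, (fun j => g j (readLabels (Function.update L e x) (w j))) =
      Function.update (fun j => g j (readLabels L (w j))) i (B x) := by
  obtain ⟨i, l, m, hi, hl, hm, hj⟩ := hw e
  -- Reading goes against the orientation, so what is met later, `m`, stands on the left of the
  -- label.
  refine ⟨i, g i ∘ₗ LinearMap.mulLeft k (readLabels L m) ∘ₗ LinearMap.mulRight k (readLabels L l),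
    fun x => funext fun j => ?_⟩
  by_cases h : j = i
  · subst h
    simp [hi, readLabels_append, readLabels_cons, readLabels_update_of_notMem _ _ _ hl,
      readLabels_update_of_notMem _ _ _ hm, mul_assoc]
  · rw [Function.update_of_ne h, readLabels_update_of_notMem _ _ _ (hj j h)]

open Classical in
/-- The tensor product of the images of the words, as a multilinear function of the labels. -/
def wordMap {w : I → List E} (hw : OccursOnce w) (g : ∀ i, R →ₗ[k] N i) :
    MultilinearMap k (fun _ : E => R) (⨂[k] i, N i) :=
  MultilinearMap.mk' (fun L => PiTensorProduct.tprod k fun i => g i (readLabels L (w i)))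
    (fun L e x y => by
      obtain ⟨i, B, hB⟩ := hw.exists_update g L e
      simp only [hB, map_add, MultilinearMap.map_update_add])
    (fun L e r x => by
      obtain ⟨i, B, hB⟩ := hw.exists_update g L e
      simp only [hB, map_smul, MultilinearMap.map_update_smul])

lemma wordMap_apply {w : I → List E} (hw : OccursOnce w) (g : ∀ i, R →ₗ[k] N i) (L : E → R) :
    wordMap hw g L = PiTensorProduct.tprod k fun i => g i (readLabels L (w i)) := rfl

end Words

/-! ### The canonical element of A ⊗ A^* and its comultiplications. -/

section Canonical
variable {k A : Type*} [Field k] [Ring A] [HopfAlgebra k A] [Module.Finite k A]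

variable (k A) in
/-- The basis of `A^*` dual to the chosen basis of `A`. -/
def dualVec (i : Fin (Module.finrank k A)) : DualAlg k A := toConv ((Module.finBasis k A).coord i)

lemma canonicalElement_eq :
    canonicalElement k A = ∑ i, Module.finBasis k A i ⊗ₜ[k] dualVec k A i := rfl

lemma sum_dualVec_smul (x : A) : ∑ i, dualVec k A i x • Module.finBasis k A i = x :=
  (Module.finBasis k A).sum_repr x

lemma sum_apply_smul_dualVec (f : DualAlg k A) :
    ∑ i, f (Module.finBasis k A i) • dualVec k A i = f := by
  ext x
  conv_rhs => rw [← sum_dualVec_smul (k := k) x]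
  simp [mul_comm]

lemma evalSnd_map_transp (x : A) (S T : Module.End k A) (z : A ⊗[k] DualAlg k A) :
    evalSnd x (TensorProduct.map S (transp k T) z) = S (evalSnd (T x) z) := by
  induction z with
  | zero => simp
  | add => simp_all
  | tmul => simp [evalSnd_tmul]

/-- The canonical element represents the identity of A, so an operator on A^* that is a transpose
can be moved to A. Every crossing label is brought into normal form in this way. -/
lemma map_transp_canonicalElement (S T : Module.End k A) :
    TensorProduct.map S (transp k T) (canonicalElement k A) =
      TensorProduct.map (S ∘ₗ T) LinearMap.id (canonicalElement k A) := by
  have e : (LinearMap.id : Module.End k (DualAlg k A)) = transp k LinearMap.id := by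
    ext; simp
  rw [e]
  refine evalSnd_ext fun x => ?_
  simp [evalSnd_map_transp, evalSnd_canonicalElement]

lemma dualComul_eq_sum (f : DualAlg k A) : dualComul k A f =
    ∑ a, ∑ b, f (Module.finBasis k A a * Module.finBasis k A b) •
      (dualVec k A a ⊗ₜ[k] dualVec k A b) := by
  refine dualPair_ext fun x y => ?_
  rw [dualPair_dualComul]
  conv_lhs => rw [← sum_dualVec_smul (k := k) x, ← sum_dualVec_smul (k := k) y]
  simp only [map_sum, LinearMap.sum_apply, map_smul, LinearMap.smul_apply, dualPair_tmul,
    Finset.sum_mul_sum, smul_mul_smul_comm, smul_eq_mul]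
  exact Finset.sum_congr rfl fun _ _ => Finset.sum_congr rfl fun _ _ => mul_comm _ _

lemma comul_eq_sum (x : A) : comul (R := k) x =
    ∑ a, ∑ c, (dualVec k A a * dualVec k A c) x •
      (Module.finBasis k A a ⊗ₜ[k] Module.finBasis k A c) := by
  have e : ∀ u v : A, u ⊗ₜ[k] v = ∑ a, ∑ c, (dualVec k A a u * dualVec k A c v) •
      (Module.finBasis k A a ⊗ₜ[k] Module.finBasis k A c) := fun u v => by
    conv_lhs => rw [← sum_dualVec_smul (k := k) u, ← sum_dualVec_smul (k := k) v]
    simp only [TensorProduct.sum_tmul, TensorProduct.tmul_sum, TensorProduct.smul_tmul_smul]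
    exact Finset.sum_comm
  simp_rw [dual_mul_apply k A _ _ x (ℛ k x), Finset.sum_smul]
  conv_lhs => rw [← (ℛ k x).eq]
  simp_rw [e ((ℛ k x).left _)]
  rw [Finset.sum_comm]
  exact Finset.sum_congr rfl fun a _ => Finset.sum_comm

/-- The comultiplications of both tensorands of the canonical element. -/
lemma sum_comul_tmul_dualComul :
    ∑ i, comul (R := k) (Module.finBasis k A i) ⊗ₜ[k] dualComul k A (dualVec k A i) =
      ∑ a, ∑ b, ∑ c, ∑ d,
        ((Module.finBasis k A a * Module.finBasis k A b) ⊗ₜ[k]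
          (Module.finBasis k A c * Module.finBasis k A d)) ⊗ₜ[k]
        ((dualVec k A a * dualVec k A c) ⊗ₜ[k] (dualVec k A b * dualVec k A d)) := by
  -- The middle term comes from (1 ⊗ Δ)S = S₁₂S₁₃ together with the multiplicativity of Δ. Expanding
  -- the two coproducts there by `comul_eq_sum` then gives the four copies of S.
  trans ∑ i, ∑ j, (comul (R := k) (Module.finBasis k A i) * comul (Module.finBasis k A j)) ⊗ₜ[k]
      (dualVec k A i ⊗ₜ[k] dualVec k A j)
  · simp_rw [dualComul_eq_sum, TensorProduct.tmul_sum, TensorProduct.tmul_smul,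
      ← Bialgebra.comul_mul]
    rw [Finset.sum_comm]
    refine Finset.sum_congr rfl fun a _ => ?_
    rw [Finset.sum_comm]
    refine Finset.sum_congr rfl fun b _ => ?_
    conv_rhs => rw [← sum_dualVec_smul (k := k) (Module.finBasis k A a * Module.finBasis k A b)]
    simp only [map_sum, map_smul, TensorProduct.sum_tmul, TensorProduct.smul_tmul']
  · have e : ∀ a b c d : Fin (Module.finrank k A),
        (dualVec k A a * dualVec k A c) ⊗ₜ[k] (dualVec k A b * dualVec k A d) =
        ∑ i, ∑ j, ((dualVec k A a * dualVec k A c) (Module.finBasis k A i) *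
          (dualVec k A b * dualVec k A d) (Module.finBasis k A j)) •
            (dualVec k A i ⊗ₜ[k] dualVec k A j) := by
      intro a b c d
      conv_lhs => rw [← sum_apply_smul_dualVec (dualVec k A a * dualVec k A c),
        ← sum_apply_smul_dualVec (dualVec k A b * dualVec k A d)]
      simp only [TensorProduct.sum_tmul, TensorProduct.tmul_sum, TensorProduct.smul_tmul_smul]
      exact Finset.sum_comm
    simp_rw [e, comul_eq_sum (k := k) (Module.finBasis k A _), Finset.sum_mul, Finset.mul_sum,
      smul_mul_smul_comm, Algebra.TensorProduct.tmul_mul_tmul, TensorProduct.sum_tmul,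
      TensorProduct.tmul_sum, TensorProduct.tmul_smul, TensorProduct.smul_tmul']
    let X := Fin (Module.finrank k A)
    -- What is left is a reordering of six finite sums, done by a bijection of the index tuples.
    have sw : ∀ f : X → X → X → X → X → X → (A ⊗[k] A) ⊗[k] (DualAlg k A ⊗[k] DualAlg k A),
        ∑ i, ∑ j, ∑ a, ∑ c, ∑ b, ∑ d, f i j a b c d =
        ∑ a, ∑ b, ∑ c, ∑ d, ∑ i, ∑ j, f i j a b c d := by
      intro f
      have := Fintype.sum_equiv (ι := X × X × X × X × X × X) (κ := X × X × X × X × X × X)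
        ⟨fun ⟨i, j, a, c, b, d⟩ => ⟨a, b, c, d, i, j⟩,
          fun ⟨a, b, c, d, i, j⟩ => ⟨i, j, a, c, b, d⟩, fun _ => rfl, fun _ => rfl⟩
        (fun ⟨i, j, a, c, b, d⟩ => f i j a b c d) (fun ⟨a, b, c, d, i, j⟩ => f i j a b c d)
        fun _ => rfl
      simpa only [Fintype.sum_prod_type] using this
    exact sw _

end Canonical

/-! ### The four doubled crossings that lie over one crossing. -/

section Local
variable (k A : Type*) [Field k] [Ring A] [HopfAlgebra k A]

/-- The product met by the two copies of an under strand at the four crossings of the doubled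
diagram that belong to a crossing; `p` says that the crossing is positive. -/
def underWord (p : Bool) (σ : Bool × Bool → A × DualAlg k A) : HHop k A :=
  readLabels (fun t => Twisted.inr (heisCoaction k A) (σ (false, t)).1) (GaussCode.copyOrder p)
    ⊗ₜ[k] readLabels (fun t => MulOpposite.op (Twisted.inr (heisCoaction k A) (σ (true, t)).1))
      (GaussCode.copyOrder p)

/-- The product met by the two copies of an over strand at the four crossings of the doubled
diagram that belong to a crossing; `p` says that the crossing is positive. -/
def overWord (p : Bool) (σ : Bool × Bool → A × DualAlg k A) : HHop k A :=
  readLabels (fun s => Twisted.inl (heisCoaction k A) (σ (s, false)).2) (GaussCode.copyOrder (!p))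
    ⊗ₜ[k] readLabels (fun s => MulOpposite.op (Twisted.inl (heisCoaction k A) (σ (s, true)).2))
      (GaussCode.copyOrder (!p))

lemma isBimultilinear_of_map {V W M ι : Type*} [AddCommGroup V] [Module k V]
    [AddCommGroup W] [Module k W] [AddCommMonoid M] [Module k M] {F : (ι → V × W) → M}
    (h : ∀ [DecidableEq ι] (σ : ι → V × W) (c : ι),
      (∀ v v' w, F (Function.update σ c (v + v', w)) =
        F (Function.update σ c (v, w)) + F (Function.update σ c (v', w))) ∧
      (∀ (r : k) v w, F (Function.update σ c (r • v, w)) = r • F (Function.update σ c (v, w))) ∧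
      (∀ v w w', F (Function.update σ c (v, w + w')) =
        F (Function.update σ c (v, w)) + F (Function.update σ c (v, w'))) ∧
      (∀ (r : k) v w, F (Function.update σ c (v, r • w)) = r • F (Function.update σ c (v, w)))) :
    IsBimultilinear k F where
  exists_bilinear σ c := ⟨LinearMap.mk₂ k (fun v w => F (Function.update σ c (v, w)))
    (h σ c).1 (h σ c).2.1 (h σ c).2.2.1 (h σ c).2.2.2, fun _ _ => rfl⟩

/-- Each of the eight entries, two for each of the four doubled crossings, is used exactly once. -/
lemma isBimultilinear_underWord_tmul_overWord (p : Bool) :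
    IsBimultilinear k fun σ => underWord k A p σ ⊗ₜ[k] overWord k A p σ := by
  refine isBimultilinear_of_map k fun σ ⟨s, t⟩ => ?_
  cases p <;> cases s <;> cases t <;>
    simp [underWord, overWord, GaussCode.copyOrder, readLabels, Function.update_apply, mul_add,
      add_mul, TensorProduct.tmul_add, TensorProduct.add_tmul,
      ← TensorProduct.smul_tmul']

end Local

/-! ### The image under φ of the label of a crossing. -/

section PhiGenerators
variable {k A : Type*} [Field k] [Ring A] [HopfAlgebra k A] [Module.Finite k A]
  [BijectiveAntipode k A]

@[simp] lemma phi_inr (a : A) : phi k A (Twisted.inr _ a) = phiAlg k A a := by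
  change Twisted.liftLin _ _ _ _ = _
  simp [Twisted.liftLin]

@[simp] lemma phi_inl (f : DualAlg k A) : phi k A (Twisted.inl _ f) = phiDual k A f := by
  change Twisted.liftLin _ _ _ _ = _
  simp [Twisted.liftLin]

@[simp] lemma drinAntipode_inr (a : A) :
    drinAntipode k A (Twisted.inr _ a) = Twisted.inr _ (antipode k a) := by
  rw [Twisted.inr_apply, drinAntipode_mk]
  have : transp k (antipodeInv k A) (1 : DualAlg k A) = 1 := by ext; simp
  simp [this]

@[simp] lemma drinAntipode_inl (f : DualAlg k A) :
    drinAntipode k A (Twisted.inl _ f) = Twisted.inl _ (transp k (antipodeInv k A) f) := by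
  rw [Twisted.inl_apply, drinAntipode_mk]
  simp

variable (k A) in
/-- The map `a ⊗ b ↦ (1 ⊗ a) ⊗ (1 ⊗ γ(b))`. -/
def embAlg : A ⊗[k] A →ₗ[k] HHop k A :=
  TensorProduct.map (Twisted.inr (heisCoaction k A)).toLinearMap
    ((MulOpposite.opLinearEquiv k).toLinearMap ∘ₗ (Twisted.inr (heisCoaction k A)).toLinearMap ∘ₗ
      antipode k)

lemma embAlg_tmul (a b : A) : embAlg k A (a ⊗ₜ b) = Twisted.inr (heisCoaction k A) a ⊗ₜ
    MulOpposite.op (Twisted.inr (heisCoaction k A) (antipode k b)) := rfl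

lemma phiAlg_eq_embAlg (a : A) : phiAlg k A a = embAlg k A (comul a) := by
  rw [phiAlg_eq (ℛ k a), ← (ℛ k a).eq, map_sum]
  rfl

lemma phiDual_eq_embDual (f : DualAlg k A) : phiDual k A f =
    (embDual ∘ₗ (transp k (antipodeInv k A)).lTensor (DualAlg k A) ∘ₗ
      (TensorProduct.comm k _ _).toLinearMap) (dualComul k A f) := rfl

/-- γ⁻¹ reverses the coproduct, so its transpose reverses the product of A^*. -/
lemma transp_antipodeInv_mul (f g : DualAlg k A) : transp k (antipodeInv k A) (f * g) =
    transp k (antipodeInv k A) g * transp k (antipodeInv k A) f := by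
  ext x
  let r : Repr k (antipodeInv k A x) (A × A) :=
    { index := (ℛ k x).index, left := fun i => antipodeInv k A ((ℛ k x).right i),
      right := fun i => antipodeInv k A ((ℛ k x).left i),
      eq := by rw [comul_antipodeInv, ← (ℛ k x).eq]; simp }
  rw [transp_apply, dual_mul_apply k A _ _ _ r, dual_mul_apply k A _ _ _ (ℛ k x)]
  exact Finset.sum_congr rfl fun _ _ => mul_comm _ _

/-- The image under `φ ⊗ φ` of the tensor `∑ T(e_a) ⊗ e^a`. -/
lemma sum_phi_tmul_phi (Θ : A ⊗[k] A →ₗ[k] HHop k A) (T : Module.End k A)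
    (h : ∀ a, phiAlg k A (T a) = Θ (comul a)) :
    ∑ i, phi k A (Twisted.inr _ (T (Module.finBasis k A i))) ⊗ₜ[k]
      phi k A (Twisted.inl _ (dualVec k A i)) =
    ∑ a, ∑ b, ∑ c, ∑ d,
      Θ ((Module.finBasis k A a * Module.finBasis k A b) ⊗ₜ[k]
          (Module.finBasis k A c * Module.finBasis k A d)) ⊗ₜ[k]
        (Twisted.inl (heisCoaction k A) (dualVec k A b * dualVec k A d) ⊗ₜ[k]
          MulOpposite.op (Twisted.inl (heisCoaction k A)
            (transp k (antipodeInv k A) (dualVec k A a * dualVec k A c)))) := by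
  -- The flip of the two dual tensorands is due to φ(f) having f'' in H(A) and γ⁻¹*(f') in the
  -- opposite factor.
  have key := congrArg (TensorProduct.map Θ (embDual ∘ₗ (transp k (antipodeInv k A)).lTensor
    (DualAlg k A) ∘ₗ (TensorProduct.comm k _ _).toLinearMap))
    (sum_comul_tmul_dualComul (k := k) (A := A))
  simp only [map_sum, TensorProduct.map_tmul] at key
  simp only [phi_inr, phi_inl, h, phiDual_eq_embDual]
  exact key

/-- A basis labelling of the doubled crossings, indexed by the thickness of the under and of the
over copy, is a quadruple. The order is the one in which the factors occur in `sum_phi_tmul_phi` at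
a positive crossing. -/
lemma sum_pi_bool_prod {X M : Type*} [Fintype X] [AddCommMonoid M] (f : X → X → X → X → M) :
    ∑ ρ : Bool × Bool → X,
        f (ρ (false, true)) (ρ (false, false)) (ρ (true, true)) (ρ (true, false)) =
      ∑ a, ∑ b, ∑ c, ∑ d, f a b c d := by
  have := Fintype.sum_equiv (ι := Bool × Bool → X) (κ := X × X × X × X)
    ⟨fun ρ => (ρ (false, true), ρ (false, false), ρ (true, true), ρ (true, false)),
      fun p q => match q with
        | (false, true) => p.1
        | (false, false) => p.2.1
        | (true, true) => p.2.2.1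
        | (true, false) => p.2.2.2,
      fun ρ => by ext ⟨_ | _, _ | _⟩ <;> rfl, fun _ => rfl⟩
    (fun ρ => f (ρ (false, true)) (ρ (false, false)) (ρ (true, true)) (ρ (true, false)))
    (fun p => f p.1 p.2.1 p.2.2.1 p.2.2.2) fun _ => rfl
  simpa only [Fintype.sum_prod_type] using this

/-- The same with the two copies of the under strand exchanged, as is needed when `T` reverses the
coproduct. -/
lemma sum_pi_bool_prod' {X M : Type*} [Fintype X] [AddCommMonoid M] (f : X → X → X → X → M) :
    ∑ ρ : Bool × Bool → X,
        f (ρ (true, true)) (ρ (true, false)) (ρ (false, true)) (ρ (false, false)) =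
      ∑ a, ∑ b, ∑ c, ∑ d, f a b c d := by
  rw [← sum_pi_bool_prod]
  refine Fintype.sum_equiv ((Equiv.prodCongr Equiv.boolNot (Equiv.refl Bool)).arrowCongr
    (Equiv.refl X)) _ _ fun _ => rfl

variable (k A) in
/-- The antipode for a thick strand, the identity for a thin one. -/
def thickAntipode (s : Bool) : Module.End k A := if s then antipode k else LinearMap.id

variable (k A) in
/-- The transposed inverse antipode for a thick strand, the identity for a thin one. -/
def thickTransp (t : Bool) : Module.End k (DualAlg k A) :=
  if t then transp k (antipodeInv k A) else LinearMap.id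

lemma contract_doubled (T : Module.End k A) (p : Bool) :
    contract (fun st : Bool × Bool => TensorProduct.map (T ∘ₗ thickAntipode k A st.1)
        (thickTransp k A st.2) (canonicalElement k A))
      (fun σ => underWord k A p σ ⊗ₜ[k] overWord k A p σ) =
    ∑ ρ : Bool × Bool → Fin (Module.finrank k A),
      underWord k A p (fun st => (T (thickAntipode k A st.1 (Module.finBasis k A (ρ st))),
        thickTransp k A st.2 (dualVec k A (ρ st)))) ⊗ₜ[k]
      overWord k A p (fun st => (T (thickAntipode k A st.1 (Module.finBasis k A (ρ st))),
        thickTransp k A st.2 (dualVec k A (ρ st)))) := by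
  simp only [canonicalElement_eq, map_sum, TensorProduct.map_tmul]
  exact contract_sum_tmul (isBimultilinear_underWord_tmul_overWord k A p)
    (fun st i => T (thickAntipode k A st.1 (Module.finBasis k A i)))
    fun st i => thickTransp k A st.2 (dualVec k A i)

/-- A twist that preserves product and coproduct leaves the factors in the order of a positive
crossing: the thin over copy is met first by the under copies, the thick under copy first by the
over copies. -/
lemma contract_doubled_of_mul (T : Module.End k A) (hm : ∀ a b, T (a * b) = T a * T b)
    (hc : ∀ a, comul (R := k) (T a) = TensorProduct.map T T (comul a))
    (hγ : ∀ a, T (antipode k a) = antipode k (T a)) :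
    contract (fun st : Bool × Bool => TensorProduct.map (T ∘ₗ thickAntipode k A st.1)
        (thickTransp k A st.2) (canonicalElement k A))
      (fun σ => underWord k A true σ ⊗ₜ[k] overWord k A true σ) =
    ∑ i, phi k A (Twisted.inr _ (T (Module.finBasis k A i))) ⊗ₜ[k]
      phi k A (Twisted.inl _ (dualVec k A i)) := by
  rw [contract_doubled, sum_phi_tmul_phi (embAlg k A ∘ₗ TensorProduct.map T T) T (fun a => by
    rw [phiAlg_eq_embAlg, hc]; rfl), ← sum_pi_bool_prod]
  refine Finset.sum_congr rfl fun ρ _ => ?_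
  simp [underWord, overWord, GaussCode.copyOrder, readLabels, thickAntipode, thickTransp,
    embAlg_tmul, hm, hγ, transp_antipodeInv_mul, antipode_mul_antidistrib]

/-- Reversing the coproduct exchanges the copies of the under strand, and reversing the product
exchanges the order in which they meet the over copies; this is the pattern of a negative crossing.
-/
lemma contract_doubled_of_antimul (T : Module.End k A) (hm : ∀ a b, T (a * b) = T b * T a)
    (hc : ∀ a, comul (R := k) (T a) = TensorProduct.map T T (TensorProduct.comm k A A (comul a)))
    (hγ : ∀ a, T (antipode k a) = antipode k (T a)) :
    contract (fun st : Bool × Bool => TensorProduct.map (T ∘ₗ thickAntipode k A st.1)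
        (thickTransp k A st.2) (canonicalElement k A))
      (fun σ => underWord k A false σ ⊗ₜ[k] overWord k A false σ) =
    ∑ i, phi k A (Twisted.inr _ (T (Module.finBasis k A i))) ⊗ₜ[k]
      phi k A (Twisted.inl _ (dualVec k A i)) := by
  rw [contract_doubled, sum_phi_tmul_phi (embAlg k A ∘ₗ TensorProduct.map T T ∘ₗ
    (TensorProduct.comm k A A).toLinearMap) T (fun a => by
    rw [phiAlg_eq_embAlg, hc]; rfl), ← sum_pi_bool_prod']
  refine Finset.sum_congr rfl fun ρ _ => ?_
  simp [underWord, overWord, GaussCode.copyOrder, readLabels, thickAntipode, thickTransp,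
    embAlg_tmul, hm, hγ, transp_antipodeInv_mul, antipode_mul_antidistrib]

/-- The power of the antipode in the normal form `∑ T(e_a) ⊗ e^a` of the label of a crossing. -/
def Crossing.twist (k A : Type*) [Field k] [Ring A] [HopfAlgebra k A] [BijectiveAntipode k A]
    (x : Crossing) : Module.End k A :=
  x.underDir.apply (antipode k) ∘ₗ (if x.slashOver then LinearMap.id else antipode k) ∘ₗ
    x.overDir.apply (antipodeInv k A)

lemma Dir.apply_transp (d : Dir) (T : Module.End k A) :
    d.apply (transp k T) = transp k (d.apply T) := by
  cases d
  · rfl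
  · ext; rfl

lemma thickTransp_eq (t : Bool) : thickTransp k A t =
    transp k (if t then antipodeInv k A else LinearMap.id) := by
  cases t
  · ext; rfl
  · rfl

lemma transp_comp (S T : Module.End k A) : transp k S ∘ₗ transp k T = transp k (T ∘ₗ S) := rfl

/-- Every operator in the label is a power of the antipode or the transpose of one. Moved to A,
those that depend on the directions and on the sign of the exponent make up the twist, which
commutes with the antipode of a thick strand. -/
lemma doubledLabel_eq (x : Crossing) (s t : Bool) : doubledLabel k A x s t =
    TensorProduct.map (x.twist k A ∘ₗ thickAntipode k A s) (thickTransp k A t)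
      (canonicalElement k A) := by
  have e : (if x.slashOver then sTensor k A s t else sTensorInv k A s t) =
      TensorProduct.map ((if x.slashOver then LinearMap.id else antipode k) ∘ₗ thickAntipode k A s)
        (thickTransp k A t) (canonicalElement k A) := by
    unfold sTensorInv
    cases x.slashOver
    · simp only [Bool.false_eq_true, if_false]
      rw [sTensor, LinearMap.rTensor, ← LinearMap.comp_apply, ← TensorProduct.map_comp]
      rfl
    · rfl
  -- Both sides are moved completely to the A tensorand; there only an identity between composites
  -- of γ and γ⁻¹ remains.
  rw [doubledLabel, e, ← LinearMap.comp_apply, ← TensorProduct.map_comp, Dir.apply_transp,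
    thickTransp_eq, transp_comp, map_transp_canonicalElement, map_transp_canonicalElement]
  congr 2
  unfold Crossing.twist thickAntipode
  ext a
  cases s <;> cases t <;> cases x.overDir <;> simp [Dir.apply]

lemma ringInverse_eq {R : Type*} [Ring R] {a b : R} (h : a * b = 1) (h' : b * a = 1) :
    Ring.inverse a = b :=
  Ring.inverse_unit ⟨a, b, h, h'⟩

/-- R is the image of S under the algebra homomorphism `inr ⊗ inl`, which carries the inverse of S
along. -/
lemma inverse_rMatrix : Ring.inverse (rMatrix k A) =
    TensorProduct.map (Twisted.inr (drinCoaction k A)).toLinearMap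
      (Twisted.inl (drinCoaction k A)).toLinearMap
      ((antipode k).rTensor (DualAlg k A) (canonicalElement k A)) := by
  let p := Algebra.TensorProduct.map (Twisted.inr (drinCoaction k A))
    (Twisted.inl (drinCoaction k A))
  have h : ∀ z, p z = TensorProduct.map (Twisted.inr (drinCoaction k A)).toLinearMap
      (Twisted.inl (drinCoaction k A)).toLinearMap z := fun _ => rfl
  refine ringInverse_eq ?_ ?_
  · rw [rMatrix, ← h, ← h, ← map_mul, canonicalElement_mul, map_one]
  · rw [rMatrix, ← h, ← h, ← map_mul, mul_canonicalElement, map_one]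

/-- The antipode of D(A) restricts to γ on A and to γ⁻¹* on A^*, so the whole label comes from A ⊗
A^*, with the same twist as the doubled labels. -/
lemma universalLabel_eq (x : Crossing) : universalLabel k A x =
    ∑ i, Twisted.inr (drinCoaction k A) (x.twist k A (Module.finBasis k A i)) ⊗ₜ[k]
      Twisted.inl (drinCoaction k A) (dualVec k A i) := by
  have e : (if x.slashOver then rMatrix k A else Ring.inverse (rMatrix k A)) =
      TensorProduct.map (Twisted.inr (drinCoaction k A)).toLinearMap
      (Twisted.inl (drinCoaction k A)).toLinearMap
      (TensorProduct.map (if x.slashOver then LinearMap.id else antipode k) LinearMap.id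
        (canonicalElement k A)) := by
    rw [inverse_rMatrix]
    cases x.slashOver
    · rfl
    · simp [rMatrix]
  have hu : x.underDir.apply (drinAntipode k A) ∘ₗ (Twisted.inr (drinCoaction k A)).toLinearMap =
      (Twisted.inr (drinCoaction k A)).toLinearMap ∘ₗ x.underDir.apply (antipode k) := by
    cases x.underDir <;> ext <;> simp [Dir.apply]
  have ho : x.overDir.apply (drinAntipode k A) ∘ₗ (Twisted.inl (drinCoaction k A)).toLinearMap =
      (Twisted.inl (drinCoaction k A)).toLinearMap ∘ₗ
        x.overDir.apply (transp k (antipodeInv k A)) := by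
    refine LinearMap.ext fun f => ?_
    cases x.overDir <;> simp [Dir.apply]
  rw [universalLabel, e, ← LinearMap.comp_apply, ← TensorProduct.map_comp, hu, ho,
    Dir.apply_transp, TensorProduct.map_map, LinearMap.comp_id, LinearMap.comp_assoc,
    TensorProduct.map_comp, LinearMap.comp_apply, map_transp_canonicalElement, canonicalElement_eq]
  simp only [map_sum, TensorProduct.map_tmul]
  rfl

/-- The labels of a crossing and of the four crossings of the doubled diagram agree under `φ`. -/
lemma contract_doubledLabel (x : Crossing) :
    contract (fun st : Bool × Bool => doubledLabel k A x st.1 st.2)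
      (fun σ => underWord k A x.positive σ ⊗ₜ[k] overWord k A x.positive σ) =
    TensorProduct.map (phi k A).toLinearMap (phi k A).toLinearMap (universalLabel k A x) := by
  simp only [doubledLabel_eq, universalLabel_eq, map_sum, TensorProduct.map_tmul,
    AlgHom.toLinearMap_apply]
  have comm_map : ∀ (S T : Module.End k A) (z : A ⊗[k] A), TensorProduct.comm k A A
      (TensorProduct.map S T z) = TensorProduct.map T S (TensorProduct.comm k A A z) := by
    intro S T z
    induction z with
    | zero => simp
    | add => simp_all
    | tmul => simp
  have comm_comm : ∀ z : A ⊗[k] A,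
      TensorProduct.comm k A A (TensorProduct.comm k A A z) = z := fun z =>
    by
    induction z with
    | zero => simp
    | add => simp_all
    | tmul => simp
  -- Even powers of γ are bialgebra maps; odd powers, treated next, reverse both structures.
  have ev : ∀ T : Module.End k A, T = LinearMap.id ∨ T = antipode k ∘ₗ antipode k →
      (∀ a b, T (a * b) = T a * T b) ∧
      (∀ a, comul (R := k) (T a) = TensorProduct.map T T (comul a)) ∧
      (∀ a, T (antipode k a) = antipode k (T a)) := by
    rintro T (rfl | rfl)
    · simp
    · simp [antipode_mul_antidistrib, comul_antipode, comm_map, TensorProduct.map_comp]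
  have od : ∀ T : Module.End k A, T = antipode k ∨ T = antipodeInv k A →
      (∀ a b, T (a * b) = T b * T a) ∧
      (∀ a, comul (R := k) (T a) = TensorProduct.map T T (TensorProduct.comm k A A (comul a))) ∧
      (∀ a, T (antipode k a) = antipode k (T a)) := by
    rintro T (rfl | rfl)
    · simp [antipode_mul_antidistrib, comul_antipode]
    · simp [antipodeInv_mul, comul_antipodeInv]
  -- The sign of the crossing is the parity of its twist, checked on the eight kinds of crossings.
  have hx : (x.positive = true ∧
        (x.twist k A = LinearMap.id ∨ x.twist k A = antipode k ∘ₗ antipode k)) ∨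
      (x.positive = false ∧ (x.twist k A = antipode k ∨ x.twist k A = antipodeInv k A)) := by
    have h1 : antipode k ∘ₗ antipodeInv k A = LinearMap.id := by ext; simp
    rcases x with ⟨_ | _, _ | _, _ | _⟩ <;>
      simp [Crossing.positive, Crossing.twist, Crossing.underDir, Crossing.overDir, Dir.apply, h1]
  rcases hx with ⟨hp, hT⟩ | ⟨hp, hT⟩
  · obtain ⟨hm, hc, hγ⟩ := ev _ hT
    rw [hp]
    exact contract_doubled_of_mul _ hm hc hγ
  · obtain ⟨hm, hc, hγ⟩ := od _ hT
    rw [hp]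
    exact contract_doubled_of_antimul _ hm hc hγ

end PhiGenerators

/-! ### The antipode of D(A) and the invertibility of u and of u γ(u). -/

section DrinU
variable {k A : Type*} [Field k] [Ring A] [HopfAlgebra k A] [Module.Finite k A]
  [BijectiveAntipode k A]

/-- The comultiplication of `γ⁻¹(a)`. -/
def reprAntipodeInv {ι : Type*} {a : A} (r : Repr k a ι) : Repr k (antipodeInv k A a) ι where
  index := r.index
  left i := antipodeInv k A (r.right i)
  right i := antipodeInv k A (r.left i)
  eq := by rw [comul_antipodeInv, ← r.eq]; simp

/-- The comultiplication of `γ(a)`. -/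
def reprAntipode {ι : Type*} {a : A} (r : Repr k a ι) : Repr k (antipode k a) ι where
  index := r.index
  left i := antipode k (r.right i)
  right i := antipode k (r.left i)
  eq := by rw [comul_antipode, ← r.eq]; simp

variable (k A) in
/-- The element `∑ (e^a ⊗ 1) (1 ⊗ T(e_a))` of `D(A)`. -/
def drinOfEnd (S T : Module.End k A) : Drin k A :=
  ∑ i, Twisted.inl _ (transp k S (dualVec k A i)) * Twisted.inr _ (T (Module.finBasis k A i))

/-- The map `f ⊗ a ↦ f(x) a`. -/
def evalFst (x : A) : Drin k A →ₗ[k] A :=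
  evalSnd x ∘ₗ (TensorProduct.comm k (DualAlg k A) A).toLinearMap ∘ₗ
    (Twisted.ofTensor (drinCoaction k A)).symm.toLinearMap

lemma evalFst_mk (x : A) (f : DualAlg k A) (a : A) :
    evalFst (k := k) x (Twisted.mk _ f a) = f x • a := rfl

lemma evalFst_ext {z w : Drin k A} (h : ∀ x, evalFst (k := k) x z = evalFst x w) : z = w := by
  have := evalSnd_ext h
  exact (Twisted.ofTensor (drinCoaction k A)).symm.injective
    ((TensorProduct.comm k (DualAlg k A) A).injective this)

variable (k A) in
/-- The map `s ⊗ t ↦ t γ⁻¹(s)`. -/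
def mulInvSwap : A ⊗[k] A →ₗ[k] A :=
  LinearMap.mul' k A ∘ₗ (antipodeInv k A).lTensor A ∘ₗ (TensorProduct.comm k A A).toLinearMap

/-- Applying γ turns this into the antipode axiom. -/
lemma mulInvSwap_comul (a : A) :
    mulInvSwap k A (comul (R := k) a) = algebraMap k A (counit a) := by
  refine antipode_inj (k := k) ?_
  trans LinearMap.mul' k A ((antipode k).lTensor A (comul (R := k) a))
  · rw [← (ℛ k a).eq]
    simp [mulInvSwap, antipode_mul_antidistrib]
  · rw [mul_antipode_lTensor_comul_apply]
    simp [Algebra.algebraMap_eq_smul_one]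

lemma evalFst_mul_inr (x : A) (z : Drin k A) (b : A) :
    evalFst (k := k) x (z * Twisted.inr _ b) = evalFst x z * b := by
  obtain ⟨z, rfl⟩ := (Twisted.ofTensor (drinCoaction k A)).surjective z
  induction z with
  | zero => simp
  | add => simp_all [add_mul]
  | tmul f a =>
    rw [← Twisted.mk_eq, ← Twisted.inl_mul_inr, mul_assoc, ← map_mul, Twisted.inl_mul_inr,
      Twisted.inl_mul_inr, evalFst_mk, evalFst_mk, smul_mul_assoc]

lemma evalFst_inl_mul {ι : Type*} {x : A} (r : Repr k x ι) (f : DualAlg k A) (z : Drin k A) :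
    evalFst (k := k) x (Twisted.inl _ f * z) =
      ∑ i ∈ r.index, f (r.left i) • evalFst (r.right i) z := by
  obtain ⟨z, rfl⟩ := (Twisted.ofTensor (drinCoaction k A)).surjective z
  induction z with
  | zero => simp
  | add => simp_all [mul_add, Finset.sum_add_distrib]
  | tmul g a =>
    rw [← Twisted.mk_eq, ← Twisted.inl_mul_inr, ← mul_assoc, ← map_mul, Twisted.inl_mul_inr,
      Twisted.inl_mul_inr, evalFst_mk, dual_mul_apply k A _ _ _ r, Finset.sum_smul]
    simp [evalFst_mk, mul_smul]

lemma evalFst_inr_mul_inl {ι : Type*} {κ : ι → Type*} {a : A} (r : Repr k a ι)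
    (s : ∀ i, Repr k (r.right i) (κ i)) (x : A) (g : DualAlg k A) :
    evalFst (k := k) x (Twisted.inr _ a * Twisted.inl _ g) =
      ∑ i ∈ r.index, ∑ j ∈ (s i).index,
        g (antipodeInv k A ((s i).right j) * (x * r.left i)) • (s i).left j := by
  rw [Twisted.inr_mul_inl, exch_drin r s]
  simp only [map_sum, ← Twisted.mk_eq, evalFst_mk, mul_one]
  rfl

/-- After the exchange of `a` with the dual basis, the sum over that basis inserts the argument of
the functional into `T`. -/
lemma evalFst_inr_mul_drinOfEnd {ι : Type*} {κ : ι → Type*} {a : A} (r : Repr k a ι)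
    (s : ∀ i, Repr k (r.right i) (κ i)) (x : A) (T : Module.End k A) :
    evalFst (k := k) x (Twisted.inr _ a * drinOfEnd k A LinearMap.id T) =
      ∑ i ∈ r.index, ∑ j ∈ (s i).index,
        (s i).left j * T (antipodeInv k A ((s i).right j) * (x * r.left i)) := by
  simp only [drinOfEnd, Finset.mul_sum, map_sum, ← mul_assoc (Twisted.inr _ a), evalFst_mul_inr,
    evalFst_inr_mul_inl r s, Finset.sum_mul]
  rw [Finset.sum_comm]
  refine Finset.sum_congr rfl fun i _ => ?_
  rw [Finset.sum_comm]
  refine Finset.sum_congr rfl fun j _ => ?_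
  conv_rhs => rw [← sum_dualVec_smul (k := k) (antipodeInv k A ((s i).right j) * (x * r.left i))]
  simp [Finset.mul_sum]

lemma coassoc_four : (TensorProduct.assoc k (A ⊗[k] A) A A).toLinearMap ∘ₗ
    TensorProduct.map (TensorProduct.map comul LinearMap.id ∘ₗ comul) LinearMap.id ∘ₗ comul =
    TensorProduct.map comul comul ∘ₗ comul (R := k) (A := A) := by
  simp only [coassoc_simps]

lemma drinU_eq : drinU k A = drinOfEnd k A (antipodeInv k A) LinearMap.id := by
  simp [drinU, drinOfEnd, rMatrix, canonicalElement_eq]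

/-- Evaluate the dual tensorand at x. The exchange relation splits the product into two contractions
of the form γ⁻¹(t)s and γ²(tγ⁻¹(s)), and by coassociativity they are applied to the coproducts of x'
and of x''; both reduce to counits. -/
lemma drinU_mul : drinU k A * drinOfEnd k A LinearMap.id (antipode k ∘ₗ antipode k) = 1 := by
  refine evalFst_ext fun x => ?_
  rw [drinU_eq]
  conv_lhs => enter [2, 1]; rw [drinOfEnd]
  simp only [Finset.sum_mul, map_sum, mul_assoc, evalFst_inl_mul (ℛ k x), transp_apply]
  rw [Finset.sum_comm]
  -- The sum over the dual basis reassembles γ⁻¹(y); here y and z will be the two parts of Δ(x).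
  have e : ∀ y z : A, ∑ j, dualVec k A j (antipodeInv k A y) •
      evalFst (k := k) z (Twisted.inr _ (Module.finBasis k A j) *
        drinOfEnd k A LinearMap.id (antipode k ∘ₗ antipode k)) =
      LinearMap.mul' k A (TensorProduct.map invMulSwap
        (antipode k ∘ₗ antipode k ∘ₗ mulInvSwap k A)
        (TensorProduct.assoc k (A ⊗[k] A) A A
          (TensorProduct.map comul LinearMap.id (comul (R := k) y) ⊗ₜ z))) := by
    intro y z
    trans evalFst (k := k) z (Twisted.inr _ (antipodeInv k A y) *
        drinOfEnd k A LinearMap.id (antipode k ∘ₗ antipode k))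
    · conv_rhs => rw [← sum_dualVec_smul (k := k) (antipodeInv k A y)]
      simp [Finset.sum_mul]
    · rw [evalFst_inr_mul_drinOfEnd (reprAntipodeInv (ℛ k y))
        (fun i => reprAntipodeInv (ℛ k ((ℛ k y).left i)))]
      rw [← (ℛ k y).eq]
      simp only [map_sum, TensorProduct.sum_tmul, TensorProduct.map_tmul]
      refine Finset.sum_congr rfl fun i _ => ?_
      rw [← (ℛ k ((ℛ k y).left i)).eq]
      simp only [map_sum, TensorProduct.sum_tmul]
      refine Finset.sum_congr rfl fun j _ => ?_
      simp [reprAntipodeInv, invMulSwap, mulInvSwap, antipode_mul_antidistrib, mul_assoc]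
  simp only [LinearMap.id_apply, e]
  have key := congrArg (LinearMap.mul' k A ∘ₗ TensorProduct.map invMulSwap
        (antipode k ∘ₗ antipode k ∘ₗ mulInvSwap k A)) (congr($(coassoc_four (k := k) (A := A)) x))
  simp only [LinearMap.comp_apply] at key
  rw [← (ℛ k x).eq] at key
  simp only [map_sum, TensorProduct.map_tmul, LinearMap.comp_apply, invMulSwap_comul,
    mulInvSwap_comul, LinearMap.id_apply, LinearEquiv.coe_coe] at key ⊢
  rw [key, Twisted.one_def, evalFst_mk]
  conv_rhs => rw [← sum_counit_smul (ℛ k x)]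
  rw [map_sum, Finset.sum_smul]
  simp [Algebra.algebraMap_eq_smul_one, smul_smul, mul_comm]

/-- D(A) is finite-dimensional, hence Noetherian, and a one-sided inverse in such a ring is
two-sided. -/
lemma mul_drinU : drinOfEnd k A LinearMap.id (antipode k ∘ₗ antipode k) * drinU k A = 1 := by
  have : IsNoetherian k (Drin k A) := inferInstance
  have : IsNoetherianRing (Drin k A) := isNoetherian_of_tower k this
  exact mul_eq_one_comm.1 drinU_mul

variable (k A) in
/-- The universal `u` as a unit. -/
def drinUUnit : (Drin k A)ˣ :=
  ⟨drinU k A, drinOfEnd k A LinearMap.id (antipode k ∘ₗ antipode k), drinU_mul, mul_drinU⟩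

/-- Auxiliary contraction `(p ⊗ q) ⊗ (m ⊗ (s ⊗ t)) ↦ g(γ⁻¹(t) s γ⁻¹(x) γ⁻¹(q) p) γ(m)`. -/
def contrAntipode (x : A) (g : DualAlg k A) : (A ⊗[k] A) ⊗[k] (A ⊗[k] (A ⊗[k] A)) →ₗ[k] A :=
  (TensorProduct.rid k A).toLinearMap ∘ₗ TensorProduct.map (antipode k)
    (g.ofConv ∘ₗ LinearMap.mul' k A ∘ₗ (TensorProduct.comm k A A).toLinearMap ∘ₗ
      (LinearMap.mulRight k (antipodeInv k A x)).lTensor A) ∘ₗ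
    (TensorProduct.leftComm k A A A).toLinearMap ∘ₗ
    TensorProduct.map invMulSwap (TensorProduct.map LinearMap.id invMulSwap)

lemma contrAntipode_tmul (x : A) (g : DualAlg k A) (z w : A ⊗[k] A) (m : A) :
    contrAntipode x g (z ⊗ₜ (m ⊗ₜ w)) =
      g (invMulSwap w * antipodeInv k A x * invMulSwap z) • antipode k m := rfl

lemma coassoc_antipode : (TensorProduct.assoc k A A (A ⊗[k] (A ⊗[k] A))).symm.toLinearMap ∘ₗ
    TensorProduct.map LinearMap.id ((TensorProduct.assoc k A A (A ⊗[k] A)).toLinearMap ∘ₗ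
      (TensorProduct.assoc k (A ⊗[k] A) A A).toLinearMap ∘ₗ
      TensorProduct.map (TensorProduct.map comul LinearMap.id ∘ₗ comul) LinearMap.id ∘ₗ comul) ∘ₗ
      comul =
    TensorProduct.map comul (TensorProduct.map LinearMap.id comul ∘ₗ comul) ∘ₗ
      comul (R := k) (A := A) := by
  simp only [coassoc_simps]

/-- The essential case of antimultiplicativity. The antipode undoes the exchange of a and g: a
second exchange produces two factors of the form γ⁻¹(t)s, which cancel to counits. -/
lemma drinAntipode_inr_mul_inl (a : A) (g : DualAlg k A) :
    drinAntipode k A (Twisted.inr _ a * Twisted.inl _ g) =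
      drinAntipode k A (Twisted.inl _ g) * drinAntipode k A (Twisted.inr _ a) := by
  refine evalFst_ext fun x => ?_
  have key := congrArg (contrAntipode x g) (congr($(coassoc_antipode (k := k) (A := A)) a))
  simp only [LinearMap.comp_apply] at key
  -- The value of both sides at x.
  trans g (antipodeInv k A x) • antipode k a
  · rw [Twisted.inr_mul_inl, exch_drin (ℛ k a) (fun i => ℛ k _)]
    simp only [map_sum, ← Twisted.mk_eq, drinAntipode_mk, mul_one]
    -- Coassociativity groups the five parts of the iterated coproduct as two, one and two, so that
    -- each outer pair is a full coproduct.
    trans contrAntipode x g (TensorProduct.map comul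
      (TensorProduct.map LinearMap.id comul ∘ₗ comul) (comul (R := k) a))
    · rw [← key, ← (ℛ k a).eq]
      simp only [map_sum, TensorProduct.map_tmul, LinearMap.comp_apply]
      refine Finset.sum_congr rfl fun i _ => ?_
      rw [← (ℛ k ((ℛ k a).right i)).eq]
      simp only [map_sum, TensorProduct.map_tmul, LinearMap.comp_apply, TensorProduct.tmul_sum]
      refine Finset.sum_congr rfl fun j _ => ?_
      set c := (ℛ k ((ℛ k a).right i)).left j
      rw [evalFst_inr_mul_inl (reprAntipode (ℛ k c)) (fun l => reprAntipode (ℛ k ((ℛ k c).left l))),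
        ← (ℛ k c).eq]
      simp only [map_sum, TensorProduct.map_tmul, TensorProduct.tmul_sum, TensorProduct.sum_tmul]
      refine Finset.sum_congr rfl fun l _ => ?_
      rw [← (ℛ k ((ℛ k c).left l)).eq]
      simp only [map_sum, TensorProduct.tmul_sum, TensorProduct.sum_tmul]
      refine Finset.sum_congr rfl fun m _ => ?_
      simp [reprAntipode, contrAntipode_tmul, invMulSwap, antipodeInv_mul, mul_assoc]
    · rw [← (ℛ k a).eq]
      conv_rhs => rw [← sum_counit_smul (ℛ k a)]
      simp only [map_sum, TensorProduct.map_tmul, LinearMap.comp_apply, map_smul, Finset.smul_sum]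
      refine Finset.sum_congr rfl fun i _ => ?_
      rw [← (ℛ k ((ℛ k a).right i)).eq]
      conv_rhs => rw [← sum_smul_counit' (ℛ k ((ℛ k a).right i))]
      simp only [map_sum, TensorProduct.map_tmul, TensorProduct.tmul_sum, contrAntipode_tmul,
        invMulSwap_comul, Algebra.algebraMap_eq_smul_one, map_smul, Finset.smul_sum]
      refine Finset.sum_congr rfl fun j _ => ?_
      simp [smul_smul]
      ring_nf
  · rw [drinAntipode_inl, drinAntipode_inr, Twisted.inl_mul_inr, evalFst_mk, transp_apply]

/-- In (f ⊗ a)(g ⊗ b) = f · (a g) · b the outer factors can be split off, since they already stand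
in the normal order; the inner product is the case treated before. -/
lemma drinAntipode_mul (x y : Drin k A) :
    drinAntipode k A (x * y) = drinAntipode k A y * drinAntipode k A x := by
  have key : ∀ f (z : Drin k A) b, drinAntipode k A (Twisted.inl _ f * z * Twisted.inr _ b) =
      drinAntipode k A (Twisted.inr _ b) * drinAntipode k A z *
        drinAntipode k A (Twisted.inl _ f) := by
    intro f z b
    obtain ⟨z, rfl⟩ := (Twisted.ofTensor (drinCoaction k A)).surjective z
    induction z with
    | zero => simp
    | add => simp_all [mul_add, add_mul]
    | tmul g c =>
      rw [← Twisted.mk_eq, drinAntipode_mk, ← Twisted.inl_mul_inr, ← mul_assoc, ← map_mul,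
        mul_assoc _ (Twisted.inr _ c), ← map_mul, Twisted.inl_mul_inr, drinAntipode_mk]
      simp [transp_antipodeInv_mul, antipode_mul_antidistrib, mul_assoc]
  obtain ⟨x, rfl⟩ := (Twisted.ofTensor (drinCoaction k A)).surjective x
  obtain ⟨y, rfl⟩ := (Twisted.ofTensor (drinCoaction k A)).surjective y
  induction x with
  | zero => simp
  | add => simp_all [add_mul, mul_add]
  | tmul f a =>
    induction y with
    | zero => simp
    | add => simp_all [add_mul, mul_add]
    | tmul g b =>
      have e : Twisted.ofTensor _ (f ⊗ₜ a) * Twisted.ofTensor _ (g ⊗ₜ b) =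
          Twisted.inl (drinCoaction k A) f * (Twisted.inr _ a * Twisted.inl _ g) *
            Twisted.inr _ b := by
        simp only [← Twisted.mk_eq, ← Twisted.inl_mul_inr, mul_assoc]
      rw [e, key, drinAntipode_inr_mul_inl]
      simp only [← Twisted.mk_eq, drinAntipode_mk, drinAntipode_inl, drinAntipode_inr, mul_assoc]

/-- An antimultiplicative unital map carries the inverse of u to an inverse of γ(u). This is what
makes θ, whose square is this element, invertible. -/
lemma isUnit_drinU_mul_drinAntipode : IsUnit (drinU k A * drinAntipode k A (drinU k A)) := by
  have h1 : drinAntipode k A 1 = 1 := by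
    rw [← map_one (Twisted.inr (drinCoaction k A)), drinAntipode_inr, antipode_one]
  refine (drinUUnit k A).isUnit.mul
    (⟨⟨_, drinAntipode k A (drinUUnit k A).inv, ?_, ?_⟩, rfl⟩ :
      IsUnit (drinAntipode k A (drinU k A)))
  · rw [← drinAntipode_mul]
    exact (congrArg _ mul_drinU).trans h1
  · rw [← drinAntipode_mul]
    exact (congrArg _ drinU_mul).trans h1

/-- The label of the crossing that replaces a left-to-right maximum or minimum. -/
lemma mul_comm_universalLabel (isMax : Bool) :
    LinearMap.mul' k (Drin k A) (TensorProduct.comm k _ _ (universalLabel k A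
      { slashOver := !isMax, slash := .up, back := .down })) =
    if isMax then Ring.inverse (drinU k A) else drinU k A := by
  rw [universalLabel_eq]
  cases isMax
  · simp only [map_sum, TensorProduct.comm_tmul, LinearMap.mul'_apply, Bool.false_eq_true, if_false]
    -- For a minimum the twist is γ⁻¹; moving it back to A^* gives the expression for u in
    -- `drinU_eq`.
    have := map_transp_canonicalElement (k := k) (A := A) LinearMap.id (antipodeInv k A)
    have h2 := congrArg (LinearMap.mul' k (Drin k A) ∘ₗ (TensorProduct.comm k _ _).toLinearMap ∘ₗ
      TensorProduct.map (Twisted.inr (drinCoaction k A)).toLinearMap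
      (Twisted.inl (drinCoaction k A)).toLinearMap) this
    simp only [canonicalElement_eq, map_sum, LinearMap.comp_apply, TensorProduct.map_tmul,
      LinearEquiv.coe_coe, TensorProduct.comm_tmul, LinearMap.mul'_apply] at h2
    rw [drinU_eq, drinOfEnd]
    exact h2.symm
  -- For a maximum the twist is γ², and the product is literally the inverse found for u.
  · rw [if_pos rfl, ringInverse_eq drinU_mul mul_drinU, drinOfEnd]
    simp only [map_sum, TensorProduct.comm_tmul, LinearMap.mul'_apply]
    rfl

end DrinU

/-! ### Events along components, and change of base points. -/

section Codes

/-- The kind of the strand on which an event is met. -/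
def Event.kind {Cr Ex : Type} : Event Cr Ex → PassKind
  | .under _ => .under
  | .over _ => .over
  | .extremum _ => .extremum

/-- The place of an event of a diagram. -/
def TangleDiagram.eventPos {D : TangleDiagram} : Event D.Crossings D.Extrema → D.Pos
  | .under c => c.1
  | .over c => c.1
  | .extremum e => e.1

lemma Fragment.existsUnique_pass_of_crossing {F : Fragment} (h : F.crossing?.isSome)
    {κ : PassKind} (hκ : κ = .under ∨ κ = .over) :
    ∃! j : Fin F.passes.length, (F.passes.get j).kind = κ := by
  rcases F with d | ⟨s, a, b⟩ | b | b
  · simp [crossing?] at h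
  · have e : ∀ j : Fin 2, j = 0 ∨ j = 1 := by decide
    rcases hκ with rfl | rfl <;> cases s <;> cases a <;> cases b
    all_goals
      first
      | exact ⟨(0 : Fin 2), rfl, fun j hj => (e j).resolve_right (by rintro rfl; cases hj)⟩
      | exact ⟨(1 : Fin 2), rfl, fun j hj => (e j).resolve_left (by rintro rfl; cases hj)⟩
  · simp [crossing?] at h
  · simp [crossing?] at h

lemma Fragment.existsUnique_pass_of_extremum {F : Fragment} (h : F.extremum?.isSome) :
    ∃! j : Fin F.passes.length, (F.passes.get j).kind = .extremum := by
  rcases F with d | ⟨s, a, b⟩ | b | b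
  · simp [extremum?] at h
  · simp [extremum?] at h
  all_goals
    cases b
    · simp [extremum?] at h
    · exact ⟨(0 : Fin 1), rfl, fun j _ => Subsingleton.elim (α := Fin 1) _ _⟩

/-- The place and the kind determine the strand: a crossing has one under and one over strand, an
extremum has one strand. -/
lemma TangleDiagram.existsUnique_piece {D : TangleDiagram} (e : Event D.Crossings D.Extrema) :
    ∃! q : D.Piece, q.1 = eventPos e ∧ q.pass.kind = e.kind := by
  have : ∃! j : Fin (D.frag (eventPos e)).passes.length,
      ((D.frag (eventPos e)).passes.get j).kind = e.kind := by
    rcases e with c | c | x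
    · exact Fragment.existsUnique_pass_of_crossing c.2 (.inl rfl)
    · exact Fragment.existsUnique_pass_of_crossing c.2 (.inr rfl)
    · exact Fragment.existsUnique_pass_of_extremum x.2
  obtain ⟨j, hj, hu⟩ := this
  refine ⟨⟨eventPos e, j⟩, ⟨rfl, hj⟩, ?_⟩
  rintro ⟨p, j'⟩ ⟨hp, hk⟩
  dsimp only at hp
  subst hp
  rw [hu j' hk]

lemma TangleDiagram.Piece.events_eq {D : TangleDiagram} (q : D.Piece)
    (e : Event D.Crossings D.Extrema) (h : q.1 = eventPos e ∧ q.pass.kind = e.kind) :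
    q.events = [e] := by
  obtain ⟨h1, h2⟩ := h
  unfold events
  rcases e with c | c | x <;> simp only [Event.kind, eventPos] at h1 h2 <;> split <;>
    rename_i h3 <;> rw [h2] at h3 <;> cases h3 <;> simp [h1]

lemma TangleDiagram.Piece.of_mem_events {D : TangleDiagram} {q : D.Piece}
    {e : Event D.Crossings D.Extrema} (h : e ∈ q.events) :
    q.1 = eventPos e ∧ q.pass.kind = e.kind := by
  unfold events at h
  split at h <;> simp at h <;> subst h <;> simp_all [eventPos, Event.kind]

lemma ComponentOrdering.occursOnce_comp {D : TangleDiagram} {n : ℕ} (o : ComponentOrdering D n) :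
    OccursOnce o.comp := by
  intro q
  obtain ⟨⟨i, j⟩, hij⟩ := o.bijective.2 q
  dsimp only at hij
  have inj : ∀ i' (j' : Fin (o.comp i').length), (o.comp i').get j' = q →
      (⟨i', j'⟩ : (i : Fin n) × Fin (o.comp i).length) = ⟨i, j⟩ := fun i' j' h' =>
    o.bijective.1 (h'.trans hij.symm)
  have hl : o.comp i = (o.comp i).take j ++ q :: (o.comp i).drop (j + 1) := by
    rw [← hij]
    simp
  refine ⟨i, _, _, hl, ?_, ?_, ?_⟩
  · intro h
    obtain ⟨m, hm, hq⟩ := List.mem_iff_getElem.1 h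
    rw [List.getElem_take] at hq
    rw [List.length_take] at hm
    have := inj i ⟨m, by omega⟩ hq
    simp at this
    have := congrArg Fin.val this
    simp at this
    omega
  · intro h
    obtain ⟨m, hm, hq⟩ := List.mem_iff_getElem.1 h
    rw [List.getElem_drop] at hq
    rw [List.length_drop] at hm
    have := inj i ⟨j + 1 + m, by omega⟩ hq
    simp at this
    have := congrArg Fin.val this
    simp at this
    omega
  · intro i' hi' h
    obtain ⟨m, hm, hq⟩ := List.mem_iff_getElem.1 h
    exact hi' (congrArg Sigma.fst (inj i' ⟨m, hm⟩ hq))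

/-- The events met along a component of a diagram. -/
def ComponentOrdering.word {D : TangleDiagram} {n : ℕ} (o : ComponentOrdering D n) (i : Fin n) :
    List (Event D.Crossings D.Extrema) :=
  (o.comp i).flatMap TangleDiagram.Piece.events

/-- An event determines its piece, and the pieces are enumerated without repetition. This is the
source of all multilinearity in the labels. -/
lemma ComponentOrdering.occursOnce_word {D : TangleDiagram} {n : ℕ} (o : ComponentOrdering D n) :
    OccursOnce o.word := by
  intro e
  obtain ⟨q, hq, hu⟩ := TangleDiagram.existsUnique_piece e
  obtain ⟨i, l, m, hi, hl, hm, hj⟩ := o.occursOnce_comp q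
  have key : ∀ l : List D.Piece, q ∉ l → e ∉ l.flatMap TangleDiagram.Piece.events := by
    intro l hl he
    obtain ⟨q', hq', he'⟩ := List.mem_flatMap.1 he
    exact hl (hu q' (TangleDiagram.Piece.of_mem_events he') ▸ hq')
  refine ⟨i, _, _, ?_, key l hl, key m hm, fun j h => key _ (hj j h)⟩
  rw [word, hi, List.flatMap_append, List.flatMap_cons, q.events_eq e hq]
  rfl

/-- A component with boundary admits no nontrivial rotation: some piece would end at its starting
point. -/
lemma ComponentOrdering.word_eq_or_isRotated {D : TangleDiagram} {n : ℕ}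
    {o o' : ComponentOrdering D n} (h : ∀ i, (o.comp i).IsRotated (o'.comp i)) (i : Fin n) :
    o.word i = o'.word i ∨ (o.IsClosed i ∧ ∃ l m, o.word i = l ++ m ∧
      o'.word i = m ++ l) := by
  obtain ⟨r, hr⟩ := h i
  rw [List.rotate_eq_drop_append_take_mod] at hr
  set l := (o.comp i).take (r % (o.comp i).length) with hl
  set m := (o.comp i).drop (r % (o.comp i).length) with hm
  have hlm : o.comp i = l ++ m := (List.take_append_drop _ _).symm
  by_cases hc : o.IsClosed i
  · refine .inr ⟨hc, l.flatMap TangleDiagram.Piece.events, m.flatMap TangleDiagram.Piece.events,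
      ?_, ?_⟩
    · rw [word, ← List.flatMap_append, ← hlm]
    · rw [word, ← List.flatMap_append, hr]
  · left
    have hs := ((o.complete i).resolve_left hc).1
    have : l = [] ∨ m = [] := by
      by_contra! hne
      obtain ⟨hl0, hm0⟩ := hne
      have hch := o'.chain i
      rw [← hr, List.isChain_append] at hch
      -- In the rotated list the last piece of `m` is followed by the first piece of `l`, where the
      -- open component begins.
      refine hs (m.getLast hm0) ?_
      have e : (o.comp i).head (o.nonempty i) = l.head hl0 := by
        simp only [hlm, List.head_append_of_ne_nil hl0]
      rw [e]
      exact hch.2.2 _ (List.getLast_mem_getLast? hm0) _ (List.head_mem_head? hl0)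
    rw [word, word, ← hr, hlm]
    rcases this with h0 | h0 <;> simp [h0]

end Codes

/-! ### Independence of J from the base points. -/

section Rotation
variable {k B : Type*} [Field k] [Ring B] [Algebra k B]

lemma mk_mul_comm_of_closed {closed : Prop} (h : closed) (a b : B) :
    (Submodule.Quotient.mk (a * b) : TraceSpace k B closed) = Submodule.Quotient.mk (b * a) :=
  (Submodule.Quotient.eq _).2 (Submodule.subset_span ⟨h, a, b, rfl⟩)

variable (A : Type*) [Ring A] [HopfAlgebra k A] [Module.Finite k A] [BijectiveAntipode k A]

/-- The labels from which the universal invariant is computed. -/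
def drinLabel {Cr Ex : Type} (isMax : Ex → Bool) (σ : Cr → Drin k A × Drin k A) :
    Event Cr Ex → DrinTheta k A
  | .under c => AdjoinSqrt.of k _ _ (σ c).1
  | .over c => AdjoinSqrt.of k _ _ (σ c).2
  | .extremum e => extremumLabel k A (isMax e)

lemma universalInvariant_eq {n : ℕ} (G : GaussCode n) (closed : Fin n → Prop) :
    universalInvariant k A G closed = contract (fun c => universalLabel k A (G.info c)) fun σ =>
      PiTensorProduct.tprod k fun i => Submodule.Quotient.mk <|
        readLabels (drinLabel A G.isMax σ) (G.comp i) := by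
  unfold universalInvariant
  refine congrArg (contract _) (funext fun σ => congrArg _ (funext fun i => ?_))
  refine congrArg _ (readLabels_congr fun e _ => ?_)
  cases e <;> rfl

variable {A} in
/-- The universal invariant does not depend on the base points of the closed components. -/
lemma universalInvariant_eq_of_rotate {n : ℕ} (G : GaussCode n)
    (w : Fin n → List (Event G.Cr G.Ex)) {closed : Fin n → Prop}
    (h : ∀ i, G.comp i = w i ∨ (closed i ∧ ∃ l m, G.comp i = l ++ m ∧ w i = m ++ l)) :
    universalInvariant k A G closed = universalInvariant k A { G with comp := w } closed := by
  rw [universalInvariant_eq, universalInvariant_eq]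
  refine congrArg (contract _) (funext fun σ => congrArg _ (funext fun i => ?_))
  rcases h i with e | ⟨hc, l, m, e, e'⟩
  · dsimp only
    rw [e]
  · dsimp only
    rw [e, e', readLabels_append, readLabels_append]
    exact mk_mul_comm_of_closed (k := k) (B := DrinTheta k A) hc _ _

end Rotation

lemma ComponentOrdering.universalInvariant_eq {k A : Type*} [Field k] [Ring A] [HopfAlgebra k A]
    [Module.Finite k A] [BijectiveAntipode k A] {D : TangleDiagram} {n : ℕ}
    {o o' : ComponentOrdering D n} (h : ∀ i, (o.comp i).IsRotated (o'.comp i)) :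
    universalInvariant k A o.code o.IsClosed = universalInvariant k A o'.code o.IsClosed :=
  universalInvariant_eq_of_rotate o.code o'.word (ComponentOrdering.word_eq_or_isRotated h)

/-! ### Labels of events obtained from labels of crossings. -/

section Labels

/-- A function on events given by its values at the three kinds of events. -/
def Event.elim {Cr Ex : Type} {R : Type*} (f g : Cr → R) (h : Ex → R) : Event Cr Ex → R
  | .under c => f c
  | .over c => g c
  | .extremum e => h e

lemma Event.elim_update_extremum {Cr Ex : Type} {R : Type*} [DecidableEq (Event Cr Ex)]
    [DecidableEq Ex] (f g : Cr → R) (h : Ex → R) (e : Ex) (x : R) :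
    Event.elim f g (Function.update h e x) =
      Function.update (Event.elim f g h) (.extremum e) x := by
  funext y
  cases y <;> simp [Event.elim, Function.update_apply]

/-- The labels of the events of a code that are obtained from labels of the crossings of the code
in which the extrema are replaced with crossings. -/
def crossingLabel {Cr Ex : Type} {R : Type*} [Mul R] (τ : Cr ⊕ Ex → R × R) : Event Cr Ex → R :=
  Event.elim (fun c => (τ (.inl c)).1) (fun c => (τ (.inl c)).2)
    fun e => (τ (.inr e)).2 * (τ (.inr e)).1

end Labels

/-! ### Multilinearity in the labels after the extrema are replaced by crossings. -/

section Multilinear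
variable {k R M : Type*} {Cr Ex : Type} [Field k] [Ring R] [Algebra k R] [AddCommMonoid M]
  [Module k M]

lemma crossingLabel_update_inl [DecidableEq (Cr ⊕ Ex)] [DecidableEq (Event Cr Ex)]
    (τ : Cr ⊕ Ex → R × R) (c : Cr) (v w : R) :
    crossingLabel (Function.update τ (.inl c) (v, w)) =
      Function.update (Function.update (crossingLabel τ) (.under c) v) (.over c) w := by
  funext x
  rcases x with d | d | d
  · by_cases h : d = c <;> simp [h, crossingLabel, Event.elim]
  · by_cases h : d = c <;> simp [h, crossingLabel, Event.elim]
  · simp [crossingLabel, Event.elim]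

lemma crossingLabel_update_inr [DecidableEq (Cr ⊕ Ex)] [DecidableEq (Event Cr Ex)]
    (τ : Cr ⊕ Ex → R × R) (e : Ex) (v w : R) :
    crossingLabel (Function.update τ (.inr e) (v, w)) =
      Function.update (crossingLabel τ) (.extremum e) (w * v) := by
  funext x
  rcases x with d | d | d
  · simp [crossingLabel, Event.elim]
  · simp [crossingLabel, Event.elim]
  · by_cases h : d = e <;> simp [h, crossingLabel, Event.elim, Function.update_apply]

/-- A genuine crossing feeds its two entries to two different events; a crossing that replaces an
extremum feeds their product to a single event. Either way the dependence on each entry is linear.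
-/
lemma isBimultilinear_crossingLabel (Ω : MultilinearMap k (fun _ : Event Cr Ex => R) M) :
    IsBimultilinear k fun τ : Cr ⊕ Ex → R × R => Ω (crossingLabel τ) := by
  classical
  refine isBimultilinear_of_map k fun τ c => ?_
  rcases c with c | e
  · have comm : ∀ v w : R,
        Function.update (Function.update (crossingLabel τ) (.under c) v) (.over c) w =
        Function.update (Function.update (crossingLabel τ) (.over c) w) (.under c) v :=
      fun v w => Function.update_comm (by simp) _ _ _
    refine ⟨fun v v' w => ?_, fun r v w => ?_, fun v w w' => ?_, fun r v w => ?_⟩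
    · simp only [crossingLabel_update_inl, comm, Ω.map_update_add]
    · simp only [crossingLabel_update_inl, comm, Ω.map_update_smul]
    · simp only [crossingLabel_update_inl, Ω.map_update_add]
    · simp only [crossingLabel_update_inl, Ω.map_update_smul]
  · refine ⟨fun v v' w => ?_, fun r v w => ?_, fun v w w' => ?_, fun r v w => ?_⟩
    · simp only [crossingLabel_update_inr, mul_add, Ω.map_update_add]
    · simp only [crossingLabel_update_inr, mul_smul_comm, Ω.map_update_smul]
    · simp only [crossingLabel_update_inr, add_mul, Ω.map_update_add]
    · simp only [crossingLabel_update_inr, smul_mul_assoc, Ω.map_update_smul]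

open Classical in
/-- A multilinear map with the variables in the second summand fixed. -/
def MultilinearMap.fixInr {Q : Type*} [AddCommMonoid Q] [Module k Q]
    (Λ : MultilinearMap k (fun _ : Cr ⊕ Ex => Q) M) (x : Ex → Q) :
    MultilinearMap k (fun _ : Cr => Q) M :=
  MultilinearMap.mk' (fun t => Λ (Sum.elim t x))
    (fun t c v w => by simp only [← Sum.update_elim_inl, Λ.map_update_add])
    (fun t c r v => by simp only [← Sum.update_elim_inl, Λ.map_update_smul])

open Classical in
/-- A multilinear map with the variables in the first summand fixed. -/
def MultilinearMap.fixInl {Q : Type*} [AddCommMonoid Q] [Module k Q]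
    (Λ : MultilinearMap k (fun _ : Cr ⊕ Ex => Q) M) (t : Cr → Q) :
    MultilinearMap k (fun _ : Ex => Q) M :=
  MultilinearMap.mk' (fun x => Λ (Sum.elim t x))
    (fun x c v w => by simp only [← Sum.update_elim_inr, Λ.map_update_add])
    (fun x c r v => by simp only [← Sum.update_elim_inr, Λ.map_update_smul])

open Classical in
/-- A multilinear map in the labels of the events with the labels of the crossings fixed. -/
def MultilinearMap.fixCrossings (Ω : MultilinearMap k (fun _ : Event Cr Ex => R) M)
    (f g : Cr → R) : MultilinearMap k (fun _ : Ex => R) M :=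
  MultilinearMap.mk' (fun x => Ω (Event.elim f g x))
    (fun x c v w => by simp only [Event.elim_update_extremum, Ω.map_update_add])
    (fun x c r v => by simp only [Event.elim_update_extremum, Ω.map_update_smul])

/-- The two passages of a crossing that replaces an extremum are consecutive, so its tensor enters
only through the product, over label times under label. The extrema may therefore keep arbitrary
tensors while the crossings carry pure ones. -/
lemma apply_elim_eq [Module.Finite k R] [Fintype Cr] [Fintype Ex]
    (Ω : MultilinearMap k (fun _ : Event Cr Ex => R) M)
    (Λ : MultilinearMap k (fun _ : Cr ⊕ Ex => R ⊗[k] R) M)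
    (hΛ : ∀ τ : Cr ⊕ Ex → R × R, Λ (fun c => (τ c).1 ⊗ₜ (τ c).2) = Ω (crossingLabel τ))
    (f g : Cr → R) (x : Ex → R ⊗[k] R) :
    Λ (Sum.elim (fun c => f c ⊗ₜ g c) x) =
      Ω (Event.elim f g fun e => LinearMap.mul' k R (TensorProduct.comm k R R (x e))) := by
  have : Λ.fixInl (fun c => f c ⊗ₜ g c) = (Ω.fixCrossings f g).compLinearMap fun _ =>
      LinearMap.mul' k R ∘ₗ (TensorProduct.comm k R R).toLinearMap := by
    refine MultilinearMap.ext_tmul fun σ => ?_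
    refine Eq.trans ?_ (hΛ (Sum.elim (fun c => (f c, g c)) σ))
    refine congrArg Λ (funext fun c => ?_)
    cases c <;> rfl
  exact congr($this x)

end Multilinear

/-! ### J'' as a value of the multilinear map. -/

section Doubling
variable {k A : Type*} [Field k] [Ring A] [HopfAlgebra k A] [Module.Finite k A]
  [BijectiveAntipode k A] {n : ℕ}

/-- The thin and the thick copy pass through the same crossings of the original diagram together, so
their words can be cut into blocks, one for each passage. -/
lemma thinWord_tmul_thickWord (G : GaussCode n) (σ : G.leftward.DoubledCr → A × DualAlg k A)
    (i : Fin n) :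
    thinWord k A σ (G.leftward.doubledComp false i) ⊗ₜ[k]
      thickWord k A σ (G.leftward.doubledComp true i) =
    readLabels (crossingLabel fun c : G.Cr ⊕ G.Ex =>
      (underWord k A (G.leftward.info c).positive (fun st => σ (c, st)),
        overWord k A (G.leftward.info c).positive fun st => σ (c, st))) (G.comp i) := by
  simp only [thinWord, thickWord, GaussCode.doubledComp]
  rw [readLabels_flatMap, readLabels_flatMap, readLabels_tmul]
  simp only [GaussCode.leftward]
  rw [readLabels_flatMap]
  refine readLabels_congr fun e _ => ?_
  rcases e with c | c | e
  · simp only [readLabels_map, readLabels_cons, readLabels_nil, one_mul]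
    rfl
  · simp only [readLabels_map, readLabels_cons, readLabels_nil, one_mul]
    rfl
  · simp only [readLabels_map, readLabels_cons, readLabels_nil, one_mul]
    rfl

/-- The contribution of a component to the Heisenberg invariant. -/
def componentMap (C : Set (HHop k A)) (G : GaussCode n) (closed : Fin n → Prop) (i : Fin n) :
    HHop k A →ₗ[k] TraceSpace k (HHTheta k A C) (closed i) :=
  (commutators k (HHTheta k A C) (closed i)).mkQ ∘ₗ
    LinearMap.mulLeft k (intPow (AdjoinSqrt.root k C _) (G.extremumCount i)) ∘ₗ
      (AdjoinSqrt.of k C _).toLinearMap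

/-- Contracting the four doubled crossings over each crossing first, the local identity
`contract_doubledLabel` replaces them by the image of the universal label. -/
lemma heisenbergInvariant_eq (C : Set (HHop k A)) (G : GaussCode n) (closed : Fin n → Prop)
    (hG : OccursOnce G.comp)
    (Λ : MultilinearMap k (fun _ : G.Cr ⊕ G.Ex => HHop k A ⊗[k] HHop k A)
      (⨂[k] i, TraceSpace k (HHTheta k A C) (closed i)))
    (hΛ : ∀ τ : G.Cr ⊕ G.Ex → HHop k A × HHop k A, Λ (fun c => (τ c).1 ⊗ₜ (τ c).2) =
      wordMap hG (componentMap C G closed) (crossingLabel τ)) :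
    heisenbergInvariant k A C G closed = Λ fun c =>
      TensorProduct.map (phi k A).toLinearMap (phi k A).toLinearMap
        (universalLabel k A (G.leftward.info c)) := by
  rw [heisenbergInvariant, heisenbergSum, map_contract]
  simp only [PiTensorProduct.map_tprod, thinWord_tmul_thickWord]
  simp only [← contract_doubledLabel]
  refine Eq.trans ?_ (contract_prod Λ (fun (c : G.Cr ⊕ G.Ex) σ =>
    underWord k A (G.leftward.info c).positive σ ⊗ₜ[k]
      overWord k A (G.leftward.info c).positive σ)
    fun p : (G.Cr ⊕ G.Ex) × (Bool × Bool) =>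
      doubledLabel k A (G.leftward.info p.1) p.2.1 p.2.2)
  refine congrArg (contract _) (funext fun σ => ?_)
  exact (hΛ fun c => (underWord k A (G.leftward.info c).positive (fun st => σ (c, st)),
    overWord k A (G.leftward.info c).positive fun st => σ (c, st))).symm

end Doubling

/-! ### The powers of θ̄, and J as a value of the same multilinear map. -/

section Root
variable {k A : Type*} [Field k] [Ring A] [HopfAlgebra k A] [Module.Finite k A]
  [BijectiveAntipode k A]

/-- The square of θ is a unit, and a factor of a unit that commutes with its cofactor is a unit. -/
lemma isUnit_root : IsUnit (AdjoinSqrt.root k Set.univ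
    (drinU k A * drinAntipode k A (drinU k A)) : DrinTheta k A) := by
  have h := (isUnit_drinU_mul_drinAntipode (k := k) (A := A)).map (AdjoinSqrt.of k Set.univ
    (drinU k A * drinAntipode k A (drinU k A)))
  rw [← AdjoinSqrt.root_mul_root] at h
  exact ((Commute.refl _).isUnit_mul_iff.1 h).1

lemma intPow_units {R : Type*} [Ring R] (x : Rˣ) (d : ℤ) : intPow (x : R) d = ↑(x ^ d) := by
  obtain ⟨m, rfl | rfl⟩ := d.eq_nat_or_neg <;> simp [intPow]

variable (C : Set (HHop k A))

/-- The structure map of the extension of `H(A) ⊗ H(A)^op`. -/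
abbrev toHHTheta : HHop k A →ₐ[k] HHTheta k A C := AdjoinSqrt.of k C _

variable {C} (hC : Set.range (phi k A) ⊆ C)

/-- The element `θ̄` as a unit. -/
def rootUnit : (HHTheta k A C)ˣ := Units.map (phiTheta hC).toMonoidHom isUnit_root.unit

lemma coe_rootUnit : (rootUnit hC : HHTheta k A C) = AdjoinSqrt.root k C _ :=
  phiTheta_root (k := k) (A := A) hC

/-- Only the image of φ has to commute with θ̄, which is why `C` may be any set that contains it. -/
lemma commute_rootUnit_zpow (x : Drin k A) (d : ℤ) :
    Commute (toHHTheta C (phi k A x)) ((rootUnit hC ^ d : (HHTheta k A C)ˣ) : HHTheta k A C) := by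
  refine Commute.units_zpow_right ?_ d
  rw [coe_rootUnit]
  exact (AdjoinSqrt.root_comm k C _ (hC ⟨x, rfl⟩)).symm

lemma rootUnit_zpow_mul (c d : ℤ) (x y : Drin k A) :
    ((rootUnit hC ^ c : (HHTheta k A C)ˣ) : HHTheta k A C) * toHHTheta C (phi k A x) *
      (((rootUnit hC ^ d : (HHTheta k A C)ˣ) : HHTheta k A C) * toHHTheta C (phi k A y)) =
    ((rootUnit hC ^ (c + d) : (HHTheta k A C)ˣ) : HHTheta k A C) *
      toHHTheta C (phi k A (x * y)) := by
  have h : toHHTheta C (phi k A (x * y)) = toHHTheta C (phi k A x) * toHHTheta C (phi k A y) :=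
    map_mul ((toHHTheta C).comp (phi k A)) x y
  rw [h, zpow_add, Units.val_mul]
  simp only [mul_assoc]
  congr 1
  simp only [← mul_assoc]
  congr 1
  exact (commute_rootUnit_zpow hC x d).eq

/-- The factor of the label of a left-to-right extremum that lies in `D(A)`. -/
def extremumFactor (k A : Type*) [Field k] [Ring A] [HopfAlgebra k A] [Module.Finite k A]
    [BijectiveAntipode k A] (isMax : Bool) : Drin k A :=
  if isMax then Ring.inverse (drinU k A) else drinU k A

lemma phiTheta_extremumLabel (isMax : Bool) : phiTheta hC (extremumLabel k A isMax) =
    ((rootUnit hC ^ (if isMax then (1 : ℤ) else -1) : (HHTheta k A C)ˣ) : HHTheta k A C) *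
      toHHTheta C (phi k A (extremumFactor k A isMax)) := by
  rw [← (commute_rootUnit_zpow hC _ _).eq]
  cases isMax
  · have : Ring.inverse (AdjoinSqrt.root k Set.univ
        (drinU k A * drinAntipode k A (drinU k A)) : DrinTheta k A) =
        ↑(isUnit_root (k := k) (A := A)).unit⁻¹ := by
      conv_lhs => rw [← (isUnit_root (k := k) (A := A)).unit_spec]
      exact Ring.inverse_unit _
    simp only [extremumLabel, extremumFactor, Bool.false_eq_true, if_false, map_mul, phiTheta_of,
      this, zpow_neg, zpow_one]
    rfl
  · simp only [extremumLabel, extremumFactor, if_true, map_mul, phiTheta_of, phiTheta_root,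
      zpow_one, coe_rootUnit]

/-- The contribution of an event to the number of left-to-right maxima minus the number of
left-to-right minima. -/
def eventSign {Cr Ex : Type} (isMax : Ex → Bool) : Event Cr Ex → ℤ :=
  Event.elim (fun _ => 0) (fun _ => 0) fun e => if isMax e then 1 else -1

lemma extremumCount_eq {n : ℕ} (G : GaussCode n) (i : Fin n) :
    G.extremumCount i = ((G.comp i).map (eventSign G.isMax)).sum := by
  unfold GaussCode.extremumCount
  congr 2
  funext e
  cases e <;> rfl

/-- Each label is a power of θ̄ times an element of the image of φ, so the powers can be moved to
the left and their exponents add up. -/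
lemma phiTheta_readLabels {Cr Ex : Type} (isMax : Ex → Bool) (σ : Cr → Drin k A × Drin k A)
    (l : List (Event Cr Ex)) :
    phiTheta hC (readLabels (drinLabel A isMax σ) l) =
      ((rootUnit hC ^ (l.map (eventSign isMax)).sum : (HHTheta k A C)ˣ) : HHTheta k A C) *
        toHHTheta C (phi k A
        (readLabels (Event.elim (fun c => (σ c).1) (fun c => (σ c).2)
          fun e => extremumFactor k A (isMax e)) l)) := by
  induction l with
  | nil =>
    rw [readLabels_nil, readLabels_nil, map_one, map_one, map_one, List.map_nil, List.sum_nil,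
      zpow_zero, Units.val_one, mul_one]
  | cons e l ih =>
    have he : phiTheta hC (drinLabel A isMax σ e) = 
        ((rootUnit hC ^ eventSign isMax e : (HHTheta k A C)ˣ) : HHTheta k A C) *
        toHHTheta C (phi k A (Event.elim (fun c => (σ c).1) (fun c => (σ c).2)
          (fun e => extremumFactor k A (isMax e)) e)) := by
      rcases e with c | c | e
      · simp [drinLabel, eventSign, Event.elim, phiTheta_of]
      · simp [drinLabel, eventSign, Event.elim, phiTheta_of]
      · exact phiTheta_extremumLabel hC _
    rw [readLabels_cons, map_mul, ih, he, readLabels_cons, List.map_cons, List.sum_cons, add_comm]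
    exact rootUnit_zpow_mul hC _ _ _ _

lemma mul_comm_map_phi (z : Drin k A ⊗[k] Drin k A) :
    LinearMap.mul' k (HHop k A) (TensorProduct.comm k _ _
      (TensorProduct.map (phi k A).toLinearMap (phi k A).toLinearMap z)) =
    phi k A (LinearMap.mul' k (Drin k A) (TensorProduct.comm k _ _ z)) := by
  have : LinearMap.mul' k (HHop k A) ∘ₗ (TensorProduct.comm k _ _).toLinearMap ∘ₗ
      TensorProduct.map (phi k A).toLinearMap (phi k A).toLinearMap =
      (phi k A).toLinearMap ∘ₗ LinearMap.mul' k (Drin k A) ∘ₗ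
        (TensorProduct.comm k _ _).toLinearMap :=
    TensorProduct.ext' fun x y => (map_mul (phi k A) y x).symm
  exact congr($this z)

/-- In J the extrema already carry products in D(A). They are opened up into tensors of replacing
crossings, and the remaining contraction runs over the genuine crossings only. -/
lemma phiPower_universalInvariant {n : ℕ} (G : GaussCode n) (closed : Fin n → Prop)
    (hG : OccursOnce G.comp)
    (Λ : MultilinearMap k (fun _ : G.Cr ⊕ G.Ex => HHop k A ⊗[k] HHop k A)
      (⨂[k] i, TraceSpace k (HHTheta k A C) (closed i)))
    (hΛ : ∀ τ : G.Cr ⊕ G.Ex → HHop k A × HHop k A, Λ (fun c => (τ c).1 ⊗ₜ (τ c).2) =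
      wordMap hG (componentMap C G closed) (crossingLabel τ)) :
    phiPower hC closed (universalInvariant k A G closed) = Λ fun c =>
      TensorProduct.map (phi k A).toLinearMap (phi k A).toLinearMap
        (universalLabel k A (G.leftward.info c)) := by
  rw [universalInvariant_eq, map_contract]
  let X : G.Ex → HHop k A ⊗[k] HHop k A := fun e =>
    TensorProduct.map (phi k A).toLinearMap (phi k A).toLinearMap
      (universalLabel k A (G.leftward.info (.inr e)))
  -- The slots of the extrema are filled with the images of the universal labels of their replacing
  -- crossings.
  rw [contract_eq_multilinear ((Λ.fixInr X).compLinearMap fun _ =>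
    TensorProduct.map (phi k A).toLinearMap (phi k A).toLinearMap) fun σ => ?_]
  · refine congrArg Λ (funext fun c => ?_)
    cases c <;> rfl
  · refine (apply_elim_eq _ Λ hΛ (fun c => phi k A (σ c).1) (fun c => phi k A (σ c).2) X).trans ?_
    rw [wordMap_apply, phiPower, PiTensorProduct.map_tprod]
    refine congrArg _ (funext fun i => ?_)
    -- At an extremum the product of that tensor is φ(u⁻¹) or φ(u), by `mul_comm_universalLabel`.
    have hL : (Event.elim (fun c => phi k A (σ c).1) (fun c => phi k A (σ c).2) fun e =>
        LinearMap.mul' k (HHop k A) (TensorProduct.comm k _ _ (X e))) = fun e =>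
        phi k A (Event.elim (fun c => (σ c).1) (fun c => (σ c).2)
          (fun e => extremumFactor k A (G.isMax e)) e) := by
      funext e
      rcases e with c | c | e
      · rfl
      · rfl
      · exact (mul_comm_map_phi _).trans (congrArg _ (mul_comm_universalLabel (G.isMax e)))
    rw [hL, ← map_readLabels]
    refine Eq.trans ?_ (congrArg (Submodule.Quotient.mk (p := commutators k (HHTheta k A C)
      (closed i))) (phiTheta_readLabels hC G.isMax σ (G.comp i))).symm
    rw [← extremumCount_eq, ← intPow_units, coe_rootUnit]
    rfl

end Root

end

theorem theorem4p1 {k A : Type*} [Field k] [Ring A] [HopfAlgebra k A] [Module.Finite k A]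
    [BijectiveAntipode k A] (C : Set (HHop k A)) (hC : Set.range (phi k A) ⊆ C)
    (D : TangleDiagram) (n : ℕ) (o o' : ComponentOrdering D n)
    (h : ∀ i, (o.comp i).IsRotated (o'.comp i)) :
    phiPower hC o.IsClosed (universalInvariant k A o.code o.IsClosed) =
      heisenbergInvariant k A C o'.code o.IsClosed := by
  have hG : OccursOnce o'.code.comp := o'.occursOnce_word
  -- This one map computes both invariants, each from the images of the universal labels.
  obtain ⟨Λ, hΛ⟩ := (isBimultilinear_crossingLabel
    (wordMap hG (componentMap C o'.code o.IsClosed))).exists_multilinear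
  -- J is first moved to the base points of `o'`, from which J'' is read.
  rw [ComponentOrdering.universalInvariant_eq h,
    phiPower_universalInvariant hC o'.code o.IsClosed hG Λ hΛ,
    heisenbergInvariant_eq C o'.code o.IsClosed hG Λ hΛ]
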